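/- Let $N\ge 1$, let $\Omega=\{x\in\mathbb R^N : x_N>0\}$ be the upper half-space, let $s\in(1/2,1)$, $\beta>0$, and let $\gamma,\nu_0>0$ be constants. For a real function $\psi$ on $\Omega$ with weak gradient $\nabla\psi$, put $$\mathcal L[\psi](x)=\gamma\,\nu_0^{1-2s}\,\Gamma(2s)\ \mathrm{P.V.}\!\int_\Omega \nabla\psi(y)\cdot\frac{y-x}{|y-x|^{N+2s}}\,dy,\qquad \mathrm{P.V.}\!\int_\Omega=\lim_{\varepsilon\to0^+}\int_{\Omega\setminus B_\varepsilon(x)} .$$ For $0<\sigma<1$ let $H^\sigma(\Omega)$ be the space of $\varphi\in L^2(\Omega)$ with $\|\varphi\|_{H^\sigma}^2=\|\varphi\|_{L^2}^2+\int_\Omega\int_\Omega\frac{|\varphi(x)-\varphi(y)|^2}{|x-y|^{N+2\sigma}}\,dx\,dy<\infty$, let $H^0(\Omega)=L^2(\Omega)$, and for $r\ge 1$ let $H^r(\Omega)$ be the space of $\varphi\in L^2(\Omega)$ whose weak first derivatives belong to $H^{r-1}(\Omega)$, with $\|\varphi\|_{H^r}^2=\|\varphi\|_{L^2}^2+\sum_{i=1}^N\|\partial_i\varphi\|_{H^{r-1}}^2$.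 There is a constant $C>0$, depending only on $N,s,\beta,\gamma,\nu_0$, such that the following holds for every $\psi\in H^{2s+\beta}(\Omega)$. The principal value defining $\mathcal L[\psi](x)$ exists for almost every $x\in\Omega$ (the truncated integrals being absolutely convergent), and: (i) If $s<3/4$, then $\mathcal L[\psi]\in L^2(\Omega)$ and $\|\mathcal L[\psi]\|_{L^2(\Omega)}\le C\,\|\psi\|_{H^{2s+\beta}(\Omega)}$. (ii) If $s\ge 3/4$, then $\mathcal L[\psi]\in L^2(\Omega)$ if and only if $$\int_\Omega \left|x_N^{1-2s}\,\partial_{x_N}\psi(x)\right|^2dx<\infty .$$ Moreover $\partial_{x_N}\psi\in H^{2s+\beta-1}(\Omega)$ has a well-defined trace in $L^2(\partial\Omega)$ (i.e. there is exactly one $g\in L^2(\partial\Omega)$ for which there are functions $\varphi_k\in H^{2s+\beta-1}(\Omega)$, restrictions of functions in $C^\infty(\mathbb R^N)$, with $\varphi_k\to\partial_{x_N}\psi$ in $H^{2s+\beta-1}(\Omega)$ and $\varphi_k|_{\partial\Omega}\to g$ in $L^2(\partial\Omega)$), and $\mathcal L[\psi]\in L^2(\Omega)$ if and only if $\partial_{x_N}\psi=0$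 on $\partial\Omega$ in the sense of this trace. When these equivalent conditions are satisfied, $\|\mathcal L[\psi]\|_{L^2(\Omega)}\le C\,\|\psi\|_{H^{2s+\beta}(\Omega)}$. -/

import Mathlib

open MeasureTheory Filter Topology
open scoped ENNReal ContDiff

noncomputable section

/-- The Euclidean space `ℝ^N`, where `N = n + 1 ≥ 1`. -/
abbrev FullSpace (n : ℕ) : Type := EuclideanSpace ℝ (Fin (n + 1))

/-- The upper half space `Ω = {x ∈ ℝ^N : x_N > 0}`, where `N = n + 1`. -/
def upperHalf (n : ℕ) : Set (FullSpace n) := {x | 0 < x (Fin.last n)}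

/-- Lebesgue measure on the upper half space. -/
def halfVol (n : ℕ) : Measure (FullSpace n) := volume.restrict (upperHalf n)

/-- The point `(x', 0)` of `∂Ω` with tangential coordinates `x' ∈ ℝ^(N-1)`. -/
def bdryPoint {n : ℕ} (x' : EuclideanSpace ℝ (Fin n)) : FullSpace n :=
  WithLp.toLp 2 (Fin.snoc (α := fun _ => ℝ) (fun i => x' i) 0)

/-- `g` is a weak partial derivative of `u` in `Ω` in the direction of the `i`-th coordinate. -/
def HasWeakPartial {n : ℕ} (i : Fin (n + 1)) (u g : FullSpace n → ℝ) : Prop :=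
  LocallyIntegrableOn u (upperHalf n) volume ∧
  LocallyIntegrableOn g (upperHalf n) volume ∧
  ∀ φ : FullSpace n → ℝ, ContDiff ℝ ∞ φ → HasCompactSupport φ → tsupport φ ⊆ upperHalf n →
    ∫ x in upperHalf n, u x * fderiv ℝ φ x (EuclideanSpace.single i 1) =
      - ∫ x in upperHalf n, g x * φ x

open Classical in
/-- The weak partial derivative `∂_i u` in `Ω` (a representative of it, unique up to null sets);
by convention it is `0` if there is none. -/
def weakPartial {n : ℕ} (i : Fin (n + 1)) (u : FullSpace n → ℝ) : FullSpace n → ℝ :=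
  if h : ∃ g, HasWeakPartial i u g then h.choose else 0

/-- The square of the Gagliardo seminorm,
`∫_Ω ∫_Ω |u(x) - u(y)|² / |x - y|^(N + 2σ) dx dy`. -/
def gagliardoSq {n : ℕ} (σ : ℝ) (u : FullSpace n → ℝ) : ℝ≥0∞ :=
  ∫⁻ x, ∫⁻ y, ENNReal.ofReal ((u x - u y) ^ 2 / ‖x - y‖ ^ (((n + 1 : ℕ) : ℝ) + 2 * σ))
    ∂(halfVol n) ∂(halfVol n)

open Classical in
/-- The square of the norm of `H^(m + σ)(Ω)`, for `m` a natural number and `0 ≤ σ < 1`: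
* `‖u‖²_{L²}` if `m = 0`, `σ = 0`;
* `‖u‖²_{L²} + [u]²_σ` if `m = 0`, `0 < σ`;
* `‖u‖²_{L²} + ∑ i, ‖∂_i u‖²_{H^(m - 1 + σ)}` if `1 ≤ m`, which is infinite if one of the
  weak derivatives does not exist. -/
def sobolevNormSqAux {n : ℕ} : ℕ → ℝ → (FullSpace n → ℝ) → ℝ≥0∞
  | 0, σ, u => eLpNorm u 2 (halfVol n) ^ 2 + (if 0 < σ then gagliardoSq σ u else 0)
  | m + 1, σ, u => eLpNorm u 2 (halfVol n) ^ 2 +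
      ∑ i : Fin (n + 1),
        (if ∃ g, HasWeakPartial i u g then sobolevNormSqAux m σ (weakPartial i u) else ⊤)

/-- The norm of the Sobolev space `H^r(Ω)`, `r ≥ 0`, with value `⊤` outside of the space. -/
def sobolevNorm {n : ℕ} (r : ℝ) (u : FullSpace n → ℝ) : ℝ≥0∞ :=
  sobolevNormSqAux ⌊r⌋₊ (Int.fract r) u ^ (1 / 2 : ℝ)

/-- `u ∈ H^r(Ω)`, for `r ≥ 0`. -/
def MemH {n : ℕ} (r : ℝ) (u : FullSpace n → ℝ) : Prop :=
  AEStronglyMeasurable u (halfVol n) ∧ sobolevNorm r u < ⊤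

/-- `g ∈ L²(∂Ω)` is the trace on `∂Ω` of `v ∈ H^τ(Ω)`, `τ > 1/2`. The trace operator is the
continuous extension of the restriction `φ ↦ φ|_∂Ω` of functions that are smooth up to the
boundary: there are such functions `φ_k` with `φ_k → v` in `H^τ(Ω)` and `φ_k|_∂Ω → g`
in `L²(∂Ω)`. -/
def HasTrace {n : ℕ} (τ : ℝ) (v : FullSpace n → ℝ)
    (g : Lp ℝ 2 (volume : Measure (EuclideanSpace ℝ (Fin n)))) : Prop :=
  ∃ φ : ℕ → FullSpace n → ℝ,
    (∀ k, ContDiff ℝ ∞ (φ k) ∧ MemH τ (φ k)) ∧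
    Tendsto (fun k => sobolevNorm τ (fun x => φ k x - v x)) atTop (𝓝 0) ∧
    Tendsto (fun k => eLpNorm (fun x' => φ k (bdryPoint x') - g x') 2 volume) atTop (𝓝 0)

/-- The integrand `∇ψ(y) · (y - x) / |y - x|^(N + 2s)`. -/
def opIntegrand {n : ℕ} (s : ℝ) (ψ : FullSpace n → ℝ) (x y : FullSpace n) : ℝ :=
  (∑ i : Fin (n + 1), weakPartial i ψ y * (y i - x i)) /
    ‖y - x‖ ^ (((n + 1 : ℕ) : ℝ) + 2 * s)

/-- The truncated integral `∫_{Ω \ B_ε(x)} ∇ψ(y) · (y - x) / |y - x|^(N + 2s) dy`. -/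
def truncInt {n : ℕ} (s : ℝ) (ψ : FullSpace n → ℝ) (x : FullSpace n) (ε : ℝ) : ℝ :=
  ∫ y in upperHalf n \ Metric.ball x ε, opIntegrand s ψ x y

/-- The principal value integral defining `𝓛[ψ](x)` exists. -/
def PVExists {n : ℕ} (s : ℝ) (ψ : FullSpace n → ℝ) (x : FullSpace n) : Prop :=
  (∀ ε > 0, IntegrableOn (opIntegrand s ψ x) (upperHalf n \ Metric.ball x ε) volume) ∧
  ∃ l : ℝ, Tendsto (truncInt s ψ x) (𝓝[>] 0) (𝓝 l)

/-- The operator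
`𝓛[ψ](x) = γ ν₀^(1 - 2s) Γ(2s) P.V. ∫_Ω ∇ψ(y) · (y - x) / |y - x|^(N + 2s) dy`. -/
def opL {n : ℕ} (γ ν₀ s : ℝ) (ψ : FullSpace n → ℝ) (x : FullSpace n) : ℝ :=
  γ * ν₀ ^ (1 - 2 * s) * Real.Gamma (2 * s) * limUnder (𝓝[>] (0 : ℝ)) (truncInt s ψ x)

end

/-! Write f = ∇ψ, K(z) = z/|z|^(N+2s) and t = x_N. Replacing f(y) by (f(y) − f(x)) + f(x) in the
truncated integral separates two contributions. The first has kernel of size |f(y) − f(x)| |y −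
x|^(−N−(2s−1)). If f lies in H^τ for some τ > 2s − 1, Cauchy–Schwarz makes it absolutely convergent
for a.e. x and bounded in L² (`lintegral_sq_lintegral_sub_mul_le`, `lintegral_sq_regularPart_le`).

The second is f(x) times the integral of K(y − x) over Ω \ B_ε(x). For ε < t the slab |z_N| < t
minus the ball is symmetric under z ↦ −z and contributes nothing. Over the remaining half space z_N
≥ t, the tangential components vanish by reflection and the normal one equals κ t^(1−2s) with κ > 0,
by homogeneity (`setIntegral_opKernel_truncated`). Hence the principal value exists and, up to a
positive factor, the operator is the regular part plus κ x_N^(1−2s) ∂_Nψ (`ae_principalValue`,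
`exists_opL_estimate`). Membership in L² therefore depends only on the weighted normal derivative,
and the theorem becomes a fractional Hardy inequality with σ = 2s − 1 for v = ∂_Nψ.

The Hardy inequality is proved with averages of v over balls of radius t = 2^(−k) at height
comparable to t. Consecutive averages differ in L²(∂Ω) by at most a constant times t^(τ−1/2) [v]_τ
(`lintegral_avgMeasure_pair_le`). If τ < 1/2, the averages grow at most like t^(τ−1/2). If τ > 1/2,
they converge at that rate to a limit, the trace, so they are O(t^(τ−1/2)) when the trace vanishes.
In both situations the layer x_N ∼ t contributes O(t^(2τ−2σ)) to the weighted integral, and the sum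
over k is geometric (`exists_hardy_of_dyadicAvg_le`). Conversely, for σ ≥ 1/2 a finite weighted
integral forces the averages to zero (`tendsto_lintegral_dyadicAvg_sq`), so the trace is zero. The
threshold σ = 1/2 is s = 3/4.

The limit of the averages agrees with the trace defined by smooth approximation because averages of
smooth functions converge to boundary values with an estimate in the H^τ norm, and because
mollification with a kernel supported below the boundary provides smooth approximants in every H^r
(`exists_trace`, `sobolevNormSqAux_mollify`). -/

/-! ### Square integrals and powers of the norm. -/

/-- The square of the norm of `L²(Ω)`. -/
noncomputable def sqNorm {n : ℕ} (v : FullSpace n → ℝ) : ℝ≥0∞ := ∫⁻ x, ‖v x‖ₑ ^ 2 ∂(halfVol n)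

/-- The power `‖z‖ ^ a` of the norm, as an extended nonnegative number. -/
noncomputable def normPow {n : ℕ} (a : ℝ) (z : FullSpace n) : ℝ≥0∞ := ENNReal.ofReal (‖z‖ ^ a)

theorem measurable_normPow {n : ℕ} (a : ℝ) : Measurable (normPow a : FullSpace n → ℝ≥0∞) := by
  unfold normPow; fun_prop

theorem normPow_neg_arg {n : ℕ} (a : ℝ) (z : FullSpace n) : normPow a (-z) = normPow a z := by
  simp [normPow]

theorem normPow_sub_comm {n : ℕ} (a : ℝ) (x y : FullSpace n) :
    normPow a (x - y) = normPow a (y - x) := by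
  rw [← neg_sub, normPow_neg_arg]

theorem normPow_mul {n : ℕ} {z : FullSpace n} (hz : z ≠ 0) (a b : ℝ) :
    normPow a z * normPow b z = normPow (a + b) z := by
  have : 0 < ‖z‖ := norm_pos_iff.2 hz
  rw [normPow, normPow, normPow, ← ENNReal.ofReal_mul (by positivity), Real.rpow_add this]

theorem normPow_le_normPow_of_norm_le_one {n : ℕ} {z : FullSpace n} (hz : ‖z‖ ≤ 1) {a b : ℝ}
    (h : a ≤ b) (h0 : z ≠ 0) : normPow b z ≤ normPow a z :=
  ENNReal.ofReal_le_ofReal (Real.rpow_le_rpow_of_exponent_ge (norm_pos_iff.2 h0) hz h)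

theorem eLpNorm_two_sq {α : Type*} {m : MeasurableSpace α} (μ : Measure α) (v : α → ℝ) :
    eLpNorm v 2 μ ^ 2 = ∫⁻ x, ‖v x‖ₑ ^ 2 ∂μ := by
  have := eLpNorm_nnreal_pow_eq_lintegral (μ := μ) (f := v) (p := 2) (by norm_num)
  simpa using this

theorem eLpNorm_two_eq {α : Type*} {m : MeasurableSpace α} (μ : Measure α) (v : α → ℝ) :
    eLpNorm v 2 μ = (∫⁻ x, ‖v x‖ₑ ^ 2 ∂μ) ^ (1 / 2 : ℝ) := by
  rw [← eLpNorm_two_sq, ← ENNReal.rpow_natCast, ← ENNReal.rpow_mul]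
  norm_num

theorem memLp_two_iff {α : Type*} {m : MeasurableSpace α} {μ : Measure α} {v : α → ℝ}
    (hv : AEStronglyMeasurable v μ) : MemLp v 2 μ ↔ ∫⁻ x, ‖v x‖ₑ ^ 2 ∂μ < ⊤ := by
  rw [MemLp, eLpNorm_two_eq, ENNReal.rpow_lt_top_iff_of_pos (by norm_num)]
  simp [hv]

theorem enorm_sub_sq_le (a b : ℝ) : ‖a - b‖ₑ ^ 2 ≤ 2 * ‖a‖ₑ ^ 2 + 2 * ‖b‖ₑ ^ 2 := by
  simp only [Real.enorm_eq_ofReal_abs, ← ENNReal.ofReal_pow (abs_nonneg _), sq_abs]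
  rw [show (2 : ℝ≥0∞) = ENNReal.ofReal 2 by simp, ← ENNReal.ofReal_mul (by norm_num),
    ← ENNReal.ofReal_mul (by norm_num), ← ENNReal.ofReal_add (by positivity) (by positivity)]
  apply ENNReal.ofReal_le_ofReal
  nlinarith [sq_nonneg (a + b)]

theorem enorm_add_sq_le (a b : ℝ) : ‖a + b‖ₑ ^ 2 ≤ 2 * ‖a‖ₑ ^ 2 + 2 * ‖b‖ₑ ^ 2 := by
  simpa using enorm_sub_sq_le a (-b)

theorem sq_lintegral_mul_le {α : Type*} {m : MeasurableSpace α} (μ : Measure α)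
    {f g : α → ℝ≥0∞} (hf : AEMeasurable f μ) (hg : AEMeasurable g μ) :
    (∫⁻ x, f x * g x ∂μ) ^ 2 ≤ (∫⁻ x, f x ^ 2 ∂μ) * ∫⁻ x, g x ^ 2 ∂μ := by
  have h := ENNReal.lintegral_mul_le_Lp_mul_Lq μ Real.HolderConjugate.two_two hf hg
  calc (∫⁻ x, f x * g x ∂μ) ^ 2 ≤ ((∫⁻ x, f x ^ (2:ℝ) ∂μ) ^ (1 / (2:ℝ)) *
      (∫⁻ x, g x ^ (2:ℝ) ∂μ) ^ (1 / (2:ℝ))) ^ 2 := by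
        gcongr; exact h
    _ = _ := by
        rw [mul_pow, ← ENNReal.rpow_natCast, ← ENNReal.rpow_natCast, ← ENNReal.rpow_mul,
          ← ENNReal.rpow_mul]
        norm_num

theorem sq_lintegral_le_of_isProbabilityMeasure {α : Type*} {m : MeasurableSpace α}
    (μ : Measure α) [IsProbabilityMeasure μ] {f : α → ℝ≥0∞} (hf : AEMeasurable f μ) :
    (∫⁻ x, f x ∂μ) ^ 2 ≤ ∫⁻ x, f x ^ 2 ∂μ := by
  simpa using sq_lintegral_mul_le μ hf (aemeasurable_const (b := (1 : ℝ≥0∞)))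

theorem sobolev_integrand_eq {n : ℕ} (σ : ℝ) (u : FullSpace n → ℝ) (x y : FullSpace n) :
    ENNReal.ofReal ((u x - u y) ^ 2 / ‖x - y‖ ^ (((n + 1 : ℕ) : ℝ) + 2 * σ)) =
      ‖u x - u y‖ₑ ^ 2 * normPow (-(((n + 1 : ℕ) : ℝ) + 2 * σ)) (x - y) := by
  rw [normPow, Real.rpow_neg (norm_nonneg _), div_eq_mul_inv, ENNReal.ofReal_mul (sq_nonneg _),
    Real.enorm_eq_ofReal_abs, ← ENNReal.ofReal_pow (abs_nonneg _), sq_abs]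

theorem gagliardoSq_eq {n : ℕ} (σ : ℝ) (u : FullSpace n → ℝ) :
    gagliardoSq σ u = ∫⁻ x, ∫⁻ y, ‖u x - u y‖ₑ ^ 2 *
      normPow (-(((n + 1 : ℕ) : ℝ) + 2 * σ)) (x - y) ∂(halfVol n) ∂(halfVol n) := by
  simp only [gagliardoSq, sobolev_integrand_eq]

theorem finrank_fullSpace (n : ℕ) : Module.finrank ℝ (FullSpace n) = n + 1 := by simp

theorem lintegral_normPow_near {n : ℕ} {a : ℝ} (ha : -((n + 1 : ℕ) : ℝ) < a) (r : ℝ) :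
    ∫⁻ z in Metric.ball (0 : FullSpace n) r, normPow a z < ⊤ := by
  have h : IntegrableOn (fun x : FullSpace n => ‖x‖ ^ a) (Metric.ball 0 r) := by
    rw [integrableOn_fun_norm_addHaar volume (f := fun t => t ^ a), finrank_fullSpace]
    have h1 : IntegrableOn (fun t : ℝ => t ^ (n + a)) (Set.Ioo 0 r) := by
      rcases le_or_gt r 0 with hr | hr
      · simp [Set.Ioo_eq_empty_of_le hr]
      · rw [intervalIntegral.integrableOn_Ioo_rpow_iff hr]
        push_cast at ha; linarith
    refine h1.congr_fun (fun t ht => ?_) measurableSet_Ioo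
    simp only [add_tsub_cancel_right, smul_eq_mul]
    rw [Real.rpow_add ht.1, Real.rpow_natCast]
  have := h.2
  rw [HasFiniteIntegral] at this
  refine lt_of_le_of_lt (lintegral_mono fun z => ?_) this
  rw [normPow, Real.enorm_eq_ofReal (by positivity)]

theorem lintegral_normPow_far {n : ℕ} {a : ℝ} (ha : a < -((n + 1 : ℕ) : ℝ)) {r : ℝ} (hr : 0 < r) :
    ∫⁻ z in (Metric.ball (0 : FullSpace n) r)ᶜ, normPow a z < ⊤ := by
  have h : Integrable ((Metric.ball (0 : FullSpace n) r)ᶜ.indicator (fun x : FullSpace n => ‖x‖ ^ a)) := by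
    have e : (Metric.ball (0 : FullSpace n) r)ᶜ.indicator (fun x : FullSpace n => ‖x‖ ^ a)
        = fun x => (Set.Ici r).indicator (fun t => t ^ a) ‖x‖ := by
      ext x; simp [Set.indicator]
    rw [e, integrable_fun_norm_addHaar volume (f := (Set.Ici r).indicator fun t => t ^ a),
      finrank_fullSpace]
    have h1 : IntegrableOn (fun t : ℝ => t ^ (n + a)) (Set.Ici r) := by
      rw [integrableOn_Ici_iff_integrableOn_Ioi, integrableOn_Ioi_rpow_iff hr]
      push_cast at ha; linarith
    have h2 : IntegrableOn ((Set.Ici r).indicator (fun t : ℝ => t ^ (n + a))) (Set.Ioi 0) :=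
      ((integrable_indicator_iff measurableSet_Ici).2 h1).integrableOn
    refine h2.congr_fun (fun t ht => ?_) measurableSet_Ioi
    by_cases h : t ∈ Set.Ici r
    · simp only [add_tsub_cancel_right, smul_eq_mul, Set.indicator_of_mem h]
      rw [Real.rpow_add ht, Real.rpow_natCast]
    · simp [Set.indicator_of_notMem h]
  rw [integrable_indicator_iff measurableSet_ball.compl] at h
  have := h.2
  rw [HasFiniteIntegral] at this
  refine lt_of_le_of_lt (lintegral_mono fun z => ?_) this
  rw [normPow, Real.enorm_eq_ofReal (by positivity)]

/-! ### The half space and Gagliardo integrals on it. -/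

theorem measurableSet_upperHalf (n : ℕ) : MeasurableSet (upperHalf n) := by
  have : upperHalf n = (fun x : FullSpace n => x (Fin.last n)) ⁻¹' Set.Ioi 0 := rfl
  rw [this]
  exact measurableSet_preimage (by fun_prop) measurableSet_Ioi

theorem isOpen_upperHalf (n : ℕ) : IsOpen (upperHalf n) := by
  have : upperHalf n = (fun x : FullSpace n => x (Fin.last n)) ⁻¹' Set.Ioi 0 := rfl
  rw [this]
  exact isOpen_Ioi.preimage (by fun_prop)

instance (n : ℕ) : SFinite (halfVol n) := by unfold halfVol; infer_instance

theorem halfVol_le (n : ℕ) : halfVol n ≤ volume := Measure.restrict_le_self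

theorem ae_halfVol_mem (n : ℕ) : ∀ᵐ x ∂(halfVol n), x ∈ upperHalf n :=
  ae_restrict_mem (measurableSet_upperHalf n)

/-- The square of the difference is at most 2|v(x)|² + 2|v(y)|², and for each term the other
variable integrates out by translation invariance. This disposes of kernels away from the diagonal.
-/
theorem lintegral_sq_sub_mul_le {n : ℕ} {v : FullSpace n → ℝ} (hv : Measurable v)
    {h : FullSpace n → ℝ≥0∞} (hh : Measurable h) :
    ∫⁻ x, ∫⁻ y, ‖v x - v y‖ₑ ^ 2 * h (x - y) ∂(halfVol n) ∂(halfVol n) ≤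
      4 * (∫⁻ z, h z) * sqNorm v := by
  calc ∫⁻ x, ∫⁻ y, ‖v x - v y‖ₑ ^ 2 * h (x - y) ∂(halfVol n) ∂(halfVol n)
      ≤ ∫⁻ x, ∫⁻ y, (2 * ‖v x‖ₑ ^ 2 * h (x - y) + 2 * ‖v y‖ₑ ^ 2 * h (x - y))
          ∂(halfVol n) ∂(halfVol n) := by
        gcongr with x y
        rw [← add_mul]
        gcongr
        exact enorm_sub_sq_le _ _
    _ = (∫⁻ x, ∫⁻ y, 2 * ‖v x‖ₑ ^ 2 * h (x - y) ∂(halfVol n) ∂(halfVol n)) +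
        ∫⁻ x, ∫⁻ y, 2 * ‖v y‖ₑ ^ 2 * h (x - y) ∂(halfVol n) ∂(halfVol n) := by
        rw [← lintegral_add_left (by fun_prop)]
        congr 1; ext x
        rw [lintegral_add_left (by fun_prop)]
    _ = (∫⁻ x, ∫⁻ y, 2 * ‖v x‖ₑ ^ 2 * h (x - y) ∂(halfVol n) ∂(halfVol n)) +
        ∫⁻ y, ∫⁻ x, 2 * ‖v y‖ₑ ^ 2 * h (x - y) ∂(halfVol n) ∂(halfVol n) := by
        congr 1
        rw [lintegral_lintegral_swap]
        fun_prop
    _ ≤ (∫⁻ x, 2 * ‖v x‖ₑ ^ 2 * (∫⁻ z, h z) ∂(halfVol n)) +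
        ∫⁻ y, 2 * ‖v y‖ₑ ^ 2 * (∫⁻ z, h z) ∂(halfVol n) := by
        gcongr with x y
        · rw [lintegral_const_mul _ (by fun_prop)]
          refine mul_le_mul' le_rfl ?_
          calc _ ≤ ∫⁻ y, h (x - y) := lintegral_mono' (halfVol_le n) le_rfl
            _ = _ := lintegral_sub_left_eq_self h x
        · rw [lintegral_const_mul _ (by fun_prop)]
          refine mul_le_mul' le_rfl ?_
          calc _ ≤ ∫⁻ x, h (x - y) := lintegral_mono' (halfVol_le n) le_rfl
            _ = _ := lintegral_sub_right_eq_self h y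
    _ = _ := by
        rw [lintegral_mul_const _ (by fun_prop), lintegral_const_mul _ (by fun_prop), sqNorm]
        ring

/-- The truncation of `normPow a` to the complement of the unit ball. -/
noncomputable def normPowFar {n : ℕ} (a : ℝ) : FullSpace n → ℝ≥0∞ :=
  (Metric.ball (0 : FullSpace n) 1)ᶜ.indicator (normPow a)

theorem measurable_normPowFar {n : ℕ} (a : ℝ) :
    Measurable (normPowFar a : FullSpace n → ℝ≥0∞) :=
  (measurable_normPow a).indicator measurableSet_ball.compl

theorem lintegral_normPowFar_lt_top {n : ℕ} {a : ℝ} (ha : a < -((n + 1 : ℕ) : ℝ)) :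
    ∫⁻ z : FullSpace n, normPowFar a z < ⊤ := by
  unfold normPowFar
  rw [lintegral_indicator measurableSet_ball.compl]
  exact lintegral_normPow_far ha one_pos

/-- For |x − y| < 1 the kernel of higher order is the larger one; for |x − y| ≥ 1 the kernel of
order σ is integrable and costs only the L² norm. -/
theorem gagliardoSq_mono_exponent {n : ℕ} {σ τ : ℝ} (hσ : 0 < σ) (h : σ ≤ τ) :
    ∃ C : ℝ≥0∞, C < ⊤ ∧ ∀ v : FullSpace n → ℝ, Measurable v →
      gagliardoSq σ v ≤ gagliardoSq τ v + C * sqNorm v := by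
  obtain ⟨a, ha⟩ : ∃ a, a = -(((n + 1 : ℕ) : ℝ) + 2 * σ) := ⟨_, rfl⟩
  refine ⟨4 * ∫⁻ z : FullSpace n, normPowFar a z, ENNReal.mul_lt_top (by simp)
    (lintegral_normPowFar_lt_top (by rw [ha]; linarith)), fun v hv => ?_⟩
  refine le_trans ?_ (add_le_add le_rfl (lintegral_sq_sub_mul_le hv (measurable_normPowFar a)))
  have hm := measurable_normPow (n := n)
  have hf := measurable_normPowFar (n := n) a
  rw [gagliardoSq_eq, gagliardoSq_eq, ← ha, ← lintegral_add_left]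
  swap
  · have := hm (-(((n + 1 : ℕ) : ℝ) + 2 * τ)); fun_prop
  gcongr with x
  rw [← lintegral_add_left]
  swap
  · have := hm (-(((n + 1 : ℕ) : ℝ) + 2 * τ)); fun_prop
  gcongr with y
  rw [← mul_add]
  rcases eq_or_ne x y with rfl | hxy
  · simp
  gcongr
  by_cases hz : ‖x - y‖ < 1
  · refine le_add_right (normPow_le_normPow_of_norm_le_one hz.le (by linarith)
      (sub_ne_zero.2 hxy))
  · refine le_add_left ?_
    rw [normPowFar, Set.indicator_of_mem]
    simpa using hz

theorem normPow_sq {n : ℕ} (a : ℝ) (z : FullSpace n) : normPow a z ^ 2 = normPow (2 * a) z := by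
  rw [normPow, normPow, ← ENNReal.ofReal_pow (by positivity), ← Real.rpow_natCast,
    ← Real.rpow_mul (norm_nonneg _), mul_comm]
  rfl

/-- Cauchy–Schwarz after factoring the kernel as p · q, with q square integrable on the whole space
and p² bounded by the Gagliardo kernel of order τ plus an integrable tail. -/
theorem lintegral_sq_lintegral_sub_mul_le {n : ℕ} {σ τ : ℝ} (hσ : 0 < σ) (h : σ < τ) :
    ∃ C : ℝ≥0∞, C < ⊤ ∧ ∀ v : FullSpace n → ℝ, Measurable v →
      ∫⁻ x, (∫⁻ y, ‖v x - v y‖ₑ * normPow (-(((n + 1 : ℕ) : ℝ) + σ)) (x - y) ∂(halfVol n)) ^ 2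
        ∂(halfVol n) ≤ C * (sqNorm v + gagliardoSq τ v) := by
  classical
  obtain ⟨N, hN⟩ : ∃ N : ℝ, N = ((n + 1 : ℕ) : ℝ) := ⟨_, rfl⟩
  rw [← hN]
  have hball : MeasurableSet {z : FullSpace n | z ∈ Metric.ball (0 : FullSpace n) 1} :=
    measurableSet_ball
  -- Near the origin p² = |z|^(−N−2τ) and q² = |z|^(−N+2(τ−σ)), which is integrable there because σ
  -- < τ. Away from the origin the kernel is split evenly, since |z|^(−N−σ) is itself integrable at
  -- infinity.
  let p : FullSpace n → ℝ≥0∞ := fun z => if z ∈ Metric.ball (0 : FullSpace n) 1 then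
    normPow (-(N / 2 + τ)) z else normPow (-((N + σ) / 2)) z
  let q : FullSpace n → ℝ≥0∞ := fun z => if z ∈ Metric.ball (0 : FullSpace n) 1 then
    normPow (-(N / 2 + σ - τ)) z else normPow (-((N + σ) / 2)) z
  have hp : Measurable p := Measurable.ite hball (measurable_normPow _) (measurable_normPow _)
  have hq : Measurable q := Measurable.ite hball (measurable_normPow _) (measurable_normPow _)
  have hpq : ∀ z : FullSpace n, z ≠ 0 → normPow (-(N + σ)) z = p z * q z := by
    intro z hz
    by_cases hb : z ∈ Metric.ball (0 : FullSpace n) 1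
    · simp only [p, q, if_pos hb, normPow_mul hz]; ring_nf
    · simp only [p, q, if_neg hb, normPow_mul hz]; ring_nf
  have hq2 : ∫⁻ z, q z ^ 2 < ⊤ := by
    rw [← lintegral_add_compl _ (measurableSet_ball (x := (0 : FullSpace n)) (ε := 1))]
    refine ENNReal.add_lt_top.2 ⟨?_, ?_⟩
    · rw [setLIntegral_congr_fun (g := normPow (2 * (-(N / 2 + σ - τ)))) measurableSet_ball
        (fun z hz => by simp only [q, if_pos hz, normPow_sq])]
      exact lintegral_normPow_near (by rw [← hN]; linarith) 1
    · rw [setLIntegral_congr_fun (g := normPow (2 * (-((N + σ) / 2)))) measurableSet_ball.compl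
        (fun z hz => by
          simp only [q, if_neg (show z ∉ Metric.ball (0 : FullSpace n) 1 from hz), normPow_sq])]
      exact lintegral_normPow_far (by rw [← hN]; linarith) one_pos
  have hp2 : ∀ z, p z ^ 2 ≤ normPow (-(N + 2 * τ)) z + normPowFar (-(N + σ)) z := by
    intro z
    by_cases hb : z ∈ Metric.ball (0 : FullSpace n) 1
    · simp only [p, if_pos hb, normPow_sq]
      refine le_add_right (le_of_eq ?_)
      ring_nf
    · simp only [p, if_neg hb, normPow_sq]
      refine le_add_left ?_
      rw [normPowFar, Set.indicator_of_mem (by exact hb)]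
      refine le_of_eq ?_
      ring_nf
  have hfar : ∫⁻ z : FullSpace n, normPowFar (-(N + σ)) z < ⊤ :=
    lintegral_normPowFar_lt_top (by rw [← hN]; linarith)
  set Q := ∫⁻ z, q z ^ 2
  set H := ∫⁻ z : FullSpace n, normPowFar (-(N + σ)) z
  refine ⟨Q * (4 * H + 1), ENNReal.mul_lt_top hq2 (ENNReal.add_lt_top.2
    ⟨ENNReal.mul_lt_top (by simp) hfar, by simp⟩), fun v hv => ?_⟩
  have hm1 := measurable_normPow (n := n) (-(N + 2 * τ))
  have hm2 := measurable_normPowFar (n := n) (-(N + σ))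
  calc ∫⁻ x, (∫⁻ y, ‖v x - v y‖ₑ * normPow (-(N + σ)) (x - y) ∂(halfVol n)) ^ 2 ∂(halfVol n)
      ≤ ∫⁻ x, Q * ∫⁻ y, ‖v x - v y‖ₑ ^ 2 * (normPow (-(N + 2 * τ)) (x - y)
          + normPowFar (-(N + σ)) (x - y)) ∂(halfVol n) ∂(halfVol n) := by
        refine lintegral_mono fun x => ?_
        have e : ∀ y, ‖v x - v y‖ₑ * normPow (-(N + σ)) (x - y) =
            (‖v x - v y‖ₑ * p (x - y)) * q (x - y) := by
          intro y
          rcases eq_or_ne x y with rfl | hxy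
          · simp
          · rw [hpq _ (sub_ne_zero.2 hxy), mul_assoc]
        simp only [e]
        refine (sq_lintegral_mul_le _ (by fun_prop) (by fun_prop)).trans ?_
        rw [mul_comm]
        refine mul_le_mul' ?_ (lintegral_mono fun y => ?_)
        · exact (lintegral_mono' (halfVol_le n) le_rfl).trans
            (lintegral_sub_left_eq_self (fun z => q z ^ 2) x).le
        · rw [mul_pow]
          exact mul_le_mul' le_rfl (hp2 _)
    _ = Q * ((∫⁻ x, ∫⁻ y, ‖v x - v y‖ₑ ^ 2 * normPow (-(N + 2 * τ)) (x - y)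
          ∂(halfVol n) ∂(halfVol n)) + ∫⁻ x, ∫⁻ y, ‖v x - v y‖ₑ ^ 2 *
          normPowFar (-(N + σ)) (x - y) ∂(halfVol n) ∂(halfVol n)) := by
        rw [lintegral_const_mul _ (by fun_prop), ← lintegral_add_left (by fun_prop)]
        congr 2; ext x
        rw [← lintegral_add_left (by fun_prop)]
        simp only [mul_add]
    _ ≤ Q * (gagliardoSq τ v + 4 * H * sqNorm v) := by
        rw [gagliardoSq_eq, ← hN]
        exact mul_le_mul' le_rfl (add_le_add le_rfl (lintegral_sq_sub_mul_le hv hm2))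
    _ ≤ Q * (4 * H + 1) * (sqNorm v + gagliardoSq τ v) := by
        rw [mul_assoc Q]
        refine mul_le_mul' le_rfl ?_
        rw [add_mul, mul_add, one_mul]
        calc _ ≤ (sqNorm v + gagliardoSq τ v) + 4 * H * sqNorm v :=
              add_le_add le_add_self le_rfl
          _ ≤ _ := by rw [add_comm]; exact add_le_add le_self_add le_rfl

/-! ### The kernel of the operator and its cancellations. -/

/-- The components `z_i / ‖z‖ ^ (N + 2 s)` of the kernel of the operator. -/
noncomputable def opKernel {n : ℕ} (s : ℝ) (i : Fin (n + 1)) (z : FullSpace n) : ℝ :=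
  z i / ‖z‖ ^ (((n + 1 : ℕ) : ℝ) + 2 * s)

theorem measurable_opKernel {n : ℕ} (s : ℝ) (i : Fin (n + 1)) :
    Measurable (opKernel s i : FullSpace n → ℝ) := by
  unfold opKernel
  have : Measurable fun z : FullSpace n => z i := by fun_prop
  fun_prop

theorem abs_apply_le_norm {n : ℕ} (z : FullSpace n) (i : Fin (n + 1)) : |z i| ≤ ‖z‖ :=
  PiLp.norm_apply_le z i

theorem abs_opKernel_le {n : ℕ} (s : ℝ) (i : Fin (n + 1)) (z : FullSpace n) :
    |opKernel s i z| ≤ ‖z‖ ^ (-(((n + 1 : ℕ) : ℝ) + (2 * s - 1))) := by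
  rcases eq_or_ne z 0 with rfl | hz
  · simp [opKernel]; positivity
  have hz' : 0 < ‖z‖ := norm_pos_iff.2 hz
  rw [opKernel, abs_div, abs_of_nonneg (a := ‖z‖ ^ _) (by positivity), div_le_iff₀ (by positivity),
    ← Real.rpow_add hz']
  ring_nf
  simpa using abs_apply_le_norm z i

theorem enorm_opKernel_le {n : ℕ} (s : ℝ) (i : Fin (n + 1)) (z : FullSpace n) :
    ‖opKernel s i z‖ₑ ≤ normPow (-(((n + 1 : ℕ) : ℝ) + (2 * s - 1))) z := by
  rw [Real.enorm_eq_ofReal_abs, normPow]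
  exact ENNReal.ofReal_le_ofReal (abs_opKernel_le s i z)

theorem integrableOn_opKernel {n : ℕ} {s : ℝ} (hs : 1 / 2 < s) (i : Fin (n + 1)) {r : ℝ}
    (hr : 0 < r) : IntegrableOn (opKernel s i : FullSpace n → ℝ) (Metric.ball 0 r)ᶜ := by
  refine ⟨(measurable_opKernel s i).aestronglyMeasurable, ?_⟩
  exact (lintegral_mono fun z => enorm_opKernel_le s i z).trans_lt
    (lintegral_normPow_far (by linarith) hr)

/-- An isometry preserves the volume and the denominator, so if it flips the numerator the integral
equals its own negative. It is applied to the central reflection and to reflections of one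
tangential coordinate. -/
theorem setIntegral_opKernel_eq_zero_of_symm {n : ℕ} (s : ℝ) (i : Fin (n + 1))
    {S : Set (FullSpace n)} (φ : FullSpace n ≃ₗᵢ[ℝ] FullSpace n)
    (hφS : φ ⁻¹' S = S) (hφ : ∀ z, φ z i = - z i) :
    ∫ z in S, opKernel s i z = 0 := by
  have h := (φ.measurePreserving).setIntegral_preimage_emb
    φ.toHomeomorph.measurableEmbedding (opKernel s i) S
  rw [hφS] at h
  have e : ∀ z, opKernel s i (φ z) = - opKernel s i z := by
    intro z; simp [opKernel, hφ, neg_div]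
  simp only [e, integral_neg] at h
  linarith

/-- The closed half space at height `t`. -/
def closedHalf (n : ℕ) (t : ℝ) : Set (FullSpace n) := {z | t ≤ z (Fin.last n)}

theorem measurableSet_closedHalf (n : ℕ) (t : ℝ) : MeasurableSet (closedHalf n t) :=
  measurableSet_le measurable_const (by fun_prop)

theorem closedHalf_subset_compl_ball {n : ℕ} {t r : ℝ} (h : r ≤ t) :
    closedHalf n t ⊆ (Metric.ball 0 r)ᶜ := by
  intro z hz
  simp only [closedHalf, Set.mem_ofPred_eq] at hz
  simp only [Set.mem_compl_iff, Metric.mem_ball, dist_zero_right, not_lt]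
  have := abs_apply_le_norm z (Fin.last n)
  have := le_abs_self (z (Fin.last n))
  linarith

/-- The constant of the boundary term of the operator. -/
noncomputable def bdryConst (n : ℕ) (s : ℝ) : ℝ :=
  ∫ z in closedHalf n 1, opKernel s (Fin.last n) z

/-- Strict positivity allows the weighted normal derivative to be recovered from the operator;
without it the L² condition would not be necessary. -/
theorem bdryConst_pos {n : ℕ} {s : ℝ} (hs : 1 / 2 < s) : 0 < bdryConst n s := by
  unfold bdryConst
  rw [setIntegral_pos_iff_support_of_nonneg_ae]
  · have ho : IsOpen {z : FullSpace n | 1 < z (Fin.last n)} :=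
      isOpen_lt continuous_const (by fun_prop)
    refine (ho.measure_pos volume ⟨EuclideanSpace.single (Fin.last n) 2, by simp⟩).trans_le
      (measure_mono fun z hz => ?_)
    simp only [Set.mem_ofPred_eq] at hz
    refine ⟨?_, hz.le⟩
    have : z ≠ 0 := by rintro rfl; simp at hz; linarith
    have : 0 < ‖z‖ := norm_pos_iff.2 this
    simp only [Function.mem_support, opKernel]
    positivity
  · filter_upwards [ae_restrict_mem (measurableSet_closedHalf n 1)] with z hz
    have : 0 ≤ z (Fin.last n) := zero_le_one.trans hz
    simp only [Pi.zero_apply, opKernel]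
    positivity
  · exact (integrableOn_opKernel hs _ one_pos).mono_set (closedHalf_subset_compl_ball le_rfl)

open scoped Pointwise in
-- Scaling by t: the kernel is homogeneous of degree 1 − N − 2s and the volume of degree N.
theorem setIntegral_opKernel_closedHalf_last {n : ℕ} (s : ℝ) {t : ℝ} (ht : 0 < t) :
    ∫ z in closedHalf n t, opKernel s (Fin.last n) z = bdryConst n s * t ^ (1 - 2 * s) := by
  have h := Measure.setIntegral_comp_smul_of_pos (volume : Measure (FullSpace n))
    (opKernel s (Fin.last n)) (closedHalf n 1) ht
  have hset : t • closedHalf n 1 = closedHalf n t := by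
    ext z
    rw [Set.mem_smul_set_iff_inv_smul_mem₀ ht.ne']
    simp only [closedHalf, Set.mem_ofPred_eq, PiLp.smul_apply, smul_eq_mul]
    rw [inv_mul_eq_div, one_le_div ht]
  rw [hset, finrank_fullSpace] at h
  have e : ∀ z : FullSpace n, opKernel s (Fin.last n) (t • z) =
      t ^ (1 - (((n + 1 : ℕ) : ℝ) + 2 * s)) * opKernel s (Fin.last n) z := by
    intro z
    simp only [opKernel, PiLp.smul_apply, smul_eq_mul, norm_smul, Real.norm_eq_abs, abs_of_pos ht]
    rw [Real.mul_rpow ht.le (norm_nonneg _), Real.rpow_sub ht, Real.rpow_one]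
    ring
  simp only [e] at h
  rw [integral_const_mul, smul_eq_mul] at h
  have h2 : (t ^ (n + 1)) * (t ^ (1 - (((n + 1 : ℕ) : ℝ) + 2 * s))) = t ^ (1 - 2 * s) := by
    rw [← Real.rpow_natCast, ← Real.rpow_add ht]; ring_nf
  rw [eq_inv_mul_iff_mul_eq₀ (by positivity), ← mul_assoc, h2] at h
  rw [← h, bdryConst, mul_comm]

theorem setIntegral_opKernel_closedHalf_of_ne {n : ℕ} (s : ℝ) {i : Fin (n + 1)}
    (hi : i ≠ Fin.last n) (t : ℝ) : ∫ z in closedHalf n t, opKernel s i z = 0 := by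
  let φ : FullSpace n ≃ₗᵢ[ℝ] FullSpace n := LinearIsometryEquiv.piLpCongrRight 2
    (fun j => if j = i then LinearIsometryEquiv.neg ℝ else LinearIsometryEquiv.refl ℝ ℝ)
  refine setIntegral_opKernel_eq_zero_of_symm s i φ ?_ ?_
  · ext z
    simp [closedHalf, φ, hi.symm]
  · intro z
    simp [φ]

/-- With x moved to the origin and t = x_N, the domain is {z_N > −t} minus a ball of radius ε < t.
Its part with |z_N| < t is centrally symmetric and cancels; the part z_N ≥ t does not meet the ball.
The value is thus independent of ε, which is what makes the principal value converge. -/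
theorem setIntegral_opKernel_truncated {n : ℕ} {s : ℝ} (hs : 1 / 2 < s) (i : Fin (n + 1))
    {x : FullSpace n} {ε : ℝ} (hε : 0 < ε) (hx : ε < x (Fin.last n)) :
    ∫ y in upperHalf n \ Metric.ball x ε, opKernel s i (y - x) =
      if i = Fin.last n then bdryConst n s * x (Fin.last n) ^ (1 - 2 * s) else 0 := by
  set t := x (Fin.last n)
  let S₁ : Set (FullSpace n) := {z | |z (Fin.last n)| < t} \ Metric.ball 0 ε
  have hS₁ : MeasurableSet S₁ :=
    (measurableSet_lt (by fun_prop) measurable_const).diff measurableSet_ball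
  have hset : upperHalf n \ Metric.ball x ε = (fun y => y - x) ⁻¹' (S₁ ∪ closedHalf n t) := by
    ext y
    have hb : y - x ∈ closedHalf n t → ε ≤ dist y x := by
      intro h
      have := closedHalf_subset_compl_ball hx.le h
      simpa [dist_eq_norm] using this
    simp only [upperHalf, Set.mem_sdiff, Set.mem_ofPred_eq, Metric.mem_ball, Set.preimage_union,
      Set.mem_union, Set.mem_preimage, S₁, dist_zero_right, ← dist_eq_norm, not_lt] at hb ⊢
    simp only [closedHalf, Set.mem_ofPred_eq, PiLp.sub_apply, abs_lt] at hb ⊢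
    constructor
    · rintro ⟨h1, h2⟩
      rcases lt_or_ge (y (Fin.last n) - x (Fin.last n)) t with h | h
      · exact Or.inl ⟨⟨by linarith, h⟩, h2⟩
      · exact Or.inr h
    · rintro (⟨⟨h1, h2⟩, h3⟩ | h)
      · exact ⟨by linarith, h3⟩
      · exact ⟨by linarith, hb h⟩
  have h1 : ∫ y in upperHalf n \ Metric.ball x ε, opKernel s i (y - x) =
      ∫ z in S₁ ∪ closedHalf n t, opKernel s i z := by
    rw [hset]
    exact (measurePreserving_sub_right volume x).setIntegral_preimage_emb
      (Homeomorph.subRight x).measurableEmbedding (opKernel s i) _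
  have hint := integrableOn_opKernel hs i hε
  rw [h1, setIntegral_union _ (measurableSet_closedHalf n t)
    (hint.mono_set fun z hz => hz.2)
    (hint.mono_set (closedHalf_subset_compl_ball hx.le)),
    setIntegral_opKernel_eq_zero_of_symm s i (LinearIsometryEquiv.neg ℝ), zero_add]
  · split_ifs with h
    · subst h
      exact setIntegral_opKernel_closedHalf_last s (hε.trans hx)
    · exact setIntegral_opKernel_closedHalf_of_ne s h t
  · ext z; simp [S₁]
  · intro z; simp
  · rw [Set.disjoint_left]
    rintro z ⟨hz, -⟩ hz'
    simp only [Set.mem_ofPred_eq, closedHalf] at hz hz'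
    linarith [le_abs_self (z (Fin.last n))]

/-! ### Splitting the operator into a regular part and a boundary term. -/

/-- The absolutely convergent part `∫_Ω (f(y) - f(x)) · (y - x) / |y - x|^(N + 2s) dy` of the
operator applied to a vector field `f`. -/
noncomputable def regularPart {n : ℕ} (s : ℝ) (f : Fin (n + 1) → FullSpace n → ℝ)
    (x : FullSpace n) : ℝ :=
  ∫ y in upperHalf n, ∑ i, (f i y - f i x) * opKernel s i (y - x)

theorem opIntegrand_eq {n : ℕ} (s : ℝ) (ψ : FullSpace n → ℝ) (x y : FullSpace n) :
    opIntegrand s ψ x y = ∑ i, weakPartial i ψ y * opKernel s i (y - x) := by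
  simp only [opIntegrand, opKernel, Finset.sum_div, mul_div_assoc, PiLp.sub_apply]

theorem stronglyMeasurable_regularPart {n : ℕ} (s : ℝ) {f : Fin (n + 1) → FullSpace n → ℝ}
    (hf : ∀ i, Measurable (f i)) : StronglyMeasurable (regularPart s f) := by
  have hk := measurable_opKernel (n := n) s
  have : Measurable (Function.uncurry fun x y : FullSpace n =>
      ∑ i, (f i y - f i x) * opKernel s i (y - x)) := by
    unfold Function.uncurry
    fun_prop
  exact this.stronglyMeasurable.integral_prod_right (ν := volume.restrict (upperHalf n))

theorem enorm_sub_mul_opKernel_le {n : ℕ} (s : ℝ) (i : Fin (n + 1)) (v : FullSpace n → ℝ)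
    (x y : FullSpace n) : ‖(v y - v x) * opKernel s i (y - x)‖ₑ ≤
      ‖v x - v y‖ₑ * normPow (-(((n + 1 : ℕ) : ℝ) + (2 * s - 1))) (x - y) := by
  rw [enorm_mul, ← enorm_neg (v y - v x), neg_sub, normPow_sub_comm]
  exact mul_le_mul' le_rfl (enorm_opKernel_le s i _)

/-- The kernel has size at most |z|^(−N−(2s−1)), so the weighted Cauchy–Schwarz bound applies with σ
= 2s − 1. The factor n + 1 in the constant comes from squaring a sum over the n + 1 coordinates. -/
theorem lintegral_sq_regularPart_le {n : ℕ} {s τ : ℝ} (hs : 1 / 2 < s) (hτ : 2 * s - 1 < τ) :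
    ∃ C : ℝ≥0∞, C < ⊤ ∧ ∀ f : Fin (n + 1) → FullSpace n → ℝ, (∀ i, Measurable (f i)) →
      ∫⁻ x, ‖regularPart s f x‖ₑ ^ 2 ∂(halfVol n) ≤
        C * ∑ i, (sqNorm (f i) + gagliardoSq τ (f i)) := by
  obtain ⟨C, hC, h⟩ := lintegral_sq_lintegral_sub_mul_le (n := n) (σ := 2 * s - 1) (τ := τ)
    (by linarith) hτ
  refine ⟨(n + 1 : ℕ) * C, ENNReal.mul_lt_top (by simp) hC, fun f hf => ?_⟩
  have hm := measurable_normPow (n := n) (-(((n + 1 : ℕ) : ℝ) + (2 * s - 1)))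
  calc ∫⁻ x, ‖regularPart s f x‖ₑ ^ 2 ∂(halfVol n)
      ≤ ∫⁻ x, ∑ i, (n + 1 : ℕ) * (∫⁻ y, ‖f i x - f i y‖ₑ *
          normPow (-(((n + 1 : ℕ) : ℝ) + (2 * s - 1))) (x - y) ∂(halfVol n)) ^ 2
          ∂(halfVol n) := by
        refine lintegral_mono fun x => ?_
        have h1 : ‖regularPart s f x‖ₑ ≤ ∑ i, ∫⁻ y, ‖f i x - f i y‖ₑ *
            normPow (-(((n + 1 : ℕ) : ℝ) + (2 * s - 1))) (x - y) ∂(halfVol n) := by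
          rw [← lintegral_finsetSum _ (fun i _ => by fun_prop)]
          refine (enorm_integral_le_lintegral_enorm _).trans (lintegral_mono fun y => ?_)
          refine (enorm_sum_le _ _).trans (Finset.sum_le_sum fun i _ => ?_)
          exact enorm_sub_mul_opKernel_le s i (f i) x y
        refine (pow_le_pow_left' h1 2).trans ?_
        have h2 := ENNReal.inner_le_Lp_mul_Lq (Finset.univ : Finset (Fin (n + 1)))
          (fun _ => 1) (fun i => ∫⁻ y, ‖f i x - f i y‖ₑ *
            normPow (-(((n + 1 : ℕ) : ℝ) + (2 * s - 1))) (x - y) ∂(halfVol n))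
          Real.HolderConjugate.two_two
        simp only [one_mul] at h2
        refine (pow_le_pow_left' h2 2).trans (le_of_eq ?_)
        rw [mul_pow, ← ENNReal.rpow_natCast, ← ENNReal.rpow_natCast, ← ENNReal.rpow_mul,
          ← ENNReal.rpow_mul, ← Finset.mul_sum]
        simp
    _ = ∑ i, (n + 1 : ℕ) * ∫⁻ x, (∫⁻ y, ‖f i x - f i y‖ₑ *
          normPow (-(((n + 1 : ℕ) : ℝ) + (2 * s - 1))) (x - y) ∂(halfVol n)) ^ 2
          ∂(halfVol n) := by
        have hJ : ∀ i, Measurable fun x => (∫⁻ y, ‖f i x - f i y‖ₑ *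
          normPow (-(((n + 1 : ℕ) : ℝ) + (2 * s - 1))) (x - y) ∂(halfVol n)) := by
          intro i
          refine Measurable.lintegral_prod_right' (f := fun p : FullSpace n × FullSpace n =>
            ‖f i p.1 - f i p.2‖ₑ * normPow (-(((n + 1 : ℕ) : ℝ) + (2 * s - 1))) (p.1 - p.2)) ?_
          fun_prop
        rw [lintegral_finsetSum _ (fun i _ => by fun_prop)]
        refine Finset.sum_congr rfl fun i _ => ?_
        rw [lintegral_const_mul _ (by fun_prop)]
    _ ≤ ∑ i, (n + 1 : ℕ) * (C * (sqNorm (f i) + gagliardoSq τ (f i))) := by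
        gcongr with i
        exact h _ (hf i)
    _ = _ := by
        rw [Finset.mul_sum]
        simp only [mul_assoc]

theorem ae_integrableOn_sub_mul_opKernel {n : ℕ} {s τ : ℝ} (hs : 1 / 2 < s) (hτ : 2 * s - 1 < τ)
    {v : FullSpace n → ℝ} (hv : Measurable v) (h0 : sqNorm v < ⊤) (h1 : gagliardoSq τ v < ⊤)
    (i : Fin (n + 1)) :
    ∀ᵐ x ∂(halfVol n), IntegrableOn (fun y => (v y - v x) * opKernel s i (y - x))
      (upperHalf n) := by
  obtain ⟨C, hC, h⟩ := lintegral_sq_lintegral_sub_mul_le (n := n) (σ := 2 * s - 1) (τ := τ)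
    (by linarith) hτ
  have hk := measurable_opKernel (n := n) s i
  have hm := measurable_normPow (n := n) (-(((n + 1 : ℕ) : ℝ) + (2 * s - 1)))
  have hJ : Measurable fun x => (∫⁻ y, ‖v x - v y‖ₑ *
      normPow (-(((n + 1 : ℕ) : ℝ) + (2 * s - 1))) (x - y) ∂(halfVol n)) := by
    refine Measurable.lintegral_prod_right' (f := fun p : FullSpace n × FullSpace n =>
      ‖v p.1 - v p.2‖ₑ * normPow (-(((n + 1 : ℕ) : ℝ) + (2 * s - 1))) (p.1 - p.2)) ?_
    fun_prop
  have hfin := ae_lt_top (hJ.pow_const 2) (ne_top_of_le_ne_top (ENNReal.mul_lt_top hC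
    (ENNReal.add_lt_top.2 ⟨h0, h1⟩)).ne (h v hv))
  filter_upwards [hfin] with x hx
  refine ⟨by fun_prop, ?_⟩
  refine (lintegral_mono fun y => enorm_sub_mul_opKernel_le s i v x y).trans_lt ?_
  by_contra hcon
  have : (∫⁻ y, ‖v x - v y‖ₑ * normPow (-(((n + 1 : ℕ) : ℝ) + (2 * s - 1))) (x - y)
    ∂(halfVol n)) = ⊤ := not_lt_top_iff.1 hcon
  rw [this] at hx
  simp at hx

/-- Cauchy–Schwarz: outside a ball the kernel is square integrable, because 2(N + 2s − 1) > N. -/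
theorem integrableOn_mul_opKernel {n : ℕ} {s : ℝ} (hs : 1 / 2 < s)
    {v : FullSpace n → ℝ} (hv : Measurable v) (h0 : sqNorm v < ⊤)
    (i : Fin (n + 1)) (x : FullSpace n) {ε : ℝ} (hε : 0 < ε) :
    IntegrableOn (fun y => v y * opKernel s i (y - x)) (upperHalf n \ Metric.ball x ε) := by
  have hk := measurable_opKernel (n := n) s i
  refine ⟨by fun_prop, ?_⟩
  rw [HasFiniteIntegral]
  simp only [enorm_mul]
  have hcs := sq_lintegral_mul_le (volume.restrict (upperHalf n \ Metric.ball x ε))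
    (f := fun y => ‖v y‖ₑ) (g := fun y => ‖opKernel s i (y - x)‖ₑ) (by fun_prop) (by fun_prop)
  have h1 : ∫⁻ y in upperHalf n \ Metric.ball x ε, ‖v y‖ₑ ^ 2 < ⊤ :=
    (lintegral_mono_set Set.sdiff_subset).trans_lt h0
  have h2 : ∫⁻ y in upperHalf n \ Metric.ball x ε, ‖opKernel s i (y - x)‖ₑ ^ 2 < ⊤ := by
    have e : (Metric.ball x ε)ᶜ = (fun y => y - x) ⁻¹' (Metric.ball 0 ε)ᶜ := by
      ext y; simp [dist_eq_norm]
    calc ∫⁻ y in upperHalf n \ Metric.ball x ε, ‖opKernel s i (y - x)‖ₑ ^ 2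
        ≤ ∫⁻ y in (Metric.ball x ε)ᶜ, ‖opKernel s i (y - x)‖ₑ ^ 2 :=
          lintegral_mono_set fun y hy => hy.2
      _ = ∫⁻ z in (Metric.ball 0 ε)ᶜ, ‖opKernel s i z‖ₑ ^ 2 := by
          rw [e]
          exact (measurePreserving_sub_right volume x).setLIntegral_comp_preimage_emb
            (Homeomorph.subRight x).measurableEmbedding (fun z => ‖opKernel s i z‖ₑ ^ 2) _
      _ ≤ ∫⁻ z in (Metric.ball 0 ε)ᶜ,
            normPow (2 * (-(((n + 1 : ℕ) : ℝ) + (2 * s - 1)))) z := by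
          refine lintegral_mono fun z => ?_
          rw [← normPow_sq]
          exact pow_le_pow_left' (enorm_opKernel_le s i z) 2
      _ < ⊤ := lintegral_normPow_far (by push_cast; linarith [n.cast_nonneg (α := ℝ)]) hε
  have := hcs.trans_lt (ENNReal.mul_lt_top h1 h2)
  simpa using this

/-- After subtracting f(x), dominated convergence removes the truncation; the subtracted part is
constant in ε as soon as ε < x_N. -/
theorem ae_principalValue {n : ℕ} {s τ : ℝ} (hs : 1 / 2 < s) (hτ : 2 * s - 1 < τ)
    {f : Fin (n + 1) → FullSpace n → ℝ} (hf : ∀ i, Measurable (f i))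
    (h0 : ∀ i, sqNorm (f i) < ⊤) (h1 : ∀ i, gagliardoSq τ (f i) < ⊤) :
    ∀ᵐ x ∂(halfVol n), Tendsto (fun ε => ∫ y in upperHalf n \ Metric.ball x ε,
      ∑ i, f i y * opKernel s i (y - x)) (𝓝[>] 0) (𝓝 (regularPart s f x +
        bdryConst n s * x (Fin.last n) ^ (1 - 2 * s) * f (Fin.last n) x)) := by
  have hint : ∀ᵐ x ∂(halfVol n), ∀ i, IntegrableOn
      (fun y => (f i y - f i x) * opKernel s i (y - x)) (upperHalf n) :=
    ae_all_iff.2 fun i => ae_integrableOn_sub_mul_opKernel hs hτ (hf i) (h0 i) (h1 i) i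
  filter_upwards [hint, ae_halfVol_mem n] with x hx hxΩ
  have hk := measurable_opKernel (n := n) s
  have hD : IntegrableOn (fun y => ∑ i, (f i y - f i x) * opKernel s i (y - x)) (upperHalf n) :=
    integrable_finsetSum _ fun i _ => hx i
  have hΩ := measurableSet_upperHalf n
  have hlim : Tendsto (fun ε => ∫ y in upperHalf n \ Metric.ball x ε,
      ∑ i, (f i y - f i x) * opKernel s i (y - x)) (𝓝[>] 0) (𝓝 (regularPart s f x)) := by
    have e : ∀ ε, ∫ y in upperHalf n \ Metric.ball x ε,
        ∑ i, (f i y - f i x) * opKernel s i (y - x) = ∫ y in upperHalf n,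
        (Metric.ball x ε)ᶜ.indicator
          (fun y => ∑ i, (f i y - f i x) * opKernel s i (y - x)) y := by
      intro ε
      rw [setIntegral_indicator measurableSet_ball.compl, Set.sdiff_eq]
    simp only [e]
    refine tendsto_integral_filter_of_dominated_convergence
      (fun y => ‖∑ i, (f i y - f i x) * opKernel s i (y - x)‖) ?_ ?_ hD.norm ?_
    · refine Eventually.of_forall fun ε => ?_
      exact hD.1.indicator measurableSet_ball.compl
    · exact Eventually.of_forall fun ε => Eventually.of_forall fun y => norm_indicator_le_norm_self _ _
    · refine Eventually.of_forall fun y => ?_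
      -- Convergence is checked at every y. At y = x the integrand vanishes because of the factor
      -- f(y) − f(x); at any other y the truncation is inactive for small ε.
      rcases eq_or_ne y x with rfl | hyx
      · have : (fun ε => (Metric.ball y ε)ᶜ.indicator
            (fun z => ∑ i, (f i z - f i y) * opKernel s i (z - y)) y) = fun _ => 0 := by
          ext ε
          by_cases h : y ∈ (Metric.ball y ε)ᶜ <;> simp [Set.indicator]
        rw [this]
        simp
      · refine tendsto_const_nhds.congr' ?_
        filter_upwards [Ioo_mem_nhdsGT (dist_pos.2 hyx)] with ε hε
        rw [Set.indicator_of_mem]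
        simpa using hε.2.le
  refine (hlim.add_const _).congr' ?_
  have hxN : 0 < x (Fin.last n) := hxΩ
  filter_upwards [Ioo_mem_nhdsGT hxN] with ε hε
  have hsub : upperHalf n \ Metric.ball x ε ⊆ upperHalf n := Set.sdiff_subset
  have hshift : ∀ i, IntegrableOn (fun y => opKernel s i (y - x))
      (upperHalf n \ Metric.ball x ε) := by
    intro i
    have e : (Metric.ball x ε)ᶜ = (fun y => y - x) ⁻¹' (Metric.ball 0 ε)ᶜ := by
      ext y; simp [dist_eq_norm]
    refine IntegrableOn.mono_set (t := (Metric.ball x ε)ᶜ) ?_ (fun y hy => hy.2)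
    rw [e]
    exact ((measurePreserving_sub_right volume x).integrableOn_comp_preimage
      (Homeomorph.subRight x).measurableEmbedding).2 (integrableOn_opKernel hs i hε.1)
  have hsum : ∀ y, ∑ i, f i y * opKernel s i (y - x) =
      (∑ i, (f i y - f i x) * opKernel s i (y - x)) + ∑ i, f i x * opKernel s i (y - x) := by
    intro y
    rw [← Finset.sum_add_distrib]
    exact Finset.sum_congr rfl fun i _ => by ring
  simp only [hsum]
  rw [integral_add (hD.mono_set hsub)
    (integrable_finsetSum _ fun i _ => (hshift i).const_mul _)]
  congr 1
  rw [integral_finsetSum _ fun i _ => (hshift i).const_mul _]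
  simp only [integral_const_mul, setIntegral_opKernel_truncated hs _ hε.1 hε.2]
  simp
  ring

theorem truncInt_congr {n : ℕ} (s : ℝ) {ψ : FullSpace n → ℝ} {f : Fin (n + 1) → FullSpace n → ℝ}
    (hψ : ∀ i, weakPartial i ψ =ᵐ[halfVol n] f i) (x : FullSpace n) :
    opIntegrand s ψ x =ᵐ[halfVol n] fun y => ∑ i, f i y * opKernel s i (y - x) := by
  filter_upwards [ae_all_iff.2 hψ] with y hy
  simp only [opIntegrand_eq, hy]

theorem ae_restrict_diff_of_ae_halfVol {n : ℕ} {p : FullSpace n → Prop}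
    (h : ∀ᵐ y ∂(halfVol n), p y) (x : FullSpace n) (ε : ℝ) :
    ∀ᵐ y ∂(volume.restrict (upperHalf n \ Metric.ball x ε)), p y :=
  ae_mono (Measure.restrict_mono Set.sdiff_subset le_rfl) h

/-- A chosen weak derivative is determined only up to null sets and need not be Borel measurable.
The computation is therefore made for measurable representatives and transferred, since changing the
gradient on a null set changes no truncated integral. -/
theorem ae_PVExists_and_opL_eq {n : ℕ} {s τ : ℝ} (hs : 1 / 2 < s) (hτ : 2 * s - 1 < τ) (γ ν₀ : ℝ)
    {ψ : FullSpace n → ℝ} {f : Fin (n + 1) → FullSpace n → ℝ}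
    (hψ : ∀ i, weakPartial i ψ =ᵐ[halfVol n] f i) (hf : ∀ i, Measurable (f i))
    (h0 : ∀ i, sqNorm (f i) < ⊤) (h1 : ∀ i, gagliardoSq τ (f i) < ⊤) :
    (∀ᵐ x ∂(halfVol n), PVExists s ψ x) ∧
    opL γ ν₀ s ψ =ᵐ[halfVol n] fun x => γ * ν₀ ^ (1 - 2 * s) * Real.Gamma (2 * s) *
      (regularPart s f x + bdryConst n s * x (Fin.last n) ^ (1 - 2 * s) * f (Fin.last n) x) := by
  have ht : ∀ x, truncInt s ψ x = fun ε => ∫ y in upperHalf n \ Metric.ball x ε,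
      ∑ i, f i y * opKernel s i (y - x) := by
    intro x
    ext ε
    exact integral_congr_ae (ae_restrict_diff_of_ae_halfVol (truncInt_congr s hψ x) x ε)
  have hpv := ae_principalValue hs hτ hf h0 h1
  constructor
  · filter_upwards [hpv] with x hx
    refine ⟨fun ε hε => ?_, _, (ht x).symm ▸ hx⟩
    have hi : IntegrableOn (fun y => ∑ i, f i y * opKernel s i (y - x))
        (upperHalf n \ Metric.ball x ε) :=
      integrable_finsetSum _ fun i _ => integrableOn_mul_opKernel hs (hf i) (h0 i) i x hε
    exact Integrable.congr hi
      (Filter.EventuallyEq.symm (ae_restrict_diff_of_ae_halfVol (truncInt_congr s hψ x) x ε))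
  · filter_upwards [hpv] with x hx
    rw [opL, ht x, hx.limUnder_eq]

/-! ### Averages over balls close to the boundary. -/

/-- The tangential coordinates of a point. -/
noncomputable def tangential {n : ℕ} (y : FullSpace n) : EuclideanSpace ℝ (Fin n) :=
  WithLp.toLp 2 fun i => y i.castSucc

/-- The point of `Ω` with tangential coordinates `x'` and normal coordinate `a`. -/
noncomputable def pointAbove {n : ℕ} (a : ℝ) (x' : EuclideanSpace ℝ (Fin n)) : FullSpace n :=
  bdryPoint x' + EuclideanSpace.single (Fin.last n) a

theorem measurable_last (n : ℕ) : Measurable fun y : FullSpace n => y (Fin.last n) := by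
  fun_prop

theorem pointAbove_last {n : ℕ} (a : ℝ) (x' : EuclideanSpace ℝ (Fin n)) :
    pointAbove a x' (Fin.last n) = a := by
  simp [pointAbove, bdryPoint]

theorem pointAbove_castSucc {n : ℕ} (a : ℝ) (x' : EuclideanSpace ℝ (Fin n)) (i : Fin n) :
    pointAbove a x' i.castSucc = x' i := by
  simp [pointAbove, bdryPoint]

theorem norm_sq_fullSpace {n : ℕ} (y : FullSpace n) :
    ‖y‖ ^ 2 = ‖tangential y‖ ^ 2 + y (Fin.last n) ^ 2 := by
  simp [EuclideanSpace.norm_sq_eq, Fin.sum_univ_castSucc, tangential]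

theorem norm_sub_pointAbove_sq {n : ℕ} (y : FullSpace n) (a : ℝ) (x' : EuclideanSpace ℝ (Fin n)) :
    ‖y - pointAbove a x'‖ ^ 2 = ‖tangential y - x'‖ ^ 2 + (y (Fin.last n) - a) ^ 2 := by
  rw [norm_sq_fullSpace]
  have : tangential (y - pointAbove a x') = tangential y - x' := by
    ext i; simp [tangential, pointAbove_castSucc]
  rw [this, PiLp.sub_apply, pointAbove_last]

theorem continuous_bdryPoint (n : ℕ) :
    Continuous (bdryPoint : EuclideanSpace ℝ (Fin n) → FullSpace n) := by
  unfold bdryPoint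
  refine (PiLp.continuous_toLp 2 _).comp (continuous_pi fun j => ?_)
  refine Fin.lastCases ?_ (fun i => ?_) j
  · simp [continuous_const]
  · simp only [Fin.snoc_castSucc]
    fun_prop

theorem continuous_pointAbove {n : ℕ} (a : ℝ) :
    Continuous (pointAbove a : EuclideanSpace ℝ (Fin n) → FullSpace n) :=
  (continuous_bdryPoint n).add continuous_const

/-- The ball of radius `t` about the point at height `3t/2` above `x'`. -/
def avgBall {n : ℕ} (t : ℝ) (x' : EuclideanSpace ℝ (Fin n)) : Set (FullSpace n) :=
  Metric.ball (pointAbove (3 / 2 * t) x') t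

theorem mem_avgBall_iff {n : ℕ} {t : ℝ} (ht : 0 < t) {x' : EuclideanSpace ℝ (Fin n)}
    {y : FullSpace n} : y ∈ avgBall t x' ↔
      ‖tangential y - x'‖ ^ 2 + (y (Fin.last n) - 3 / 2 * t) ^ 2 < t ^ 2 := by
  rw [avgBall, Metric.mem_ball, dist_eq_norm, ← norm_sub_pointAbove_sq,
    sq_lt_sq₀ (norm_nonneg _) ht.le]

theorem last_mem_of_mem_avgBall {n : ℕ} {t : ℝ} (ht : 0 < t) {x' : EuclideanSpace ℝ (Fin n)}
    {y : FullSpace n} (h : y ∈ avgBall t x') :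
    t / 2 < y (Fin.last n) ∧ y (Fin.last n) < 5 / 2 * t := by
  rw [mem_avgBall_iff ht] at h
  have : (y (Fin.last n) - 3 / 2 * t) ^ 2 < t ^ 2 := by
    linarith [sq_nonneg ‖tangential y - x'‖]
  have := abs_lt_of_sq_lt_sq' this ht.le
  constructor <;> linarith [this.1, this.2]

theorem avgBall_subset_upperHalf {n : ℕ} {t : ℝ} (ht : 0 < t) (x' : EuclideanSpace ℝ (Fin n)) :
    avgBall t x' ⊆ upperHalf n := fun y hy => by
  have := (last_mem_of_mem_avgBall ht hy).1
  show 0 < y (Fin.last n)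
  linarith

theorem measurableSet_avgBall {n : ℕ} (t : ℝ) (x' : EuclideanSpace ℝ (Fin n)) :
    MeasurableSet (avgBall t x') := measurableSet_ball

theorem measurableSet_avgBall_prod (n : ℕ) (t : ℝ) :
    MeasurableSet {p : EuclideanSpace ℝ (Fin n) × FullSpace n | p.2 ∈ avgBall t p.1} := by
  have : Continuous fun p : EuclideanSpace ℝ (Fin n) × FullSpace n =>
      dist p.2 (pointAbove (3 / 2 * t) p.1) :=
    continuous_snd.dist ((continuous_pointAbove _).comp continuous_fst)
  exact (isOpen_lt this continuous_const).measurableSet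

/-- The volume of `avgBall t x'`. -/
noncomputable def avgVol (n : ℕ) (t : ℝ) : ℝ≥0∞ :=
  ENNReal.ofReal (t ^ (n + 1)) * volume (Metric.ball (0 : FullSpace n) 1)

theorem volume_avgBall {n : ℕ} {t : ℝ} (ht : 0 < t) (x' : EuclideanSpace ℝ (Fin n)) :
    volume (avgBall t x') = avgVol n t := by
  rw [avgBall, Measure.addHaar_ball_of_pos _ _ ht, finrank_fullSpace, avgVol]

theorem avgVol_ne_zero {n : ℕ} {t : ℝ} (ht : 0 < t) : avgVol n t ≠ 0 := by
  rw [← volume_avgBall ht 0]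
  exact (Metric.measure_ball_pos _ _ ht).ne'

theorem avgVol_ne_top {n : ℕ} {t : ℝ} (ht : 0 < t) : avgVol n t ≠ ⊤ := by
  rw [← volume_avgBall ht 0]
  exact measure_ball_lt_top.ne

/-- The uniform probability measure on `avgBall t x'`. -/
noncomputable def avgMeasure {n : ℕ} (t : ℝ) (x' : EuclideanSpace ℝ (Fin n)) :
    Measure (FullSpace n) := (avgVol n t)⁻¹ • volume.restrict (avgBall t x')

theorem isProbabilityMeasure_avgMeasure {n : ℕ} {t : ℝ} (ht : 0 < t)
    (x' : EuclideanSpace ℝ (Fin n)) : IsProbabilityMeasure (avgMeasure t x') := by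
  constructor
  rw [avgMeasure, Measure.smul_apply, Measure.restrict_apply_univ, volume_avgBall ht, smul_eq_mul,
    ENNReal.inv_mul_cancel (avgVol_ne_zero ht) (avgVol_ne_top ht)]

theorem lintegral_avgMeasure {n : ℕ} (t : ℝ) (x' : EuclideanSpace ℝ (Fin n))
    (h : FullSpace n → ℝ≥0∞) :
    ∫⁻ y, h y ∂(avgMeasure t x') = (avgVol n t)⁻¹ * ∫⁻ y in avgBall t x', h y := by
  rw [avgMeasure, lintegral_smul_measure, smul_eq_mul]

/-- The average of `v` over `avgBall t x'`. -/
noncomputable def ballAvg {n : ℕ} (t : ℝ) (v : FullSpace n → ℝ)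
    (x' : EuclideanSpace ℝ (Fin n)) : ℝ := ∫ y, v y ∂(avgMeasure t x')

theorem stronglyMeasurable_ballAvg {n : ℕ} (t : ℝ) {v : FullSpace n → ℝ} (hv : Measurable v) :
    StronglyMeasurable (ballAvg t v : EuclideanSpace ℝ (Fin n) → ℝ) := by
  have e : (ballAvg t v : EuclideanSpace ℝ (Fin n) → ℝ) = fun x' => (avgVol n t)⁻¹.toReal * ∫ y,
      {p : EuclideanSpace ℝ (Fin n) × FullSpace n | p.2 ∈ avgBall t p.1}.indicator
        (fun p => v p.2) (x', y) := by
    ext x'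
    rw [ballAvg, avgMeasure, integral_smul_measure, smul_eq_mul,
      ← integral_indicator (measurableSet_avgBall t x')]
    rfl
  rw [e]
  have := ((hv.comp measurable_snd).stronglyMeasurable.indicator
    (measurableSet_avgBall_prod n t)).integral_prod_right' (ν := (volume : Measure (FullSpace n)))
  exact this.const_mul _

/-- Tonelli turns the integral of the averages into an integral weighted by the measure of the set
of admissible centres. Bounds on that measure from above and below convert between averages and
integrals over horizontal layers. -/
theorem lintegral_avgMeasure_tonelli {n : ℕ} (t : ℝ) {h : FullSpace n → ℝ≥0∞}
    (hh : Measurable h) :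
    ∫⁻ x', ∫⁻ y, h y ∂(avgMeasure t x') = (avgVol n t)⁻¹ *
      ∫⁻ y, h y * volume {x' : EuclideanSpace ℝ (Fin n) | y ∈ avgBall t x'} := by
  obtain ⟨F, hF⟩ : ∃ F : EuclideanSpace ℝ (Fin n) × FullSpace n → ℝ≥0∞, F =
    {p : EuclideanSpace ℝ (Fin n) × FullSpace n | p.2 ∈ avgBall t p.1}.indicator
      (fun p => h p.2) := ⟨_, rfl⟩
  have hind : Measurable F := by
    rw [hF]
    exact (hh.comp measurable_snd).indicator (measurableSet_avgBall_prod n t)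
  have e : ∀ x', ∫⁻ y, h y ∂(avgMeasure t x') = (avgVol n t)⁻¹ * ∫⁻ y, F (x', y) := by
    intro x'
    rw [lintegral_avgMeasure, ← lintegral_indicator (measurableSet_avgBall t x'), hF]
    rfl
  simp only [e]
  rw [lintegral_const_mul _ hind.lintegral_prod_right',
    lintegral_lintegral_swap (f := fun x' y => F (x', y)) hind.aemeasurable]
  congr 1
  refine lintegral_congr fun y => ?_
  have hm : MeasurableSet {x' : EuclideanSpace ℝ (Fin n) | y ∈ avgBall t x'} :=
    (isOpen_lt (continuous_const.dist (continuous_pointAbove (3 / 2 * t)))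
      continuous_const).measurableSet
  rw [← lintegral_indicator_const hm (h y), hF]
  rfl

/-- The volume of the unit ball of `ℝ^(N-1)`. -/
noncomputable def bdryBallVol (n : ℕ) : ℝ≥0∞ :=
  volume (Metric.ball (0 : EuclideanSpace ℝ (Fin n)) 1)

theorem volume_bdry_ball {n : ℕ} (x' : EuclideanSpace ℝ (Fin n)) {r : ℝ} (hr : 0 < r) :
    volume (Metric.ball x' r) = ENNReal.ofReal (r ^ n) * bdryBallVol n := by
  rw [Measure.addHaar_ball_of_pos _ _ hr, bdryBallVol]
  simp

/-- The layer of `Ω` that meets the balls `avgBall t x'`. -/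
def layer (n : ℕ) (t : ℝ) : Set (FullSpace n) :=
  {y | t / 2 < y (Fin.last n) ∧ y (Fin.last n) < 5 / 2 * t}

theorem measurableSet_layer (n : ℕ) (t : ℝ) : MeasurableSet (layer n t) :=
  measurableSet_preimage (measurable_last n) measurableSet_Ioo

theorem volume_centers_le {n : ℕ} {t : ℝ} (ht : 0 < t) (y : FullSpace n) :
    volume {x' : EuclideanSpace ℝ (Fin n) | y ∈ avgBall t x'} ≤
      (layer n t).indicator (fun _ => ENNReal.ofReal (t ^ n) * bdryBallVol n) y := by
  by_cases hy : y ∈ layer n t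
  · rw [Set.indicator_of_mem hy, ← volume_bdry_ball (tangential y) ht]
    refine measure_mono fun x' hx' => ?_
    have h := (mem_avgBall_iff ht).1 hx'
    rw [Metric.mem_ball, dist_comm, dist_eq_norm]
    refine lt_of_pow_lt_pow_left₀ 2 ht.le ?_
    linarith [sq_nonneg (y (Fin.last n) - 3 / 2 * t)]
  · rw [Set.indicator_of_notMem hy]
    have : {x' : EuclideanSpace ℝ (Fin n) | y ∈ avgBall t x'} = ∅ := by
      ext x'
      simp only [Set.mem_ofPred_eq, Set.mem_empty_iff_false, iff_false]
      exact fun h => hy (last_mem_of_mem_avgBall ht h)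
    simp [this]

/-- For t ≤ y_N ≤ 2t the vertical distance from y to the height 3t/2 is at most t/2. A horizontal
distance below t/2 then suffices, as t²/4 + t²/4 < t². -/
theorem le_volume_centers {n : ℕ} {t : ℝ} (ht : 0 < t) {y : FullSpace n}
    (h1 : t ≤ y (Fin.last n)) (h2 : y (Fin.last n) ≤ 2 * t) :
    ENNReal.ofReal ((t / 2) ^ n) * bdryBallVol n ≤
      volume {x' : EuclideanSpace ℝ (Fin n) | y ∈ avgBall t x'} := by
  rw [← volume_bdry_ball (tangential y) (half_pos ht)]
  refine measure_mono fun x' hx' => ?_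
  rw [Metric.mem_ball, dist_comm, dist_eq_norm] at hx'
  refine (mem_avgBall_iff ht).2 ?_
  have h3 : ‖tangential y - x'‖ ^ 2 < (t / 2) ^ 2 :=
    pow_lt_pow_left₀ hx' (norm_nonneg _) two_ne_zero
  have h4 : (y (Fin.last n) - 3 / 2 * t) ^ 2 ≤ (t / 2) ^ 2 :=
    sq_le_sq' (by linarith) (by linarith)
  nlinarith

theorem bdryBallVol_ne_zero (n : ℕ) : bdryBallVol n ≠ 0 :=
  (Metric.measure_ball_pos _ _ one_pos).ne'

theorem bdryBallVol_ne_top (n : ℕ) : bdryBallVol n ≠ ⊤ := measure_ball_lt_top.ne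

/-- The volume of the unit ball of `ℝ^N`. -/
noncomputable def unitBallVol (n : ℕ) : ℝ≥0∞ := volume (Metric.ball (0 : FullSpace n) 1)

theorem unitBallVol_ne_zero (n : ℕ) : unitBallVol n ≠ 0 :=
  (Metric.measure_ball_pos _ _ one_pos).ne'

theorem unitBallVol_ne_top (n : ℕ) : unitBallVol n ≠ ⊤ := measure_ball_lt_top.ne

theorem avgVol_inv {n : ℕ} {t : ℝ} (ht : 0 < t) :
    (avgVol n t)⁻¹ = ENNReal.ofReal ((t ^ (n + 1))⁻¹) * (unitBallVol n)⁻¹ := by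
  rw [avgVol, ENNReal.mul_inv (Or.inr measure_ball_lt_top.ne) (Or.inl ENNReal.ofReal_ne_top),
    ENNReal.ofReal_inv_of_pos (by positivity), unitBallVol]

/-- The power of t is t^n for the centres divided by t^(n+1) for the volume of the ball. -/
theorem lintegral_avgMeasure_le {n : ℕ} {t : ℝ} (ht : 0 < t) {h : FullSpace n → ℝ≥0∞}
    (hh : Measurable h) :
    ∫⁻ x', ∫⁻ y, h y ∂(avgMeasure t x') ≤
      ENNReal.ofReal t⁻¹ * (bdryBallVol n / unitBallVol n) * ∫⁻ y in layer n t, h y := by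
  rw [lintegral_avgMeasure_tonelli t hh]
  calc _ ≤ (avgVol n t)⁻¹ * ∫⁻ y, (layer n t).indicator
        (fun y => h y * (ENNReal.ofReal (t ^ n) * bdryBallVol n)) y := by
        refine mul_le_mul' le_rfl (lintegral_mono fun y => ?_)
        refine (mul_le_mul' le_rfl (volume_centers_le ht y)).trans (le_of_eq ?_)
        by_cases hy : y ∈ layer n t <;> simp [hy]
    _ = _ := by
        rw [lintegral_indicator (measurableSet_layer n t), lintegral_mul_const _ hh, avgVol_inv ht]
        have : ENNReal.ofReal t⁻¹ = ENNReal.ofReal ((t ^ (n + 1))⁻¹) * ENNReal.ofReal (t ^ n) := by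
          rw [← ENNReal.ofReal_mul (by positivity)]
          congr 1
          field_simp
          ring
        rw [this, div_eq_mul_inv]
        ring

/-- The factor 2^n reflects that only centres within horizontal distance t/2 are counted. -/
theorem lintegral_layer_le {n : ℕ} {t : ℝ} (ht : 0 < t) {h : FullSpace n → ℝ≥0∞}
    (hh : Measurable h) :
    ∫⁻ y in {y : FullSpace n | t ≤ y (Fin.last n) ∧ y (Fin.last n) ≤ 2 * t}, h y ≤
      ENNReal.ofReal t * (2 ^ n * (unitBallVol n / bdryBallVol n)) *
        ∫⁻ x', ∫⁻ y, h y ∂(avgMeasure t x') := by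
  rw [lintegral_avgMeasure_tonelli t hh]
  set S : Set (FullSpace n) := {y : FullSpace n | t ≤ y (Fin.last n) ∧ y (Fin.last n) ≤ 2 * t}
  have hS : MeasurableSet S := measurableSet_preimage (measurable_last n) measurableSet_Icc
  have h1 : (∫⁻ y in S, h y) * (ENNReal.ofReal ((t / 2) ^ n) * bdryBallVol n) ≤
      ∫⁻ y, h y * volume {x' : EuclideanSpace ℝ (Fin n) | y ∈ avgBall t x'} := by
    rw [← lintegral_mul_const _ hh, ← lintegral_indicator hS]
    refine lintegral_mono fun y => ?_
    by_cases hy : y ∈ S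
    · rw [Set.indicator_of_mem hy]
      exact mul_le_mul' le_rfl (le_volume_centers ht hy.1 hy.2)
    · simp [Set.indicator_of_notMem hy]
  refine le_trans (le_of_eq ?_) (mul_le_mul' le_rfl (mul_le_mul' le_rfl h1))
  rw [avgVol_inv ht]
  have h2 : ENNReal.ofReal t * 2 ^ n * ENNReal.ofReal ((t ^ (n + 1))⁻¹) *
      ENNReal.ofReal ((t / 2) ^ n) = 1 := by
    rw [show (2 : ℝ≥0∞) ^ n = ENNReal.ofReal (2 ^ n) by simp [ENNReal.ofReal_pow],
      ← ENNReal.ofReal_mul (by positivity), ← ENNReal.ofReal_mul (by positivity),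
      ← ENNReal.ofReal_mul (by positivity), ← ENNReal.ofReal_one]
    congr 1
    rw [div_pow]
    field_simp
    ring
  calc (∫⁻ y in S, h y) = 1 * (unitBallVol n * (unitBallVol n)⁻¹) *
        (bdryBallVol n * (bdryBallVol n)⁻¹) * ∫⁻ y in S, h y := by
        rw [ENNReal.mul_inv_cancel (unitBallVol_ne_zero n) (unitBallVol_ne_top n),
          ENNReal.mul_inv_cancel (bdryBallVol_ne_zero n) (bdryBallVol_ne_top n)]
        simp
    _ = _ := by
        rw [← h2, div_eq_mul_inv (unitBallVol n)]
        ring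

theorem enorm_integral_sq_le {α : Type*} {m : MeasurableSpace α} (μ : Measure α)
    [IsProbabilityMeasure μ] {v : α → ℝ} (hv : AEMeasurable v μ) :
    ‖∫ y, v y ∂μ‖ₑ ^ 2 ≤ ∫⁻ y, ‖v y‖ₑ ^ 2 ∂μ :=
  (pow_le_pow_left' (enorm_integral_le_lintegral_enorm v) 2).trans
    (sq_lintegral_le_of_isProbabilityMeasure μ (by fun_prop))

theorem enorm_sub_integral_sq_le {α : Type*} {m : MeasurableSpace α} (μ : Measure α)
    [IsProbabilityMeasure μ] {v : α → ℝ} (hv : Integrable v μ) (a : ℝ) :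
    ‖a - ∫ z, v z ∂μ‖ₑ ^ 2 ≤ ∫⁻ z, ‖a - v z‖ₑ ^ 2 ∂μ := by
  have : a - ∫ z, v z ∂μ = ∫ z, (a - v z) ∂μ := by
    rw [integral_sub (integrable_const a) hv]; simp
  rw [this]
  exact enorm_integral_sq_le μ (hv.aemeasurable.const_sub a)

theorem enorm_integral_sub_integral_sq_le {α : Type*} {m : MeasurableSpace α} (μ ν : Measure α)
    [IsProbabilityMeasure μ] [IsProbabilityMeasure ν] {v : α → ℝ} (hμ : Integrable v μ)
    (hν : Integrable v ν) :
    ‖∫ y, v y ∂μ - ∫ z, v z ∂ν‖ₑ ^ 2 ≤ ∫⁻ y, ∫⁻ z, ‖v y - v z‖ₑ ^ 2 ∂ν ∂μ := by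
  have : ∫ y, v y ∂μ - ∫ z, v z ∂ν = ∫ y, (v y - ∫ z, v z ∂ν) ∂μ := by
    rw [integral_sub hμ (integrable_const _)]; simp
  rw [this]
  refine (enorm_integral_sq_le μ (hμ.aemeasurable.sub_const _)).trans
    (lintegral_mono fun y => enorm_sub_integral_sq_le ν hν (v y))

theorem memLp_of_sqNorm_lt_top {n : ℕ} {v : FullSpace n → ℝ} (hv : Measurable v)
    (h : sqNorm v < ⊤) : MemLp v 2 (halfVol n) :=
  (memLp_two_iff hv.aestronglyMeasurable).2 h

theorem integrable_avgMeasure {n : ℕ} {t : ℝ} (ht : 0 < t) (x' : EuclideanSpace ℝ (Fin n))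
    {v : FullSpace n → ℝ} (hv : Measurable v) (h : sqNorm v < ⊤) :
    Integrable v (avgMeasure t x') := by
  have h1 : MemLp v 2 (volume.restrict (avgBall t x')) :=
    (memLp_of_sqNorm_lt_top hv h).mono_measure
      (Measure.restrict_mono (avgBall_subset_upperHalf ht x') le_rfl)
  have : IsFiniteMeasure (volume.restrict (avgBall t x')) :=
    ⟨by rw [Measure.restrict_apply_univ]; exact measure_ball_lt_top⟩
  exact (h1.integrable one_le_two).smul_measure (ENNReal.inv_ne_top.2 (avgVol_ne_zero ht))

/-- The radii contribute at most 2t and the centres are 3(t − t')/2 ≤ 3t/4 apart; 4t is a convenient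
upper bound. -/
theorem norm_sub_lt_of_mem_avgBall {n : ℕ} {t t' : ℝ} (h1 : t / 2 ≤ t') (h2 : t' ≤ t)
    {x' : EuclideanSpace ℝ (Fin n)} {y z : FullSpace n} (hy : y ∈ avgBall t x')
    (hz : z ∈ avgBall t' x') : ‖y - z‖ ≤ 4 * t := by
  have e : dist (pointAbove (3 / 2 * t) x') (pointAbove (3 / 2 * t') x') = 3 / 2 * (t - t') := by
    rw [pointAbove, pointAbove, dist_add_left, PiLp.dist_single_same, Real.dist_eq,
      ← mul_sub, abs_of_nonneg (by linarith)]
  have hy' := Metric.mem_ball.1 hy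
  have hz' := Metric.mem_ball'.1 hz
  rw [← dist_eq_norm]
  have := dist_triangle4 y (pointAbove (3 / 2 * t) x') (pointAbove (3 / 2 * t') x') z
  linarith

/-- On the two balls |y − z| ≤ 4t, so the Gagliardo kernel can be inserted at the price of
(4t)^(N+2τ). The two averages contribute t^(−1) and, up to a constant, t^(−N), which leaves
t^(2τ−1). With t' = t/2 this compares consecutive dyadic averages; with t' = t it controls the
oscillation inside one ball. -/
theorem lintegral_avgMeasure_pair_le (n : ℕ) {τ : ℝ} (hτ : 0 < τ) :
    ∃ C : ℝ≥0∞, C < ⊤ ∧ ∀ t t' : ℝ, 0 < t → t / 2 ≤ t' → t' ≤ t → ∀ v : FullSpace n → ℝ,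
      Measurable v → ∫⁻ x', ∫⁻ y, ∫⁻ z, ‖v y - v z‖ₑ ^ 2 ∂(avgMeasure t' x') ∂(avgMeasure t x') ≤
        C * ENNReal.ofReal (t ^ (2 * τ - 1)) * gagliardoSq τ v := by
  obtain ⟨p, hp⟩ : ∃ p : ℝ, p = ((n + 1 : ℕ) : ℝ) + 2 * τ := ⟨_, rfl⟩
  refine ⟨bdryBallVol n / unitBallVol n * (unitBallVol n)⁻¹ *
    ENNReal.ofReal (2 ^ (n + 1) * 4 ^ p), ?_, ?_⟩
  · refine ENNReal.mul_lt_top (ENNReal.mul_lt_top (ENNReal.div_lt_top (bdryBallVol_ne_top n)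
      (unitBallVol_ne_zero n)) (ENNReal.inv_lt_top.2 (unitBallVol_ne_zero n).bot_lt)) ENNReal.ofReal_lt_top
  intro t t' ht h1 h2 v hv
  have ht' : 0 < t' := by linarith
  have hmp := measurable_normPow (n := n) (-p)
  set G : FullSpace n → ℝ≥0∞ := fun y => ∫⁻ z, ‖v y - v z‖ₑ ^ 2 * normPow (-p) (y - z) ∂(halfVol n)
    with hG
  have hGm : Measurable G := by
    refine Measurable.lintegral_prod_right' (f := fun q : FullSpace n × FullSpace n =>
      ‖v q.1 - v q.2‖ₑ ^ 2 * normPow (-p) (q.1 - q.2)) ?_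
    fun_prop
  have hinner : ∀ x', ∀ y ∈ avgBall t x', ∫⁻ z, ‖v y - v z‖ₑ ^ 2 ∂(avgMeasure t' x') ≤
      (avgVol n t')⁻¹ * ENNReal.ofReal ((4 * t) ^ p) * G y := by
    intro x' y hy
    rw [lintegral_avgMeasure, mul_assoc, hG]
    refine mul_le_mul' le_rfl ?_
    rw [← lintegral_const_mul _ (by fun_prop)]
    refine le_trans ?_ (lintegral_mono_set (avgBall_subset_upperHalf ht' x'))
    refine setLIntegral_mono' (measurableSet_avgBall t' x') fun z hz => ?_
    rcases eq_or_ne y z with rfl | hyz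
    · simp
    have hpos : 0 < ‖y - z‖ := norm_pos_iff.2 (sub_ne_zero.2 hyz)
    have h3 := norm_sub_lt_of_mem_avgBall h1 h2 hy hz
    calc ‖v y - v z‖ₑ ^ 2 = ‖v y - v z‖ₑ ^ 2 * 1 := (mul_one _).symm
      _ ≤ ‖v y - v z‖ₑ ^ 2 * (ENNReal.ofReal ((4 * t) ^ p) * normPow (-p) (y - z)) := by
          refine mul_le_mul' le_rfl ?_
          rw [normPow, ← ENNReal.ofReal_mul (by positivity), ← ENNReal.ofReal_one]
          apply ENNReal.ofReal_le_ofReal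
          rw [Real.rpow_neg hpos.le, ← div_eq_mul_inv, one_le_div (by positivity)]
          exact Real.rpow_le_rpow hpos.le h3 (by rw [hp]; positivity)
      _ = _ := by ring
  calc ∫⁻ x', ∫⁻ y, ∫⁻ z, ‖v y - v z‖ₑ ^ 2 ∂(avgMeasure t' x') ∂(avgMeasure t x')
      ≤ ∫⁻ x', ∫⁻ y, (avgVol n t')⁻¹ * ENNReal.ofReal ((4 * t) ^ p) * G y ∂(avgMeasure t x') := by
        refine lintegral_mono fun x' => ?_
        rw [lintegral_avgMeasure, lintegral_avgMeasure]
        exact mul_le_mul' le_rfl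
          (setLIntegral_mono' (measurableSet_avgBall t x') fun y hy => hinner x' y hy)
    _ ≤ ENNReal.ofReal t⁻¹ * (bdryBallVol n / unitBallVol n) *
          ∫⁻ y in layer n t, (avgVol n t')⁻¹ * ENNReal.ofReal ((4 * t) ^ p) * G y :=
        lintegral_avgMeasure_le ht (by fun_prop)
    _ ≤ ENNReal.ofReal t⁻¹ * (bdryBallVol n / unitBallVol n) *
          ((avgVol n t')⁻¹ * ENNReal.ofReal ((4 * t) ^ p) * gagliardoSq τ v) := by
        refine mul_le_mul' le_rfl ?_
        rw [lintegral_const_mul _ hGm, gagliardoSq_eq, ← hp]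
        refine mul_le_mul' le_rfl (lintegral_mono_set fun y hy => ?_)
        have := hy.1
        show 0 < y (Fin.last n)
        linarith
    _ = bdryBallVol n / unitBallVol n * (unitBallVol n)⁻¹ * (ENNReal.ofReal t⁻¹ *
          ENNReal.ofReal ((t' ^ (n + 1))⁻¹) * ENNReal.ofReal ((4 * t) ^ p)) * gagliardoSq τ v := by
        rw [avgVol_inv ht']
        ring
    _ ≤ bdryBallVol n / unitBallVol n * (unitBallVol n)⁻¹ * (ENNReal.ofReal (2 ^ (n + 1) * 4 ^ p) *
          ENNReal.ofReal (t ^ (2 * τ - 1))) * gagliardoSq τ v := by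
        refine mul_le_mul' (mul_le_mul' le_rfl ?_) le_rfl
        rw [← ENNReal.ofReal_mul (by positivity), ← ENNReal.ofReal_mul (by positivity),
          ← ENNReal.ofReal_mul (by positivity)]
        apply ENNReal.ofReal_le_ofReal
        have h3 : (t' ^ (n + 1))⁻¹ ≤ ((t / 2) ^ (n + 1))⁻¹ := by gcongr
        have h4 : (4 * t) ^ p = 4 ^ p * (t ^ (n + 1) * (t * t ^ (2 * τ - 1))) := by
          have e1 : t * t ^ (2 * τ - 1) = t ^ (2 * τ) := by
            nth_rewrite 1 [← Real.rpow_one t]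
            rw [← Real.rpow_add ht]; ring_nf
          rw [Real.mul_rpow (by norm_num) ht.le, e1, ← Real.rpow_natCast, ← Real.rpow_add ht, hp]
        calc t⁻¹ * (t' ^ (n + 1))⁻¹ * (4 * t) ^ p ≤ t⁻¹ * ((t / 2) ^ (n + 1))⁻¹ * (4 * t) ^ p := by
              gcongr
          _ = _ := by
              rw [h4, div_pow]
              field_simp
    _ = _ := by ring

theorem lintegral_ballAvg_sub_sq_le {n : ℕ} {t t' : ℝ} (ht : 0 < t) (ht' : 0 < t')
    {v : FullSpace n → ℝ} (hv : Measurable v) (h : sqNorm v < ⊤) :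
    ∫⁻ x', ‖ballAvg t v x' - ballAvg t' v x'‖ₑ ^ 2 ≤
      ∫⁻ x', ∫⁻ y, ∫⁻ z, ‖v y - v z‖ₑ ^ 2 ∂(avgMeasure t' x') ∂(avgMeasure t x') := by
  refine lintegral_mono fun x' => ?_
  have := isProbabilityMeasure_avgMeasure ht x'
  have := isProbabilityMeasure_avgMeasure ht' x'
  exact enorm_integral_sub_integral_sq_le _ _ (integrable_avgMeasure ht x' hv h)
    (integrable_avgMeasure ht' x' hv h)

/-- Splitting v into its average and the deviation from it; Jensen bounds the deviation by the pair
integral. -/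
theorem lintegral_avgMeasure_sq_le {n : ℕ} {t : ℝ} (ht : 0 < t)
    {v : FullSpace n → ℝ} (hv : Measurable v) (h : sqNorm v < ⊤) :
    ∫⁻ x', ∫⁻ y, ‖v y‖ₑ ^ 2 ∂(avgMeasure t x') ≤ 2 * (∫⁻ x', ‖ballAvg t v x'‖ₑ ^ 2) +
      2 * ∫⁻ x', ∫⁻ y, ∫⁻ z, ‖v y - v z‖ₑ ^ 2 ∂(avgMeasure t x') ∂(avgMeasure t x') := by
  have hm := (stronglyMeasurable_ballAvg t hv).measurable
  rw [← lintegral_const_mul' _ _ (by simp), ← lintegral_const_mul' _ _ (by simp),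
    ← lintegral_add_left (by fun_prop)]
  refine lintegral_mono fun x' => ?_
  have := isProbabilityMeasure_avgMeasure ht x'
  have hi := integrable_avgMeasure ht x' hv h
  calc ∫⁻ y, ‖v y‖ₑ ^ 2 ∂(avgMeasure t x')
      ≤ ∫⁻ y, (2 * ‖ballAvg t v x'‖ₑ ^ 2 + 2 * ∫⁻ z, ‖v y - v z‖ₑ ^ 2 ∂(avgMeasure t x'))
          ∂(avgMeasure t x') := by
        refine lintegral_mono fun y => ?_
        have h1 := enorm_add_sq_le (ballAvg t v x') (v y - ballAvg t v x')
        rw [add_sub_cancel] at h1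
        exact h1.trans (add_le_add le_rfl (mul_le_mul' le_rfl
          (enorm_sub_integral_sq_le _ hi (v y))))
    _ = _ := by
        rw [lintegral_add_left measurable_const, lintegral_const, measure_univ, mul_one,
          lintegral_const_mul' _ _ (by simp)]

theorem lintegral_ballAvg_sq_le {n : ℕ} {t : ℝ} (ht : 0 < t)
    {v : FullSpace n → ℝ} (hv : Measurable v) :
    ∫⁻ x', ‖ballAvg t v x'‖ₑ ^ 2 ≤ ENNReal.ofReal t⁻¹ * (bdryBallVol n / unitBallVol n) *
      ∫⁻ y in layer n t, ‖v y‖ₑ ^ 2 := by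
  refine le_trans (lintegral_mono fun x' => ?_)
    (lintegral_avgMeasure_le (h := fun y => ‖v y‖ₑ ^ 2) ht (by fun_prop))
  have := isProbabilityMeasure_avgMeasure ht x'
  exact enorm_integral_sq_le _ hv.aemeasurable

theorem layer_subset_upperHalf {n : ℕ} {t : ℝ} (ht : 0 < t) : layer n t ⊆ upperHalf n :=
  fun y hy => by
    have := hy.1
    show 0 < y (Fin.last n)
    linarith

/-! ### Dyadic averages: growth, convergence and boundary values. -/

/-- The average over the dyadic ball of radius `2⁻ᵏ`. -/
noncomputable def dyadicAvg {n : ℕ} (k : ℕ) (v : FullSpace n → ℝ) :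
    EuclideanSpace ℝ (Fin n) → ℝ := ballAvg ((1 / 2 : ℝ) ^ k) v

/-- The ratio of the geometric decay of the differences of the dyadic averages. -/
noncomputable def dyadicRatio (τ : ℝ) : ℝ := (1 / 2 : ℝ) ^ (τ - 1 / 2)

theorem dyadicRatio_pos (τ : ℝ) : 0 < dyadicRatio τ := by unfold dyadicRatio; positivity

theorem dyadicRatio_sq_pow (τ : ℝ) (k : ℕ) :
    ((1 / 2 : ℝ) ^ k) ^ (2 * τ - 1) = (dyadicRatio τ ^ k) ^ 2 := by
  rw [dyadicRatio, ← Real.rpow_natCast, ← Real.rpow_natCast, ← Real.rpow_natCast,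
    ← Real.rpow_mul (by norm_num), ← Real.rpow_mul (by positivity), ← Real.rpow_mul (by positivity)]
  push_cast
  ring_nf

theorem aestronglyMeasurable_dyadicAvg {n : ℕ} (k : ℕ) {v : FullSpace n → ℝ} (hv : Measurable v) :
    AEStronglyMeasurable (dyadicAvg k v) volume :=
  (stronglyMeasurable_ballAvg _ hv).aestronglyMeasurable

/-- The difference telescopes into steps bounded by a multiple of r^j, with r = 2^(−(τ−1/2)). The
closed form of the geometric sum serves both r < 1 and r > 1; only r = 1, that is τ = 1/2, is
excluded. -/
theorem exists_eLpNorm_dyadicAvg_sub_le (n : ℕ) {τ : ℝ} (hτ : 0 < τ) (hτ' : τ ≠ 1 / 2) :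
    ∃ C : ℝ≥0∞, C < ⊤ ∧ ∀ v : FullSpace n → ℝ, Measurable v → sqNorm v < ⊤ →
      ∀ k l : ℕ, k ≤ l → eLpNorm (dyadicAvg k v - dyadicAvg l v) 2 volume ≤
        ENNReal.ofReal ((dyadicRatio τ ^ k - dyadicRatio τ ^ l) / (1 - dyadicRatio τ)) *
          (C * gagliardoSq τ v) ^ (1 / 2 : ℝ) := by
  obtain ⟨C, hC, h⟩ := lintegral_avgMeasure_pair_le n hτ
  refine ⟨C, hC, fun v hv hv2 k l hkl => ?_⟩
  set r := dyadicRatio τ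
  have hr : 0 < r := dyadicRatio_pos τ
  have hstep : ∀ j, eLpNorm (dyadicAvg j v - dyadicAvg (j + 1) v) 2 volume ≤
      ENNReal.ofReal (r ^ j) * (C * gagliardoSq τ v) ^ (1 / 2 : ℝ) := by
    intro j
    have ht : (0 : ℝ) < (1 / 2 : ℝ) ^ j := by positivity
    have e : (1 / 2 : ℝ) ^ (j + 1) = (1 / 2 : ℝ) ^ j / 2 := by ring
    have h1 := (lintegral_ballAvg_sub_sq_le ht (by positivity : (0 : ℝ) < (1 / 2 : ℝ) ^ (j + 1))
      hv hv2).trans (h _ _ ht (by rw [e]) (by rw [e]; linarith) v hv)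
    rw [eLpNorm_two_eq]
    have h2 := ENNReal.rpow_le_rpow h1 (by norm_num : (0 : ℝ) ≤ 1 / 2)
    refine h2.trans (le_of_eq ?_)
    have h3 : ENNReal.ofReal (r ^ j) =
        ENNReal.ofReal (((1 / 2 : ℝ) ^ j) ^ (2 * τ - 1)) ^ (1 / 2 : ℝ) := by
      rw [dyadicRatio_sq_pow, ENNReal.ofReal_rpow_of_nonneg (by positivity) (by norm_num),
        ← Real.sqrt_eq_rpow, Real.sqrt_sq (by positivity)]
    rw [h3, ← ENNReal.mul_rpow_of_nonneg _ _ (by norm_num)]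
    ring_nf
  have hr1 : r ≠ 1 := by
    rcases lt_or_gt_of_ne hτ' with h1 | h1
    · exact (Real.one_lt_rpow_of_pos_of_lt_one_of_neg (by norm_num) (by norm_num)
        (by linarith)).ne'
    · exact (Real.rpow_lt_one (by norm_num) (by norm_num) (by linarith)).ne
  -- `ENNReal.ofReal` truncates negative numbers to zero, so adding the next term of the sum
  -- requires the partial sum to be nonnegative, whatever the sign of 1 − r.
  have hmono : ∀ j, 0 ≤ (r ^ k - r ^ j) / (1 - r) ∨ j < k := by
    intro j
    rcases lt_or_ge j k with hj | hj
    · exact Or.inr hj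
    left
    rcases lt_or_gt_of_ne hr1 with h1 | h1
    · exact div_nonneg (sub_nonneg.2 (pow_le_pow_of_le_one hr.le h1.le hj)) (by linarith)
    · exact div_nonneg_of_nonpos (sub_nonpos.2 (pow_le_pow_right₀ h1.le hj)) (by linarith)
  induction l, hkl using Nat.le_induction with
  | base => simp
  | succ j hj ih =>
    have e : dyadicAvg k v - dyadicAvg (j + 1) v =
        (dyadicAvg k v - dyadicAvg j v) + (dyadicAvg j v - dyadicAvg (j + 1) v) := by abel
    rw [e]
    refine (eLpNorm_add_le ((aestronglyMeasurable_dyadicAvg k hv).sub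
      (aestronglyMeasurable_dyadicAvg j hv)) ((aestronglyMeasurable_dyadicAvg j hv).sub
      (aestronglyMeasurable_dyadicAvg (j + 1) hv)) one_le_two).trans ?_
    refine (add_le_add ih (hstep j)).trans (le_of_eq ?_)
    rw [← add_mul, ← ENNReal.ofReal_add ((hmono j).resolve_right (by omega)) (by positivity)]
    congr 2
    have : 1 - r ≠ 0 := sub_ne_zero.2 hr1.symm
    field_simp
    ring

theorem dyadicRatio_lt_one {τ : ℝ} (hτ : 1 / 2 < τ) : dyadicRatio τ < 1 :=
  Real.rpow_lt_one (by norm_num) (by norm_num) (by linarith)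

theorem one_lt_dyadicRatio {τ : ℝ} (hτ : τ < 1 / 2) : 1 < dyadicRatio τ :=
  Real.one_lt_rpow_of_pos_of_lt_one_of_neg (by norm_num) (by norm_num) (by linarith)

theorem lintegral_dyadicAvg_zero_le {n : ℕ} {v : FullSpace n → ℝ} (hv : Measurable v) :
    ∫⁻ x', ‖dyadicAvg 0 v x'‖ₑ ^ 2 ≤ bdryBallVol n / unitBallVol n * sqNorm v := by
  have h := lintegral_ballAvg_sq_le (n := n) one_pos hv
  simp only [inv_one, ENNReal.ofReal_one, one_mul] at h
  rw [dyadicAvg, pow_zero]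
  exact h.trans (mul_le_mul' le_rfl (lintegral_mono_set (layer_subset_upperHalf one_pos)))

theorem bdryBallVol_div_lt_top (n : ℕ) : bdryBallVol n / unitBallVol n < ⊤ :=
  ENNReal.div_lt_top (bdryBallVol_ne_top n) (unitBallVol_ne_zero n)

theorem memLp_dyadicAvg {n : ℕ} (k : ℕ) {v : FullSpace n → ℝ} (hv : Measurable v)
    (h : sqNorm v < ⊤) : MemLp (dyadicAvg k v) 2 volume := by
  rw [memLp_two_iff (aestronglyMeasurable_dyadicAvg k hv)]
  have ht : (0 : ℝ) < (1 / 2 : ℝ) ^ k := by positivity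
  refine (lintegral_ballAvg_sq_le ht hv).trans_lt (ENNReal.mul_lt_top (ENNReal.mul_lt_top
    ENNReal.ofReal_lt_top (bdryBallVol_div_lt_top n)) ?_)
  exact (lintegral_mono_set (layer_subset_upperHalf ht)).trans_lt h

theorem exists_eLpNorm_dyadicAvg_sub_le_of_half_lt (n : ℕ) {τ : ℝ} (hτ : 1 / 2 < τ) :
    ∃ C : ℝ≥0∞, C < ⊤ ∧ ∀ v : FullSpace n → ℝ, Measurable v → sqNorm v < ⊤ →
      ∀ k l : ℕ, k ≤ l → eLpNorm (dyadicAvg k v - dyadicAvg l v) 2 volume ≤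
        C * ENNReal.ofReal (dyadicRatio τ ^ k) * gagliardoSq τ v ^ (1 / 2 : ℝ) := by
  obtain ⟨C, hC, h⟩ := exists_eLpNorm_dyadicAvg_sub_le n (by linarith : 0 < τ) hτ.ne'
  refine ⟨ENNReal.ofReal (1 / (1 - dyadicRatio τ)) * C ^ (1 / 2 : ℝ), ENNReal.mul_lt_top
    ENNReal.ofReal_lt_top (ENNReal.rpow_lt_top_of_nonneg (by norm_num) hC.ne), ?_⟩
  intro v hv hv2 k l hkl
  refine (h v hv hv2 k l hkl).trans ?_
  have hr := dyadicRatio_lt_one hτ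
  have hr0 := dyadicRatio_pos τ
  rw [ENNReal.mul_rpow_of_nonneg _ _ (by norm_num)]
  calc _ ≤ ENNReal.ofReal (1 / (1 - dyadicRatio τ) * dyadicRatio τ ^ k) *
        (C ^ (1 / 2 : ℝ) * gagliardoSq τ v ^ (1 / 2 : ℝ)) := by
        refine mul_le_mul' (ENNReal.ofReal_le_ofReal ?_) le_rfl
        rw [div_mul_eq_mul_div, one_mul]
        have h1 : 0 < 1 - dyadicRatio τ := by linarith
        gcongr
        have : 0 < dyadicRatio τ ^ l := by positivity
        linarith
    _ = _ := by
        rw [ENNReal.ofReal_mul (one_div_nonneg.2 (by linarith))]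
        ring

theorem tendsto_ofReal_dyadicRatio_pow {τ : ℝ} (hτ : 1 / 2 < τ) :
    Tendsto (fun k : ℕ => ENNReal.ofReal (dyadicRatio τ ^ k)) atTop (𝓝 0) := by
  have := ENNReal.tendsto_ofReal (tendsto_pow_atTop_nhds_zero_of_lt_one (dyadicRatio_pos τ).le
    (dyadicRatio_lt_one hτ))
  simpa using this

theorem tendsto_const_mul_ofReal_dyadicRatio_pow {τ : ℝ} (hτ : 1 / 2 < τ) {C D : ℝ≥0∞}
    (hC : C < ⊤) (hD : D < ⊤) :
    Tendsto (fun k : ℕ => C * ENNReal.ofReal (dyadicRatio τ ^ k) * D) atTop (𝓝 0) := by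
  have h1 := ENNReal.Tendsto.const_mul (tendsto_ofReal_dyadicRatio_pow hτ) (Or.inr hC.ne)
  have h2 := ENNReal.Tendsto.mul_const h1 (Or.inr hD.ne)
  simpa using h2

theorem gag_rpow_lt_top {n : ℕ} {τ : ℝ} {v : FullSpace n → ℝ} (h : gagliardoSq τ v < ⊤) :
    gagliardoSq τ v ^ (1 / 2 : ℝ) < ⊤ := ENNReal.rpow_lt_top_of_nonneg (by norm_num) h.ne

/-- For τ > 1/2 the averages are Cauchy in the complete space L²(∂Ω). Letting the second index tend
to infinity in the difference bound keeps the geometric rate. -/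
theorem exists_lim_dyadicAvg (n : ℕ) {τ : ℝ} (hτ : 1 / 2 < τ) :
    ∃ C : ℝ≥0∞, C < ⊤ ∧ ∀ v : FullSpace n → ℝ, Measurable v → sqNorm v < ⊤ →
      gagliardoSq τ v < ⊤ → ∃ g : Lp ℝ 2 (volume : Measure (EuclideanSpace ℝ (Fin n))),
      ∀ k : ℕ, eLpNorm (fun x' => dyadicAvg k v x' - g x') 2 volume ≤
        C * ENNReal.ofReal (dyadicRatio τ ^ k) * gagliardoSq τ v ^ (1 / 2 : ℝ) := by
  obtain ⟨C, hC, h⟩ := exists_eLpNorm_dyadicAvg_sub_le_of_half_lt n hτ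
  refine ⟨C, hC, fun v hv hv2 hg => ?_⟩
  let M : ℕ → Lp ℝ 2 (volume : Measure (EuclideanSpace ℝ (Fin n))) :=
    fun k => (memLp_dyadicAvg k hv hv2).toLp
  have hM : ∀ k l, k ≤ l → edist (M k) (M l) ≤
      C * ENNReal.ofReal (dyadicRatio τ ^ k) * gagliardoSq τ v ^ (1 / 2 : ℝ) := by
    intro k l hkl
    rw [Lp.edist_toLp_toLp]
    exact h v hv hv2 k l hkl
  have hanti : ∀ k l, k ≤ l → ENNReal.ofReal (dyadicRatio τ ^ l) ≤
      ENNReal.ofReal (dyadicRatio τ ^ k) := fun k l hkl => ENNReal.ofReal_le_ofReal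
    (pow_le_pow_of_le_one (dyadicRatio_pos τ).le (dyadicRatio_lt_one hτ).le hkl)
  have hcau : CauchySeq M := by
    rw [EMetric.cauchySeq_iff_le_tendsto_0]
    refine ⟨fun k => C * ENNReal.ofReal (dyadicRatio τ ^ k) * gagliardoSq τ v ^ (1 / 2 : ℝ), ?_,
      tendsto_const_mul_ofReal_dyadicRatio_pow hτ hC (gag_rpow_lt_top hg)⟩
    intro a b N ha hb
    rcases le_total a b with hab | hab
    · exact (hM a b hab).trans (mul_le_mul' (mul_le_mul' le_rfl (hanti _ _ ha)) le_rfl)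
    · rw [edist_comm]
      exact (hM b a hab).trans (mul_le_mul' (mul_le_mul' le_rfl (hanti _ _ hb)) le_rfl)
  obtain ⟨g, hgl⟩ := cauchySeq_tendsto_of_complete hcau
  refine ⟨g, fun k => ?_⟩
  have h1 : edist (M k) g ≤
      C * ENNReal.ofReal (dyadicRatio τ ^ k) * gagliardoSq τ v ^ (1 / 2 : ℝ) :=
    le_of_tendsto (tendsto_const_nhds.edist hgl)
      ((eventually_ge_atTop k).mono fun l hl => hM k l hl)
  rw [Lp.edist_def] at h1
  refine (le_of_eq (eLpNorm_congr_ae ?_)).trans h1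
  filter_upwards [(memLp_dyadicAvg k hv hv2).coeFn_toLp] with x' hx'
  simp only [Pi.sub_apply, M, hx']

theorem tendsto_dyadicAvg_of_continuous {n : ℕ} {φ : FullSpace n → ℝ} (hφ : Continuous φ)
    (h2 : sqNorm φ < ⊤) (x' : EuclideanSpace ℝ (Fin n)) :
    Tendsto (fun k => dyadicAvg k φ x') atTop (𝓝 (φ (bdryPoint x'))) := by
  rw [Metric.tendsto_atTop]
  intro ε hε
  obtain ⟨δ, hδ, hball⟩ := Metric.continuous_iff.1 hφ (bdryPoint x') (ε / 2) (half_pos hε)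
  -- Points of the ball of radius 2^(−k) are within (3/2 + 1) 2^(−k) of the boundary point, and
  -- (5/2)(δ/4) < δ.
  obtain ⟨K, hK⟩ := exists_pow_lt_of_lt_one (show 0 < δ / 4 by positivity)
    (by norm_num : (1 / 2 : ℝ) < 1)
  refine ⟨K, fun k hk => ?_⟩
  have ht : (0 : ℝ) < (1 / 2 : ℝ) ^ k := by positivity
  have htK : (1 / 2 : ℝ) ^ k ≤ (1 / 2 : ℝ) ^ K :=
    pow_le_pow_of_le_one (by norm_num) (by norm_num) hk
  have := isProbabilityMeasure_avgMeasure ht x'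
  have hi := integrable_avgMeasure ht x' hφ.measurable h2
  have hmem : ∀ᵐ y ∂(avgMeasure ((1 / 2 : ℝ) ^ k) x'), ‖φ y - φ (bdryPoint x')‖ ≤ ε / 2 := by
    have h3 : ∀ᵐ y ∂(volume.restrict (avgBall ((1 / 2 : ℝ) ^ k) x')),
        ‖φ y - φ (bdryPoint x')‖ ≤ ε / 2 := by
      filter_upwards [ae_restrict_mem (measurableSet_avgBall _ x')] with y hy
      refine (hball y ?_).le
      have h4 := Metric.mem_ball.1 hy
      have h5 : dist (pointAbove (3 / 2 * (1 / 2 : ℝ) ^ k) x') (bdryPoint x') =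
          3 / 2 * (1 / 2 : ℝ) ^ k := by
        rw [pointAbove, dist_eq_norm, add_sub_cancel_left, PiLp.norm_single,
          Real.norm_eq_abs, abs_of_pos (by positivity)]
      have := dist_triangle y (pointAbove (3 / 2 * (1 / 2 : ℝ) ^ k) x') (bdryPoint x')
      linarith
    exact Measure.ae_smul_measure h3 _
  have h6 : dyadicAvg k φ x' - φ (bdryPoint x') =
      ∫ y, (φ y - φ (bdryPoint x')) ∂(avgMeasure ((1 / 2 : ℝ) ^ k) x') := by
    rw [integral_sub hi (integrable_const _), integral_const, probReal_univ, one_smul]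
    rfl
  rw [dist_eq_norm, h6]
  refine (norm_integral_le_of_norm_le_const hmem).trans_lt ?_
  simp only [probReal_univ, mul_one]
  linarith

/-- Fatou's lemma applied to the difference bound: the averages of a continuous function converge
pointwise to its boundary values, so these need not be known to lie in L² beforehand. -/
theorem exists_eLpNorm_dyadicAvg_sub_restrict_le (n : ℕ) {τ : ℝ} (hτ : 1 / 2 < τ) :
    ∃ C : ℝ≥0∞, C < ⊤ ∧ ∀ φ : FullSpace n → ℝ, Continuous φ → sqNorm φ < ⊤ →
      ∀ k : ℕ, eLpNorm (fun x' => dyadicAvg k φ x' - φ (bdryPoint x')) 2 volume ≤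
        C * ENNReal.ofReal (dyadicRatio τ ^ k) * gagliardoSq τ φ ^ (1 / 2 : ℝ) := by
  obtain ⟨C, hC, h⟩ := exists_eLpNorm_dyadicAvg_sub_le_of_half_lt n hτ
  refine ⟨C, hC, fun φ hφ h2 k => ?_⟩
  refine (Lp.eLpNorm_lim_le_liminf_eLpNorm
    (f := fun l => dyadicAvg k φ - dyadicAvg l φ)
    (fun l => (aestronglyMeasurable_dyadicAvg k hφ.measurable).sub
      (aestronglyMeasurable_dyadicAvg l hφ.measurable)) _
    (Eventually.of_forall fun x' => ?_)).trans ?_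
  · exact tendsto_const_nhds.sub (tendsto_dyadicAvg_of_continuous hφ h2 x')
  · refine liminf_le_of_frequently_le' (Eventually.frequently ?_)
    filter_upwards [eventually_ge_atTop k] with l hl
    exact h φ hφ.measurable h2 k l hl

theorem dyadicAvg_sub {n : ℕ} (k : ℕ) {u v : FullSpace n → ℝ} (hu : Measurable u)
    (hv : Measurable v) (hu2 : sqNorm u < ⊤) (hv2 : sqNorm v < ⊤) :
    dyadicAvg k (fun x => u x - v x) = fun x' : EuclideanSpace ℝ (Fin n) =>
      dyadicAvg k u x' - dyadicAvg k v x' := by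
  ext x'
  have ht : (0 : ℝ) < (1 / 2 : ℝ) ^ k := by positivity
  exact integral_sub (integrable_avgMeasure ht x' hu hu2) (integrable_avgMeasure ht x' hv hv2)

theorem sqNorm_sub_le {n : ℕ} {u v : FullSpace n → ℝ} (hu : Measurable u) :
    sqNorm (fun x => u x - v x) ≤ 2 * sqNorm u + 2 * sqNorm v := by
  unfold sqNorm
  rw [← lintegral_const_mul' _ _ (by simp), ← lintegral_const_mul' _ _ (by simp),
    ← lintegral_add_left (by fun_prop)]
  exact lintegral_mono fun x => enorm_sub_sq_le _ _

/-- Continuity of the trace in the H^τ norm. Boundary values of φ are compared with averages of φ,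
then with averages of v, then with g. The outer errors vanish as k → ∞, and the averages of φ − v
are bounded uniformly in k by the average at scale 1 plus a convergent geometric series. -/
theorem exists_eLpNorm_restrict_sub_lim_le (n : ℕ) {τ : ℝ} (hτ : 1 / 2 < τ) :
    ∃ C : ℝ≥0∞, C < ⊤ ∧ ∀ φ v : FullSpace n → ℝ, Continuous φ → Measurable v → sqNorm φ < ⊤ →
      sqNorm v < ⊤ → gagliardoSq τ φ < ⊤ →
      ∀ g : Lp ℝ 2 (volume : Measure (EuclideanSpace ℝ (Fin n))),
      Tendsto (fun k => eLpNorm (fun x' => dyadicAvg k v x' - g x') 2 volume) atTop (𝓝 0) →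
      eLpNorm (fun x' => φ (bdryPoint x') - g x') 2 volume ≤
        C * (sqNorm (fun x => φ x - v x) + gagliardoSq τ (fun x => φ x - v x)) ^ (1 / 2 : ℝ) := by
  obtain ⟨C₁, hC₁, h₁⟩ := exists_eLpNorm_dyadicAvg_sub_restrict_le n hτ
  obtain ⟨C₂, hC₂, h₂⟩ := exists_eLpNorm_dyadicAvg_sub_le_of_half_lt n hτ
  have hb := bdryBallVol_div_lt_top n
  set b := (bdryBallVol n / unitBallVol n) ^ (1 / 2 : ℝ) with hbdef
  refine ⟨b + C₂, ENNReal.add_lt_top.2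
    ⟨ENNReal.rpow_lt_top_of_nonneg (by norm_num) hb.ne, hC₂⟩, ?_⟩
  intro φ v hφ hv hφ2 hv2 hφg g hlim
  set w : FullSpace n → ℝ := fun x => φ x - v x with hw
  have hwm : Measurable w := hφ.measurable.sub hv
  have hw2 : sqNorm w < ⊤ := (sqNorm_sub_le hφ.measurable).trans_lt (ENNReal.add_lt_top.2
    ⟨ENNReal.mul_lt_top (by simp) hφ2, ENNReal.mul_lt_top (by simp) hv2⟩)
  set B := (b + C₂) * (sqNorm w + gagliardoSq τ w) ^ (1 / 2 : ℝ)
  have hmw : ∀ k, eLpNorm (dyadicAvg k w) 2 volume ≤ B := by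
    intro k
    have e : dyadicAvg k w = dyadicAvg 0 w - (dyadicAvg 0 w - dyadicAvg k w) := by abel
    rw [e]
    refine (eLpNorm_sub_le (aestronglyMeasurable_dyadicAvg 0 hwm)
      ((aestronglyMeasurable_dyadicAvg 0 hwm).sub (aestronglyMeasurable_dyadicAvg k hwm))
      one_le_two).trans ?_
    simp only [B, add_mul]
    refine add_le_add ?_ ?_
    · rw [eLpNorm_two_eq, hbdef, ← ENNReal.mul_rpow_of_nonneg _ _ (by norm_num)]
      refine ENNReal.rpow_le_rpow ((lintegral_dyadicAvg_zero_le hwm).trans ?_) (by norm_num)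
      exact mul_le_mul' le_rfl le_self_add
    · refine (h₂ w hwm hw2 0 k (Nat.zero_le k)).trans ?_
      rw [pow_zero, ENNReal.ofReal_one, mul_one]
      exact mul_le_mul' le_rfl (ENNReal.rpow_le_rpow le_add_self (by norm_num))
  have hk : ∀ k, eLpNorm (fun x' => φ (bdryPoint x') - g x') 2 volume ≤
      C₁ * ENNReal.ofReal (dyadicRatio τ ^ k) * gagliardoSq τ φ ^ (1 / 2 : ℝ) + B +
        eLpNorm (fun x' => dyadicAvg k v x' - g x') 2 volume := by
    intro k
    have hφb : AEStronglyMeasurable (fun x' : EuclideanSpace ℝ (Fin n) => φ (bdryPoint x'))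
        volume := (hφ.comp (continuous_bdryPoint n)).aestronglyMeasurable
    have hk1 := aestronglyMeasurable_dyadicAvg k hφ.measurable
    have hk2 := aestronglyMeasurable_dyadicAvg k hv
    have hk3 := aestronglyMeasurable_dyadicAvg k hwm
    have e : (fun x' => φ (bdryPoint x') - g x') =
        (fun x' => φ (bdryPoint x') - dyadicAvg k φ x') + dyadicAvg k w +
          fun x' => dyadicAvg k v x' - g x' := by
      rw [hw, dyadicAvg_sub k hφ.measurable hv hφ2 hv2]
      ext x'
      simp
    rw [e]
    refine (eLpNorm_add_le ((hφb.sub hk1).add hk3)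
      (hk2.sub (Lp.aestronglyMeasurable g)) one_le_two).trans (add_le_add ?_ le_rfl)
    refine (eLpNorm_add_le (hφb.sub hk1) hk3 one_le_two).trans (add_le_add ?_ (hmw k))
    rw [← eLpNorm_neg]
    have := h₁ φ hφ hφ2 k
    refine (le_of_eq (congrArg (fun f => eLpNorm f 2 volume) ?_)).trans this
    ext x'
    simp
  have hT := ((tendsto_const_mul_ofReal_dyadicRatio_pow hτ hC₁ (gag_rpow_lt_top hφg)).add
    (tendsto_const_nhds (x := B))).add hlim
  simp only [zero_add, add_zero] at hT
  exact ge_of_tendsto hT (Eventually.of_forall hk)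

theorem lintegral_sq_le_of_eLpNorm_le {α : Type*} {m : MeasurableSpace α} {μ : Measure α}
    {f : α → ℝ} {D E : ℝ≥0∞} {τ : ℝ} {k : ℕ}
    (h : eLpNorm f 2 μ ≤ D * ENNReal.ofReal (dyadicRatio τ ^ k) * E ^ (1 / 2 : ℝ)) :
    ∫⁻ x, ‖f x‖ₑ ^ 2 ∂μ ≤ D ^ 2 * E * ENNReal.ofReal (((1 / 2 : ℝ) ^ k) ^ (2 * τ - 1)) := by
  have hr := dyadicRatio_pos τ
  rw [← eLpNorm_two_sq]
  refine (pow_le_pow_left' h 2).trans (le_of_eq ?_)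
  rw [dyadicRatio_sq_pow, mul_pow, mul_pow, ← ENNReal.ofReal_pow (by positivity),
    ← ENNReal.rpow_natCast (E ^ (1 / 2 : ℝ)), ← ENNReal.rpow_mul]
  norm_num
  ring

/-- Here r > 1, so the telescoped sum is at most r^k/(r − 1): the averages may blow up, but no
faster than t^(τ−1/2), which the Hardy argument tolerates without any boundary condition. -/
theorem exists_lintegral_dyadicAvg_sq_le_of_lt_half (n : ℕ) {τ : ℝ} (hτ : 0 < τ)
    (hτ' : τ < 1 / 2) :
    ∃ C : ℝ≥0∞, C < ⊤ ∧ ∀ v : FullSpace n → ℝ, Measurable v → sqNorm v < ⊤ → ∀ k : ℕ,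
      ∫⁻ x', ‖dyadicAvg k v x'‖ₑ ^ 2 ≤ C * (sqNorm v + gagliardoSq τ v) *
        ENNReal.ofReal (((1 / 2 : ℝ) ^ k) ^ (2 * τ - 1)) := by
  obtain ⟨C, hC, h⟩ := exists_eLpNorm_dyadicAvg_sub_le n hτ hτ'.ne
  have hb := bdryBallVol_div_lt_top n
  have hr := one_lt_dyadicRatio hτ'
  set r := dyadicRatio τ with hrdef
  refine ⟨((bdryBallVol n / unitBallVol n) ^ (1 / 2 : ℝ) + ENNReal.ofReal (1 / (r - 1)) *
    C ^ (1 / 2 : ℝ)) ^ 2, ?_, fun v hv hv2 k => ?_⟩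
  · refine ENNReal.pow_lt_top (ENNReal.add_lt_top.2 ⟨?_, ENNReal.mul_lt_top ENNReal.ofReal_lt_top ?_⟩)
    · exact ENNReal.rpow_lt_top_of_nonneg (by norm_num) hb.ne
    · exact ENNReal.rpow_lt_top_of_nonneg (by norm_num) hC.ne
  apply lintegral_sq_le_of_eLpNorm_le
  have h0 := aestronglyMeasurable_dyadicAvg 0 hv
  have hk := aestronglyMeasurable_dyadicAvg k hv
  have e : dyadicAvg k v = dyadicAvg 0 v - (dyadicAvg 0 v - dyadicAvg k v) := by abel
  rw [e]
  refine (eLpNorm_sub_le h0 (h0.sub hk) one_le_two).trans ?_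
  rw [add_mul, add_mul]
  have hrk : 1 ≤ r ^ k := one_le_pow₀ hr.le
  refine add_le_add ?_ ?_
  · rw [eLpNorm_two_eq]
    calc _ ≤ (bdryBallVol n / unitBallVol n * (sqNorm v + gagliardoSq τ v)) ^ (1 / 2 : ℝ) :=
          ENNReal.rpow_le_rpow ((lintegral_dyadicAvg_zero_le hv).trans
            (mul_le_mul' le_rfl le_self_add)) (by norm_num)
      _ = (bdryBallVol n / unitBallVol n) ^ (1 / 2 : ℝ) * 1 *
            (sqNorm v + gagliardoSq τ v) ^ (1 / 2 : ℝ) := by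
          rw [mul_one, ENNReal.mul_rpow_of_nonneg _ _ (by norm_num)]
      _ ≤ _ := by
          refine mul_le_mul' (mul_le_mul' le_rfl ?_) le_rfl
          simpa using ENNReal.ofReal_le_ofReal hrk
  · refine (h v hv hv2 0 k (Nat.zero_le k)).trans ?_
    rw [ENNReal.mul_rpow_of_nonneg _ _ (by norm_num), ← mul_assoc]
    refine mul_le_mul' ?_ (ENNReal.rpow_le_rpow le_add_self (by norm_num))
    rw [mul_right_comm, ← ENNReal.ofReal_mul (one_div_nonneg.2 (by linarith))]
    refine mul_le_mul' (ENNReal.ofReal_le_ofReal ?_) le_rfl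
    rw [← neg_div_neg_eq, neg_sub, neg_sub, one_div_mul_eq_div, pow_zero]
    have : 0 < r - 1 := by linarith
    gcongr
    linarith

/-! ### The fractional Hardy inequality and its converse. -/

theorem lintegral_upperHalf_le_tsum {n : ℕ} (F : FullSpace n → ℝ≥0∞) :
    ∫⁻ x, F x ∂(halfVol n) ≤ (∫⁻ x in {x : FullSpace n | 1 < x (Fin.last n)}, F x) +
      ∑' k : ℕ, ∫⁻ x in {x : FullSpace n | (1 / 2 : ℝ) ^ k ≤ x (Fin.last n) ∧
        x (Fin.last n) ≤ 2 * (1 / 2 : ℝ) ^ k}, F x := by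
  have hsub : upperHalf n ⊆ {x : FullSpace n | 1 < x (Fin.last n)} ∪
      ⋃ k : ℕ, {x : FullSpace n | (1 / 2 : ℝ) ^ k ≤ x (Fin.last n) ∧
        x (Fin.last n) ≤ 2 * (1 / 2 : ℝ) ^ k} := by
    intro x hx
    have hx0 : 0 < x (Fin.last n) := hx
    rcases lt_or_ge 1 (x (Fin.last n)) with h | h
    · exact Or.inl h
    · obtain ⟨k, hk1, hk2⟩ := exists_nat_pow_near_of_lt_one hx0 h
        (by norm_num : (0 : ℝ) < 1 / 2) (by norm_num)
      -- The given k satisfies 2^(−(k+1)) < x_N ≤ 2^(−k), and the upper end is twice 2^(−(k+1)); the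
      -- layer index is therefore k + 1.
      refine Or.inr (Set.mem_iUnion.2 ⟨k + 1, hk1.le, ?_⟩)
      rw [pow_succ]
      linarith
  refine (lintegral_mono_set hsub).trans ((lintegral_union_le _ _ _).trans ?_)
  exact add_le_add le_rfl (lintegral_iUnion_le _ _)

/-- On the layer t ≤ x_N ≤ 2t with t = 2^(−k), the weight is at most t^(−2σ), and the integral of
|v|² is at most a constant times t times the averaged |v|², which is O(t^(2τ−1)). The layer
contributes O(t^(2τ−2σ)), a geometric series because σ < τ. The assumption on A isolates the role of
the boundary: it is automatic for τ < 1/2 and follows from a vanishing trace for τ > 1/2. -/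
theorem exists_hardy_of_dyadicAvg_le (n : ℕ) {σ τ : ℝ} (hσ : 0 < σ) (h : σ < τ) :
    ∃ C : ℝ≥0∞, C < ⊤ ∧ ∀ v : FullSpace n → ℝ, Measurable v → sqNorm v < ⊤ → ∀ A : ℝ≥0∞,
      (∀ k : ℕ, ∫⁻ x', ‖dyadicAvg k v x'‖ₑ ^ 2 ≤
        A * ENNReal.ofReal (((1 / 2 : ℝ) ^ k) ^ (2 * τ - 1))) →
      ∫⁻ x, ENNReal.ofReal (x (Fin.last n) ^ (-(2 * σ))) * ‖v x‖ₑ ^ 2 ∂(halfVol n) ≤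
        C * (A + sqNorm v + gagliardoSq τ v) := by
  obtain ⟨C, hC, hpair⟩ := lintegral_avgMeasure_pair_le n (by linarith : 0 < τ)
  set K : ℝ≥0∞ := 2 ^ n * (unitBallVol n / bdryBallVol n)
  have hK : K < ⊤ := ENNReal.mul_lt_top (by simp)
    (ENNReal.div_lt_top (unitBallVol_ne_top n) (bdryBallVol_ne_zero n))
  set q : ℝ := (1 / 2 : ℝ) ^ (2 * τ - 2 * σ)
  have hq0 : 0 < q := by positivity
  have hq1 : q < 1 := Real.rpow_lt_one (by norm_num) (by norm_num) (by linarith)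
  have hS : ∑' k : ℕ, ENNReal.ofReal (q ^ k) < ⊤ := by
    rw [← ENNReal.ofReal_tsum_of_nonneg (fun k => by positivity)
      (summable_geometric_of_lt_one hq0.le hq1)]
    exact ENNReal.ofReal_lt_top
  set S := ∑' k : ℕ, ENNReal.ofReal (q ^ k)
  refine ⟨1 + K * (2 + 2 * C) * S, ENNReal.add_lt_top.2 ⟨by simp, ENNReal.mul_lt_top
    (ENNReal.mul_lt_top hK (ENNReal.add_lt_top.2 ⟨by simp, ENNReal.mul_lt_top (by simp) hC⟩)) hS⟩,
    fun v hv hv2 A hA => ?_⟩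
  refine (lintegral_upperHalf_le_tsum _).trans ?_
  have h1 : ∫⁻ x in {x : FullSpace n | 1 < x (Fin.last n)},
      ENNReal.ofReal (x (Fin.last n) ^ (-(2 * σ))) * ‖v x‖ₑ ^ 2 ≤ sqNorm v := by
    calc _ ≤ ∫⁻ x in {x : FullSpace n | 1 < x (Fin.last n)}, ‖v x‖ₑ ^ 2 := by
          refine setLIntegral_mono' (measurableSet_preimage (measurable_last n)
            measurableSet_Ioi) fun x hx => ?_
          have hx' : 1 < x (Fin.last n) := hx
          refine mul_le_of_le_one_left' ?_
          rw [← ENNReal.ofReal_one]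
          exact ENNReal.ofReal_le_ofReal
            (Real.rpow_le_one_of_one_le_of_nonpos hx'.le (by linarith))
      _ ≤ _ := lintegral_mono_set fun x hx =>
          lt_trans zero_lt_one (show (1 : ℝ) < x (Fin.last n) from hx)
  have h2 : ∀ k : ℕ, ∫⁻ x in {x : FullSpace n | (1 / 2 : ℝ) ^ k ≤ x (Fin.last n) ∧
      x (Fin.last n) ≤ 2 * (1 / 2 : ℝ) ^ k},
      ENNReal.ofReal (x (Fin.last n) ^ (-(2 * σ))) * ‖v x‖ₑ ^ 2 ≤
        K * (2 + 2 * C) * (A + gagliardoSq τ v) * ENNReal.ofReal (q ^ k) := by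
    intro k
    obtain ⟨t, htk⟩ : ∃ t : ℝ, t = (1 / 2 : ℝ) ^ k := ⟨_, rfl⟩
    have ht : 0 < t := by rw [htk]; positivity
    rw [← htk]
    have hAk := hA k
    rw [dyadicAvg, ← htk] at hAk
    have hq : q ^ k = t ^ (2 * τ - 2 * σ) := by
      simp only [q, htk]
      rw [← Real.rpow_natCast, ← Real.rpow_natCast, ← Real.rpow_mul (by norm_num),
        ← Real.rpow_mul (by norm_num), mul_comm]
    have hexp : t ^ (-(2 * σ)) * t * t ^ (2 * τ - 1) = t ^ (2 * τ - 2 * σ) := by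
      nth_rewrite 2 [← Real.rpow_one t]
      rw [← Real.rpow_add ht, ← Real.rpow_add ht]
      ring_nf
    calc ∫⁻ x in {x : FullSpace n | t ≤ x (Fin.last n) ∧ x (Fin.last n) ≤ 2 * t},
        ENNReal.ofReal (x (Fin.last n) ^ (-(2 * σ))) * ‖v x‖ₑ ^ 2
        ≤ ∫⁻ x in {x : FullSpace n | t ≤ x (Fin.last n) ∧ x (Fin.last n) ≤ 2 * t},
          ENNReal.ofReal (t ^ (-(2 * σ))) * ‖v x‖ₑ ^ 2 := by
          refine setLIntegral_mono' (measurableSet_preimage (measurable_last n)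
            measurableSet_Icc) fun x hx => ?_
          refine mul_le_mul' (ENNReal.ofReal_le_ofReal ?_) le_rfl
          exact Real.rpow_le_rpow_of_nonpos ht hx.1 (by linarith)
      _ ≤ ENNReal.ofReal (t ^ (-(2 * σ))) * (ENNReal.ofReal t * K *
            ∫⁻ x', ∫⁻ y, ‖v y‖ₑ ^ 2 ∂(avgMeasure t x')) := by
          rw [lintegral_const_mul _ (by fun_prop)]
          exact mul_le_mul' le_rfl (lintegral_layer_le ht (by fun_prop))
      _ ≤ ENNReal.ofReal (t ^ (-(2 * σ))) * (ENNReal.ofReal t * K *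
            (2 * (A * ENNReal.ofReal (t ^ (2 * τ - 1))) +
              2 * (C * ENNReal.ofReal (t ^ (2 * τ - 1)) * gagliardoSq τ v))) := by
          refine mul_le_mul' le_rfl (mul_le_mul' le_rfl
            ((lintegral_avgMeasure_sq_le ht hv hv2).trans ?_))
          exact add_le_add (mul_le_mul' le_rfl hAk)
            (mul_le_mul' le_rfl (hpair t t ht (by linarith) le_rfl v hv))
      _ = K * (2 * A + 2 * C * gagliardoSq τ v) * (ENNReal.ofReal (t ^ (-(2 * σ))) *
            ENNReal.ofReal t * ENNReal.ofReal (t ^ (2 * τ - 1))) := by ring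
      _ = K * (2 * A + 2 * C * gagliardoSq τ v) * ENNReal.ofReal (q ^ k) := by
          rw [← ENNReal.ofReal_mul (by positivity), ← ENNReal.ofReal_mul (by positivity), hexp, hq]
      _ ≤ _ := by
          refine mul_le_mul' ?_ le_rfl
          rw [mul_assoc K (2 + 2 * C)]
          refine mul_le_mul' le_rfl ?_
          rw [add_mul, mul_add, mul_add]
          exact add_le_add le_self_add le_add_self
  refine (add_le_add h1 (ENNReal.tsum_le_tsum h2)).trans ?_
  rw [ENNReal.tsum_mul_left, add_mul, one_mul]
  refine add_le_add (le_add_right le_add_self) ?_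
  rw [mul_right_comm]
  refine mul_le_mul' le_rfl ?_
  rw [add_right_comm]
  exact le_self_add

/-- On the layer at scale t one has 1 ≤ (5t/2)^(2σ) x_N^(−2σ), so the squared averages are bounded
by a constant times t^(2σ−1) times the weighted integral over the layer. At σ = 1/2 the power gives
no decay; the limit is zero because the layer integrals themselves tend to zero by dominated
convergence. -/
theorem tendsto_lintegral_dyadicAvg_sq (n : ℕ) {σ : ℝ} (hσ : 1 / 2 ≤ σ) {v : FullSpace n → ℝ}
    (hv : Measurable v) (h : ∫⁻ x, ENNReal.ofReal (x (Fin.last n) ^ (-(2 * σ))) * ‖v x‖ₑ ^ 2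
      ∂(halfVol n) < ⊤) :
    Tendsto (fun k => ∫⁻ x' : EuclideanSpace ℝ (Fin n), ‖dyadicAvg k v x'‖ₑ ^ 2) atTop (𝓝 0) := by
  set F : FullSpace n → ℝ≥0∞ := fun x =>
    ENNReal.ofReal (x (Fin.last n) ^ (-(2 * σ))) * ‖v x‖ₑ ^ 2
  have hF : Measurable F := by
    have := measurable_last n
    fun_prop
  have hlay : Tendsto (fun k : ℕ => ∫⁻ x, (layer n ((1 / 2 : ℝ) ^ k)).indicator F x ∂(halfVol n))
      atTop (𝓝 0) := by
    have := tendsto_lintegral_of_dominated_convergence (μ := halfVol n) (f := fun _ => 0)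
      (F := fun (k : ℕ) x => (layer n ((1 / 2 : ℝ) ^ k)).indicator F x) F
      (fun k => hF.indicator (measurableSet_layer n _))
      (fun k => Eventually.of_forall fun x => Set.indicator_le_self _ _ _) h.ne ?_
    · simpa using this
    · filter_upwards [ae_halfVol_mem n] with x hx
      have hx0 : 0 < x (Fin.last n) := hx
      refine tendsto_const_nhds.congr' ?_
      obtain ⟨K, hK⟩ := exists_pow_lt_of_lt_one (show 0 < x (Fin.last n) / 4 by positivity)
        (by norm_num : (1 / 2 : ℝ) < 1)
      filter_upwards [eventually_ge_atTop K] with k hk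
      have : (1 / 2 : ℝ) ^ k ≤ (1 / 2 : ℝ) ^ K :=
        pow_le_pow_of_le_one (by norm_num) (by norm_num) hk
      rw [Set.indicator_of_notMem]
      intro hmem
      have := hmem.2
      linarith
  set D : ℝ≥0∞ := bdryBallVol n / unitBallVol n * ENNReal.ofReal ((5 / 2) ^ (2 * σ))
  have hD : D < ⊤ := ENNReal.mul_lt_top (bdryBallVol_div_lt_top n) ENNReal.ofReal_lt_top
  have hlim := ENNReal.Tendsto.const_mul (a := D) hlay (Or.inr hD.ne)
  rw [mul_zero] at hlim
  refine tendsto_of_tendsto_of_tendsto_of_le_of_le tendsto_const_nhds hlim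
    (fun k => zero_le) fun k => ?_
  obtain ⟨t, htk⟩ : ∃ t : ℝ, t = (1 / 2 : ℝ) ^ k := ⟨_, rfl⟩
  have ht : 0 < t := by rw [htk]; positivity
  have ht1 : t ≤ 1 := by rw [htk]; exact pow_le_one₀ (by norm_num) (by norm_num)
  simp only [dyadicAvg, ← htk]
  have hml := measurableSet_layer n t
  have hrestr : ∫⁻ x, (layer n t).indicator F x ∂(halfVol n) = ∫⁻ x in layer n t, F x := by
    rw [lintegral_indicator hml, halfVol, Measure.restrict_restrict hml,
      Set.inter_eq_left.2 (layer_subset_upperHalf ht)]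
  rw [hrestr]
  refine (lintegral_ballAvg_sq_le ht hv).trans ?_
  calc _ ≤ ENNReal.ofReal t⁻¹ * (bdryBallVol n / unitBallVol n) *
        ∫⁻ y in layer n t, ENNReal.ofReal ((5 / 2 * t) ^ (2 * σ)) * F y := by
        refine mul_le_mul' le_rfl (setLIntegral_mono' hml fun y hy => ?_)
        have hy0 : 0 < y (Fin.last n) := layer_subset_upperHalf ht hy
        simp only [F]
        rw [← mul_assoc, ← ENNReal.ofReal_mul (by positivity)]
        refine le_mul_of_one_le_left' ?_
        rw [← ENNReal.ofReal_one]
        apply ENNReal.ofReal_le_ofReal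
        rw [Real.rpow_neg hy0.le, ← div_eq_mul_inv, one_le_div (by positivity)]
        exact Real.rpow_le_rpow hy0.le hy.2.le (by linarith)
    _ = (bdryBallVol n / unitBallVol n) * (ENNReal.ofReal t⁻¹ *
          ENNReal.ofReal ((5 / 2 * t) ^ (2 * σ))) * ∫⁻ y in layer n t, F y := by
        rw [lintegral_const_mul _ hF]
        ring
    _ ≤ _ := by
        refine mul_le_mul' (mul_le_mul' le_rfl ?_) le_rfl
        rw [← ENNReal.ofReal_mul (by positivity)]
        apply ENNReal.ofReal_le_ofReal
        rw [Real.mul_rpow (by norm_num) ht.le, mul_left_comm]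
        refine mul_le_of_le_one_right (by positivity) ?_
        rw [inv_mul_le_iff₀ ht, mul_one]
        calc t ^ (2 * σ) ≤ t ^ (1 : ℝ) := Real.rpow_le_rpow_of_exponent_ge ht ht1 (by linarith)
          _ = t := Real.rpow_one t

/-! ### Weak derivatives and Sobolev norms up to null sets. -/

theorem locallyIntegrableOn_congr_halfVol {n : ℕ} {u v : FullSpace n → ℝ}
    (hu : LocallyIntegrableOn u (upperHalf n) volume) (h : u =ᵐ[halfVol n] v) :
    LocallyIntegrableOn v (upperHalf n) volume := by
  intro x hx
  obtain ⟨S, hS, hi⟩ := hu x hx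
  refine ⟨S ∩ upperHalf n, inter_mem hS self_mem_nhdsWithin, ?_⟩
  exact Integrable.congr (hi.mono_set Set.inter_subset_left)
    (ae_restrict_of_ae_restrict_of_subset Set.inter_subset_right h)

theorem aestronglyMeasurable_halfVol_of_locallyIntegrableOn {n : ℕ} {u : FullSpace n → ℝ}
    (hu : LocallyIntegrableOn u (upperHalf n) volume) : AEStronglyMeasurable u (halfVol n) :=
  hu.aestronglyMeasurable

theorem HasWeakPartial.congr {n : ℕ} {i : Fin (n + 1)} {u u' g g' : FullSpace n → ℝ}
    (h : HasWeakPartial i u g) (hu : u =ᵐ[halfVol n] u') (hg : g =ᵐ[halfVol n] g') :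
    HasWeakPartial i u' g' := by
  refine ⟨locallyIntegrableOn_congr_halfVol h.1 hu, locallyIntegrableOn_congr_halfVol h.2.1 hg, fun φ h1 h2 h3 => ?_⟩
  have e := h.2.2 φ h1 h2 h3
  have e1 : ∫ x in upperHalf n, u' x * fderiv ℝ φ x (EuclideanSpace.single i 1) =
      ∫ x in upperHalf n, u x * fderiv ℝ φ x (EuclideanSpace.single i 1) :=
    integral_congr_ae (hu.mono fun x hx => by simp only [hx])
  have e2 : ∫ x in upperHalf n, g' x * φ x = ∫ x in upperHalf n, g x * φ x :=
    integral_congr_ae (hg.mono fun x hx => by simp only [hx])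
  rw [e1, e2, e]

/-- The product of a function that is locally integrable on `Ω` and a continuous function with
compact support in `Ω` is integrable on `Ω`. -/
theorem integrableOn_mul_of_tsupport_subset {n : ℕ} {u φ : FullSpace n → ℝ}
    (hu : LocallyIntegrableOn u (upperHalf n) volume) (hφ : Continuous φ)
    (hc : HasCompactSupport φ) (hs : tsupport φ ⊆ upperHalf n) :
    IntegrableOn (fun x => u x * φ x) (upperHalf n) := by
  have h1 : IntegrableOn (fun x => u x * φ x) (tsupport φ) :=
    (hu.integrableOn_compact_subset hs hc).mul_continuousOn hφ.continuousOn hc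
  have h2 : Integrable (fun x => u x * φ x) := by
    refine (integrableOn_iff_integrable_of_support_subset ?_).1 h1
    intro x hx
    apply subset_tsupport
    intro h0
    exact hx (by simp [h0])
  exact h2.integrableOn

theorem HasWeakPartial.sub {n : ℕ} {i : Fin (n + 1)} {u u' g g' : FullSpace n → ℝ}
    (h : HasWeakPartial i u g) (h' : HasWeakPartial i u' g') :
    HasWeakPartial i (fun x => u x - u' x) (fun x => g x - g' x) := by
  refine ⟨LocallyIntegrableOn.sub h.1 h'.1, LocallyIntegrableOn.sub h.2.1 h'.2.1, fun φ h1 h2 h3 => ?_⟩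
  have hc : Continuous fun x => fderiv ℝ φ x (EuclideanSpace.single i 1) :=
    (h1.continuous_fderiv (by simp)).clm_apply continuous_const
  have hcs : HasCompactSupport fun x => fderiv ℝ φ x (EuclideanSpace.single i 1) :=
    h2.fderiv_apply ℝ _
  have hts : tsupport (fun x => fderiv ℝ φ x (EuclideanSpace.single i 1)) ⊆ upperHalf n :=
    (tsupport_fderiv_apply_subset ℝ _).trans h3
  simp only [sub_mul]
  rw [integral_sub (integrableOn_mul_of_tsupport_subset h.1 hc hcs hts)
    (integrableOn_mul_of_tsupport_subset h'.1 hc hcs hts),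
    integral_sub (integrableOn_mul_of_tsupport_subset h.2.1 h1.continuous h2 h3)
    (integrableOn_mul_of_tsupport_subset h'.2.1 h1.continuous h2 h3), h.2.2 φ h1 h2 h3,
    h'.2.2 φ h1 h2 h3]
  ring

/-- The fundamental lemma of the calculus of variations on the open set Ω. -/
theorem HasWeakPartial.ae_eq {n : ℕ} {i : Fin (n + 1)} {u g g' : FullSpace n → ℝ}
    (h : HasWeakPartial i u g) (h' : HasWeakPartial i u g') : g =ᵐ[halfVol n] g' := by
  have hl : LocallyIntegrableOn (fun x => g x - g' x) (upperHalf n) volume :=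
    LocallyIntegrableOn.sub h.2.1 h'.2.1
  have h0 := (isOpen_upperHalf n).ae_eq_zero_of_integral_contDiff_smul_eq_zero hl ?_
  · rw [halfVol, Filter.EventuallyEq, ae_restrict_iff' (measurableSet_upperHalf n)]
    filter_upwards [h0] with x hx hxΩ
    exact sub_eq_zero.1 (hx hxΩ)
  · intro φ h1 h2 h3
    have e1 := h.2.2 φ h1 h2 h3
    rw [h'.2.2 φ h1 h2 h3, neg_inj] at e1
    have e2 : ∫ x, φ x • (g x - g' x) = ∫ x in upperHalf n, (g x - g' x) * φ x := by
      rw [setIntegral_eq_integral_of_forall_compl_eq_zero]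
      · simp only [smul_eq_mul, mul_comm]
      · intro x hx
        have : φ x = 0 := image_eq_zero_of_notMem_tsupport fun hx' => hx (h3 hx')
        simp [this]
    rw [e2]
    simp only [sub_mul]
    rw [integral_sub (integrableOn_mul_of_tsupport_subset h.2.1 h1.continuous h2 h3)
      (integrableOn_mul_of_tsupport_subset h'.2.1 h1.continuous h2 h3), e1, sub_self]

theorem HasWeakPartial.weakPartial_spec {n : ℕ} {i : Fin (n + 1)} {u g : FullSpace n → ℝ}
    (h : HasWeakPartial i u g) : HasWeakPartial i u (weakPartial i u) := by
  have hex : ∃ g, HasWeakPartial i u g := ⟨g, h⟩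
  rw [weakPartial, dif_pos hex]
  exact hex.choose_spec

theorem HasWeakPartial.weakPartial_ae_eq {n : ℕ} {i : Fin (n + 1)} {u g : FullSpace n → ℝ}
    (h : HasWeakPartial i u g) : weakPartial i u =ᵐ[halfVol n] g :=
  h.weakPartial_spec.ae_eq h

theorem sqNorm_congr {n : ℕ} {u v : FullSpace n → ℝ} (h : u =ᵐ[halfVol n] v) :
    sqNorm u = sqNorm v :=
  lintegral_congr_ae (h.mono fun x hx => by simp only [hx])

theorem gagliardoSq_congr {n : ℕ} (σ : ℝ) {u v : FullSpace n → ℝ} (h : u =ᵐ[halfVol n] v) :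
    gagliardoSq σ u = gagliardoSq σ v := by
  unfold gagliardoSq
  refine lintegral_congr_ae (h.mono fun x hx => ?_)
  refine lintegral_congr_ae (h.mono fun y hy => ?_)
  simp only [hx, hy]

/-- The representatives of the derivatives of u and v are chosen independently; uniqueness up to
null sets lets the induction proceed. -/
theorem sobolevNormSqAux_congr {n : ℕ} (m : ℕ) (σ : ℝ) :
    ∀ {u v : FullSpace n → ℝ}, u =ᵐ[halfVol n] v →
      sobolevNormSqAux m σ u = sobolevNormSqAux m σ v := by
  induction m with
  | zero =>
    intro u v h
    simp only [sobolevNormSqAux]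
    rw [eLpNorm_congr_ae h, gagliardoSq_congr σ h]
  | succ m ih =>
    intro u v h
    simp only [sobolevNormSqAux]
    rw [eLpNorm_congr_ae h]
    congr 1
    refine Finset.sum_congr rfl fun i _ => ?_
    by_cases hu : ∃ g, HasWeakPartial i u g
    · obtain ⟨g, hg⟩ := hu
      have hv := hg.congr h EventuallyEq.rfl
      rw [if_pos ⟨g, hg⟩, if_pos ⟨g, hv⟩]
      exact ih (hg.weakPartial_ae_eq.trans hv.weakPartial_ae_eq.symm)
    · have hv : ¬ ∃ g, HasWeakPartial i v g := by
        rintro ⟨g, hg⟩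
        exact hu ⟨g, hg.congr h.symm EventuallyEq.rfl⟩
      rw [if_neg hu, if_neg hv]

theorem sqNorm_le_sobolevNormSqAux {n : ℕ} (m : ℕ) (σ : ℝ) (u : FullSpace n → ℝ) :
    sqNorm u ≤ sobolevNormSqAux m σ u := by
  cases m <;> simp only [sobolevNormSqAux, eLpNorm_two_sq, sqNorm] <;> exact le_self_add

theorem exists_hasWeakPartial_of_sobolevNormSqAux_lt_top {n : ℕ} {m : ℕ} {σ : ℝ}
    {u : FullSpace n → ℝ} (h : sobolevNormSqAux (m + 1) σ u < ⊤) (i : Fin (n + 1)) :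
    ∃ g, HasWeakPartial i u g := by
  by_contra hcon
  simp only [sobolevNormSqAux] at h
  have h1 := (ENNReal.add_lt_top.1 h).2
  have h2 := ENNReal.sum_lt_top.1 h1 i (Finset.mem_univ i)
  rw [if_neg hcon] at h2
  exact lt_irrefl _ h2

theorem sobolevNormSqAux_succ_eq {n : ℕ} {m : ℕ} {σ : ℝ} {u : FullSpace n → ℝ}
    (h : ∀ i, ∃ g, HasWeakPartial i u g) : sobolevNormSqAux (m + 1) σ u =
      sqNorm u + ∑ i, sobolevNormSqAux m σ (weakPartial i u) := by
  simp only [sobolevNormSqAux, eLpNorm_two_sq, sqNorm]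
  congr 1
  exact Finset.sum_congr rfl fun i _ => if_pos (h i)

/-! ### One-sided mollification. -/

/-- A bump function supported in the ball of radius `1/(k+1)` about `-2/(k+1) e_N`. -/
noncomputable def shiftedBump (n k : ℕ) :
    ContDiffBump (EuclideanSpace.single (Fin.last n) (-(2 / ((k : ℝ) + 1))) : FullSpace n) where
  rIn := 1 / (2 * ((k : ℝ) + 1))
  rOut := 1 / ((k : ℝ) + 1)
  rIn_pos := by positivity
  rIn_lt_rOut := by
    apply one_div_lt_one_div_of_lt <;> linarith [k.cast_nonneg (α := ℝ)]

/-- The mollifying kernel: a probability density supported in the lower half space. -/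
noncomputable def mollKernel (n k : ℕ) : FullSpace n → ℝ := (shiftedBump n k).normed volume

theorem contDiff_mollKernel (n k : ℕ) : ContDiff ℝ ∞ (mollKernel n k) :=
  (shiftedBump n k).contDiff_normed

theorem hasCompactSupport_mollKernel (n k : ℕ) : HasCompactSupport (mollKernel n k) :=
  (shiftedBump n k).hasCompactSupport_normed

theorem mollKernel_nonneg (n k : ℕ) (t : FullSpace n) : 0 ≤ mollKernel n k t :=
  (shiftedBump n k).nonneg_normed t

theorem tsupport_mollKernel (n k : ℕ) : tsupport (mollKernel n k) =
    Metric.closedBall (EuclideanSpace.single (Fin.last n) (-(2 / ((k : ℝ) + 1))))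
      (1 / ((k : ℝ) + 1)) :=
  (shiftedBump n k).tsupport_normed_eq

theorem last_neg_of_mem_tsupport_mollKernel {n k : ℕ} {t : FullSpace n}
    (ht : t ∈ tsupport (mollKernel n k)) : t (Fin.last n) < 0 := by
  rw [tsupport_mollKernel, Metric.mem_closedBall, dist_eq_norm] at ht
  have h := (le_abs_self _).trans ((abs_apply_le_norm _ (Fin.last n)).trans ht)
  have hk : (0 : ℝ) < 1 / ((k : ℝ) + 1) := by positivity
  rw [PiLp.sub_apply] at h
  simp only [PiLp.single_apply, if_true] at h
  have e : 2 / ((k : ℝ) + 1) = 2 * (1 / ((k : ℝ) + 1)) := by ring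
  rw [e] at h
  linarith

theorem norm_le_of_mem_tsupport_mollKernel {n k : ℕ} {t : FullSpace n}
    (ht : t ∈ tsupport (mollKernel n k)) : ‖t‖ ≤ 3 / ((k : ℝ) + 1) := by
  rw [tsupport_mollKernel, Metric.mem_closedBall] at ht
  have h := dist_triangle t (EuclideanSpace.single (Fin.last n) (-(2 / ((k : ℝ) + 1)))) 0
  rw [dist_zero_right, dist_zero_right, PiLp.norm_single, norm_neg, Real.norm_eq_abs,
    abs_of_pos (by positivity)] at h
  calc ‖t‖ ≤ 1 / ((k : ℝ) + 1) + 2 / ((k : ℝ) + 1) := by linarith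
    _ = _ := by ring

/-- The probability measure with density `mollKernel n k`. -/
noncomputable def mollMeasure (n k : ℕ) : Measure (FullSpace n) :=
  volume.withDensity fun t => ENNReal.ofReal (mollKernel n k t)

theorem measurable_mollKernel (n k : ℕ) : Measurable (mollKernel n k) :=
  (contDiff_mollKernel n k).continuous.measurable

instance isProbabilityMeasure_mollMeasure (n k : ℕ) : IsProbabilityMeasure (mollMeasure n k) := by
  constructor
  rw [mollMeasure, withDensity_apply _ MeasurableSet.univ, Measure.restrict_univ]
  have h := ofReal_integral_eq_lintegral_ofReal (f := mollKernel n k) (μ := volume)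
    (shiftedBump n k).integrable_normed (Eventually.of_forall (mollKernel_nonneg n k))
  rw [← h, mollKernel, (shiftedBump n k).integral_normed, ENNReal.ofReal_one]

theorem ae_mollMeasure (n k : ℕ) : ∀ᵐ t ∂(mollMeasure n k), t ∈ tsupport (mollKernel n k) := by
  rw [mollMeasure, ae_withDensity_iff (by have := measurable_mollKernel n k; fun_prop)]
  refine Eventually.of_forall fun t ht => ?_
  apply subset_tsupport
  intro h0
  exact ht (by simp [h0])

theorem integral_mollMeasure (n k : ℕ) (f : FullSpace n → ℝ) :
    ∫ t, f t ∂(mollMeasure n k) = ∫ t, mollKernel n k t * f t := by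
  have hm := measurable_mollKernel n k
  rw [mollMeasure, integral_withDensity_eq_integral_toReal_smul (by fun_prop)
    (Eventually.of_forall fun t => ENNReal.ofReal_lt_top)]
  simp only [ENNReal.toReal_ofReal (mollKernel_nonneg n k _), smul_eq_mul]

/-- The restriction of `v` to `Ω`, extended by zero. -/
noncomputable def zeroExt {n : ℕ} (v : FullSpace n → ℝ) : FullSpace n → ℝ :=
  (upperHalf n).indicator v

theorem zeroExt_of_mem {n : ℕ} {v : FullSpace n → ℝ} {x : FullSpace n} (hx : x ∈ upperHalf n) :
    zeroExt v x = v x := Set.indicator_of_mem hx v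

theorem measurable_zeroExt {n : ℕ} {v : FullSpace n → ℝ} (hv : Measurable v) :
    Measurable (zeroExt v) := hv.indicator (measurableSet_upperHalf n)

theorem lintegral_zeroExt {n : ℕ} (v : FullSpace n → ℝ) :
    ∫⁻ x, ‖zeroExt v x‖ₑ ^ 2 = sqNorm v := by
  rw [sqNorm, halfVol, ← lintegral_indicator (measurableSet_upperHalf n)]
  refine lintegral_congr fun x => ?_
  by_cases hx : x ∈ upperHalf n
  · rw [zeroExt_of_mem hx, Set.indicator_of_mem hx]
  · rw [zeroExt, Set.indicator_of_notMem hx, Set.indicator_of_notMem hx]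
    simp

theorem memLp_zeroExt {n : ℕ} {v : FullSpace n → ℝ} (hv : Measurable v) (h : sqNorm v < ⊤) :
    MemLp (zeroExt v) 2 volume := by
  rw [memLp_two_iff (measurable_zeroExt hv).aestronglyMeasurable, lintegral_zeroExt]
  exact h

theorem locallyIntegrable_zeroExt {n : ℕ} {v : FullSpace n → ℝ} (hv : Measurable v)
    (h : sqNorm v < ⊤) : LocallyIntegrable (zeroExt v) volume :=
  (memLp_zeroExt hv h).locallyIntegrable one_le_two

/-- The mollification of `v`. -/
noncomputable def mollify {n : ℕ} (k : ℕ) (v : FullSpace n → ℝ) (x : FullSpace n) : ℝ :=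
  ∫ t, zeroExt v t * mollKernel n k (x - t)

theorem mollify_eq_convolution {n : ℕ} (k : ℕ) (v : FullSpace n → ℝ) :
    mollify k v = MeasureTheory.convolution (zeroExt v) (mollKernel n k)
      (ContinuousLinearMap.mul ℝ ℝ) volume := rfl

theorem contDiff_mollify {n : ℕ} (k : ℕ) {v : FullSpace n → ℝ} (hv : Measurable v)
    (h : sqNorm v < ⊤) : ContDiff ℝ ∞ (mollify k v) := by
  rw [mollify_eq_convolution]
  exact (hasCompactSupport_mollKernel n k).contDiff_convolution_right _
    (locallyIntegrable_zeroExt hv h) (contDiff_mollKernel n k)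

/-- Written as an average of translates over a probability measure, the mollification is controlled
by Jensen's inequality and Tonelli. -/
theorem mollify_eq_integral_mollMeasure {n : ℕ} (k : ℕ) (v : FullSpace n → ℝ) (x : FullSpace n) :
    mollify k v x = ∫ t, zeroExt v (x - t) ∂(mollMeasure n k) := by
  rw [integral_mollMeasure, mollify, ← integral_sub_left_eq_self _ volume x]
  simp only [sub_sub_cancel, mul_comm]

theorem integrable_mollMeasure {n : ℕ} (k : ℕ) {v : FullSpace n → ℝ} (hv : Measurable v)
    (h : sqNorm v < ⊤) (x : FullSpace n) :
    Integrable (fun t => zeroExt v (x - t)) (mollMeasure n k) := by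
  have hm := measurable_mollKernel n k
  have hc := (hasCompactSupport_mollKernel n k).convolutionExists_right
    (ContinuousLinearMap.mul ℝ ℝ) (locallyIntegrable_zeroExt hv h)
    (contDiff_mollKernel n k).continuous x
  have h1 : Integrable (fun t => zeroExt v t * mollKernel n k (x - t)) := hc
  have h2 := h1.comp_sub_left x
  rw [mollMeasure, integrable_withDensity_iff_integrable_smul₀' (by fun_prop)
    (Eventually.of_forall fun t => ENNReal.ofReal_lt_top)]
  refine h2.congr (Eventually.of_forall fun t => ?_)
  simp only [ENNReal.toReal_ofReal (mollKernel_nonneg n k _), smul_eq_mul, sub_sub_cancel, mul_comm]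

/-- For x in Ω the function y ↦ K(x − y) is supported inside Ω, because the kernel lives below the
boundary. It is thus an admissible test function, and the extension of v by zero produces no
boundary term. -/
theorem fderiv_mollify {n : ℕ} (k : ℕ) {v g : FullSpace n → ℝ} {i : Fin (n + 1)}
    (hv : Measurable v) (h : sqNorm v < ⊤) (hw : HasWeakPartial i v g) {x : FullSpace n}
    (hx : x ∈ upperHalf n) :
    fderiv ℝ (mollify k v) x (EuclideanSpace.single i 1) = mollify k g x := by
  have hK := contDiff_mollKernel n k
  have hKc := hasCompactSupport_mollKernel n k
  have hd := hKc.hasFDerivAt_convolution_right (ContinuousLinearMap.mul ℝ ℝ)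
    (locallyIntegrable_zeroExt hv h) (hK.of_le (by exact_mod_cast le_top)) x
  rw [mollify_eq_convolution, hd.fderiv, convolution_precompR_apply _
    (locallyIntegrable_zeroExt hv h) (hKc.fderiv ℝ) (hK.continuous_fderiv (by simp))]
  set φ : FullSpace n → ℝ := fun y => mollKernel n k (x - y) with hφ
  have hφ1 : ContDiff ℝ ∞ φ := hK.comp (contDiff_const.sub contDiff_id)
  have hφ2 : HasCompactSupport φ := hKc.comp_homeomorph (Homeomorph.subLeft x)
  have hφ3 : tsupport φ ⊆ upperHalf n := by
    have : tsupport φ ⊆ (fun y => x - y) ⁻¹' tsupport (mollKernel n k) := by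
      refine closure_minimal (fun y hy => subset_tsupport _ hy)
        ((isClosed_tsupport _).preimage (by fun_prop))
    intro y hy
    have h1 := last_neg_of_mem_tsupport_mollKernel (this hy)
    have hx0 : 0 < x (Fin.last n) := hx
    rw [PiLp.sub_apply] at h1
    show 0 < y (Fin.last n)
    linarith
  have hder : ∀ y, fderiv ℝ φ y (EuclideanSpace.single i 1) =
      - fderiv ℝ (mollKernel n k) (x - y) (EuclideanSpace.single i 1) := by
    intro y
    have h1 : HasFDerivAt φ ((fderiv ℝ (mollKernel n k) (x - y)).comp
        (-(ContinuousLinearMap.id ℝ (FullSpace n)))) y :=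
      ((hK.differentiable (by simp)) (x - y)).hasFDerivAt.comp y
        ((hasFDerivAt_id y).const_sub x)
    rw [h1.fderiv]
    simp
  have hset : ∀ f w : FullSpace n → ℝ, ∫ y, zeroExt f y * w y = ∫ y in upperHalf n, f y * w y := by
    intro f w
    rw [← integral_indicator (measurableSet_upperHalf n)]
    refine integral_congr_ae (Eventually.of_forall fun y => ?_)
    simp only [zeroExt]
    rw [Set.indicator_mul_left]
  have e := hw.2.2 φ hφ1 hφ2 hφ3
  simp only [hder, mul_neg, integral_neg, neg_inj] at e
  rw [mollify, hset, ← e, ← hset]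
  rfl

theorem locallyIntegrableOn_of_continuous {n : ℕ} {v : FullSpace n → ℝ} (hv : Continuous v) :
    LocallyIntegrableOn v (upperHalf n) volume :=
  hv.locallyIntegrable.locallyIntegrableOn _

theorem hasWeakPartial_of_contDiff {n : ℕ} {i : Fin (n + 1)} {u : FullSpace n → ℝ}
    (hu : ContDiff ℝ ∞ u) :
    HasWeakPartial i u (fun x => fderiv ℝ u x (EuclideanSpace.single i 1)) := by
  have hu' : Continuous fun x => fderiv ℝ u x (EuclideanSpace.single i 1) :=
    (hu.continuous_fderiv (by simp)).clm_apply continuous_const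
  refine ⟨locallyIntegrableOn_of_continuous hu.continuous,
    locallyIntegrableOn_of_continuous hu', fun φ h1 h2 h3 => ?_⟩
  have hφ' : Continuous fun x => fderiv ℝ φ x (EuclideanSpace.single i 1) :=
    (h1.continuous_fderiv (by simp)).clm_apply continuous_const
  have hφc : HasCompactSupport fun x => fderiv ℝ φ x (EuclideanSpace.single i 1) :=
    h2.fderiv_apply ℝ _
  have e1 : ∫ x in upperHalf n, u x * fderiv ℝ φ x (EuclideanSpace.single i 1) =
      ∫ x, u x * fderiv ℝ φ x (EuclideanSpace.single i 1) := by
    refine setIntegral_eq_integral_of_forall_compl_eq_zero fun x hx => ?_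
    rw [image_eq_zero_of_notMem_tsupport (f := fun x => fderiv ℝ φ x (EuclideanSpace.single i 1))
      fun hx' => hx (h3 (tsupport_fderiv_apply_subset ℝ _ hx')), mul_zero]
  have e2 : ∫ x in upperHalf n, fderiv ℝ u x (EuclideanSpace.single i 1) * φ x =
      ∫ x, fderiv ℝ u x (EuclideanSpace.single i 1) * φ x := by
    refine setIntegral_eq_integral_of_forall_compl_eq_zero fun x hx => ?_
    rw [image_eq_zero_of_notMem_tsupport fun hx' => hx (h3 hx'), mul_zero]
  rw [e1, e2]
  refine integral_mul_fderiv_eq_neg_fderiv_mul_of_integrable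
    ((hu'.mul h1.continuous).integrable_of_hasCompactSupport h2.mul_left)
    ((hu.continuous.mul hφ').integrable_of_hasCompactSupport hφc.mul_left)
    ((hu.continuous.mul h1.continuous).integrable_of_hasCompactSupport h2.mul_left)
    (fun x _ => (hu.differentiable (by simp)) x) (fun x _ => (h1.differentiable (by simp)) x)

theorem hasWeakPartial_mollify {n : ℕ} (k : ℕ) {v g : FullSpace n → ℝ} {i : Fin (n + 1)}
    (hv : Measurable v) (h : sqNorm v < ⊤) (hw : HasWeakPartial i v g) :
    HasWeakPartial i (mollify k v) (mollify k g) := by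
  refine (hasWeakPartial_of_contDiff (contDiff_mollify k hv h)).congr EventuallyEq.rfl ?_
  filter_upwards [ae_halfVol_mem n] with x hx
  exact fderiv_mollify k hv h hw hx

/-- Continuity of translations in L². The general setting permits its use both on the space and on
its square, where the Gagliardo quotient lives. -/
theorem tendsto_lintegral_translate_sub_sq {X : Type*} [NormedAddCommGroup X] [MeasurableSpace X]
    [BorelSpace X] (μ : Measure X) [IsLocallyFiniteMeasure μ] [μ.InnerRegularCompactLTTop]
    [μ.IsAddRightInvariant] {F : X → ℝ} (hF : MemLp F 2 μ) :
    Tendsto (fun a => ∫⁻ p, ‖F (p - a) - F p‖ₑ ^ 2 ∂μ) (𝓝 0) (𝓝 0) := by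
  let G : Lp ℝ 2 μ := hF.toLp
  let T : C(X, C(X, X)) := (ContinuousMap.mk (fun q : X × X => q.2 - q.1) (by fun_prop)).curry
  have hT : ∀ a, MeasurePreserving (T a) μ μ := fun a => measurePreserving_sub_right μ a
  have hc : Continuous fun a => Lp.compMeasurePreserving (T a) (hT a) G :=
    continuous_const.compMeasurePreservingLp T.continuous hT (by simp)
  have h0 : Lp.compMeasurePreserving (T 0) (hT 0) G = G := by
    apply Lp.ext
    filter_upwards [Lp.coeFn_compMeasurePreserving G (hT 0)] with x hx
    rw [hx]
    simp [T]
  have h1 : Tendsto (fun a => edist (Lp.compMeasurePreserving (T a) (hT a) G) G) (𝓝 0) (𝓝 0) := by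
    have h2 := (hc.tendsto 0).edist (tendsto_const_nhds (x := G))
    rwa [h0, edist_self] at h2
  have h3 : ∀ a, edist (Lp.compMeasurePreserving (T a) (hT a) G) G ^ 2 =
      ∫⁻ p, ‖F (p - a) - F p‖ₑ ^ 2 ∂μ := by
    intro a
    rw [Lp.edist_def, eLpNorm_two_sq]
    refine lintegral_congr_ae ?_
    have h4 : (fun p => G (T a p)) =ᵐ[μ] fun p => F (T a p) :=
      (hT a).quasiMeasurePreserving.ae_eq_comp hF.coeFn_toLp
    filter_upwards [Lp.coeFn_compMeasurePreserving G (hT a), h4, hF.coeFn_toLp] with p h5 h6 h7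
    simp only [Pi.sub_apply]
    rw [h5]
    simp only [Function.comp_apply]
    rw [h6, h7]
    rfl
  have h8 := ENNReal.Tendsto.pow (n := 2) h1
  simp only [h3] at h8
  simpa using h8

theorem tendsto_lintegral_mollMeasure {n : ℕ} {w : FullSpace n → ℝ≥0∞}
    (hw : Tendsto w (𝓝 0) (𝓝 0)) :
    Tendsto (fun k => ∫⁻ t, w t ∂(mollMeasure n k)) atTop (𝓝 0) := by
  rw [ENNReal.tendsto_nhds_zero] at hw ⊢
  intro ε hε
  obtain ⟨δ, hδ, hball⟩ := Metric.eventually_nhds_iff.1 (hw ε hε)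
  have hlim : Tendsto (fun k : ℕ => 3 / ((k : ℝ) + 1)) atTop (𝓝 0) := by
    have := (tendsto_one_div_add_atTop_nhds_zero_nat (𝕜 := ℝ)).const_mul 3
    simpa [div_eq_mul_inv] using this
  filter_upwards [hlim.eventually (gt_mem_nhds hδ)] with k hk
  calc ∫⁻ t, w t ∂(mollMeasure n k) ≤ ∫⁻ _t, ε ∂(mollMeasure n k) := by
        refine lintegral_mono_ae ?_
        filter_upwards [ae_mollMeasure n k] with t ht
        apply hball
        rw [dist_zero_right]
        exact (norm_le_of_mem_tsupport_mollKernel ht).trans_lt hk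
    _ = ε := by simp

theorem sub_mem_upperHalf {n k : ℕ} {x t : FullSpace n} (hx : x ∈ upperHalf n)
    (ht : t ∈ tsupport (mollKernel n k)) : x - t ∈ upperHalf n := by
  have h1 := last_neg_of_mem_tsupport_mollKernel ht
  have hx0 : 0 < x (Fin.last n) := hx
  show 0 < (x - t) (Fin.last n)
  rw [PiLp.sub_apply]
  linarith

theorem sqNorm_mollify_le {n : ℕ} (k : ℕ) {v : FullSpace n → ℝ} (hv : Measurable v) :
    sqNorm (mollify k v) ≤ sqNorm v := by
  have hz := measurable_zeroExt hv
  calc sqNorm (mollify k v) ≤ ∫⁻ x, ∫⁻ t, ‖zeroExt v (x - t)‖ₑ ^ 2 ∂(mollMeasure n k) := by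
        refine (lintegral_mono' (halfVol_le n) le_rfl).trans (lintegral_mono fun x => ?_)
        rw [mollify_eq_integral_mollMeasure]
        exact enorm_integral_sq_le _ (by fun_prop)
    _ = ∫⁻ t, (∫⁻ x, ‖zeroExt v (x - t)‖ₑ ^ 2) ∂(mollMeasure n k) := by
        rw [lintegral_lintegral_swap]
        fun_prop
    _ = sqNorm v := by
        simp only [lintegral_sub_right_eq_self (fun x => ‖zeroExt v x‖ₑ ^ 2), lintegral_zeroExt]
        simp

theorem tendsto_sqNorm_mollify_sub {n : ℕ} {v : FullSpace n → ℝ} (hv : Measurable v)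
    (h : sqNorm v < ⊤) : Tendsto (fun k => sqNorm (fun x => mollify k v x - v x)) atTop (𝓝 0) := by
  have hz := measurable_zeroExt hv
  have hlim := tendsto_lintegral_mollMeasure
    (tendsto_lintegral_translate_sub_sq volume (memLp_zeroExt hv h))
  refine tendsto_of_tendsto_of_tendsto_of_le_of_le tendsto_const_nhds hlim
    (fun k => zero_le) fun k => ?_
  calc sqNorm (fun x => mollify k v x - v x)
      ≤ ∫⁻ x, ∫⁻ t, ‖zeroExt v (x - t) - zeroExt v x‖ₑ ^ 2 ∂(mollMeasure n k) ∂(halfVol n) := by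
        refine lintegral_mono_ae ?_
        filter_upwards [ae_halfVol_mem n] with x hx
        rw [← enorm_neg, neg_sub, mollify_eq_integral_mollMeasure, ← zeroExt_of_mem (v := v) hx]
        refine (enorm_sub_integral_sq_le _ (integrable_mollMeasure k hv h x) _).trans
          (lintegral_mono fun t => ?_)
        rw [← enorm_neg, neg_sub]
    _ ≤ ∫⁻ x, ∫⁻ t, ‖zeroExt v (x - t) - zeroExt v x‖ₑ ^ 2 ∂(mollMeasure n k) :=
        lintegral_mono' (halfVol_le n) le_rfl
    _ = ∫⁻ t, (∫⁻ x, ‖zeroExt v (x - t) - zeroExt v x‖ₑ ^ 2) ∂(mollMeasure n k) := by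
        rw [lintegral_lintegral_swap]
        fun_prop

/-- The difference quotient whose `L²` norm is the Gagliardo seminorm, extended by zero from
`Ω × Ω`. -/
noncomputable def gagliardoQuotient {n : ℕ} (σ : ℝ) (v : FullSpace n → ℝ) :
    FullSpace n × FullSpace n → ℝ :=
  (upperHalf n ×ˢ upperHalf n).indicator
    fun p => (v p.1 - v p.2) * ‖p.1 - p.2‖ ^ (-((((n + 1 : ℕ) : ℝ) + 2 * σ) / 2))

theorem measurable_gagliardoQuotient {n : ℕ} (σ : ℝ) {v : FullSpace n → ℝ} (hv : Measurable v) :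
    Measurable (gagliardoQuotient σ v) := by
  refine Measurable.indicator (by fun_prop)
    ((measurableSet_upperHalf n).prod (measurableSet_upperHalf n))

theorem enorm_sub_mul_rpow_sq {n : ℕ} (σ a : ℝ) (z : FullSpace n) :
    ‖a * ‖z‖ ^ (-((((n + 1 : ℕ) : ℝ) + 2 * σ) / 2))‖ₑ ^ 2 =
      ‖a‖ₑ ^ 2 * normPow (-(((n + 1 : ℕ) : ℝ) + 2 * σ)) z := by
  rw [enorm_mul, mul_pow]
  congr 1
  rw [Real.enorm_eq_ofReal (by positivity)]
  have := normPow_sq (-((((n + 1 : ℕ) : ℝ) + 2 * σ) / 2)) z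
  rw [normPow] at this
  rw [this]
  congr 1
  ring

theorem lintegral_gagliardoQuotient {n : ℕ} (σ : ℝ) {v : FullSpace n → ℝ} (hv : Measurable v) :
    ∫⁻ p, ‖gagliardoQuotient σ v p‖ₑ ^ 2 = gagliardoSq σ v := by
  have hm := measurable_gagliardoQuotient σ hv
  have hS := (measurableSet_upperHalf n).prod (measurableSet_upperHalf n)
  have hnp := measurable_normPow (n := n) (-(((n + 1 : ℕ) : ℝ) + 2 * σ))
  have e : ∀ p, ‖gagliardoQuotient σ v p‖ₑ ^ 2 = (upperHalf n ×ˢ upperHalf n).indicator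
      (fun p => ‖v p.1 - v p.2‖ₑ ^ 2 * normPow (-(((n + 1 : ℕ) : ℝ) + 2 * σ)) (p.1 - p.2)) p := by
    intro p
    by_cases hp : p ∈ upperHalf n ×ˢ upperHalf n
    · rw [gagliardoQuotient, Set.indicator_of_mem hp, Set.indicator_of_mem hp,
        enorm_sub_mul_rpow_sq]
    · rw [gagliardoQuotient, Set.indicator_of_notMem hp, Set.indicator_of_notMem hp]
      simp
  simp only [e]
  rw [lintegral_indicator hS, gagliardoSq_eq, Measure.volume_eq_prod, ← Measure.prod_restrict,
    lintegral_prod _ (by fun_prop)]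
  rfl

theorem gagliardoQuotient_of_mem {n : ℕ} (σ : ℝ) (v : FullSpace n → ℝ) {x y : FullSpace n}
    (hx : x ∈ upperHalf n) (hy : y ∈ upperHalf n) : gagliardoQuotient σ v (x, y) =
      (v x - v y) * ‖x - y‖ ^ (-((((n + 1 : ℕ) : ℝ) + 2 * σ) / 2)) := by
  rw [gagliardoQuotient, Set.indicator_of_mem (Set.mk_mem_prod hx hy)]

/-- Translating both points by t leaves x − y unchanged, so the quotient of a mollification is the
average of the quotient over diagonal translations. The Gagliardo seminorm can then be handled as an
L² norm on the product. -/
theorem mollify_sub_mul_eq_integral {n : ℕ} (σ : ℝ) (k : ℕ) {v : FullSpace n → ℝ}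
    (hv : Measurable v) (h : sqNorm v < ⊤) {x y : FullSpace n}
    (hx : x ∈ upperHalf n) (hy : y ∈ upperHalf n) :
    (mollify k v x - mollify k v y) * ‖x - y‖ ^ (-((((n + 1 : ℕ) : ℝ) + 2 * σ) / 2)) =
      ∫ t, gagliardoQuotient σ v (x - t, y - t) ∂(mollMeasure n k) ∧
    Integrable (fun t => gagliardoQuotient σ v (x - t, y - t)) (mollMeasure n k) := by
  have hix := integrable_mollMeasure k hv h x
  have hiy := integrable_mollMeasure k hv h y
  have e : (fun t => (zeroExt v (x - t) - zeroExt v (y - t)) *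
      ‖x - y‖ ^ (-((((n + 1 : ℕ) : ℝ) + 2 * σ) / 2))) =ᵐ[mollMeasure n k]
      fun t => gagliardoQuotient σ v (x - t, y - t) := by
    filter_upwards [ae_mollMeasure n k] with t ht
    have hx' := sub_mem_upperHalf hx ht
    have hy' := sub_mem_upperHalf hy ht
    rw [gagliardoQuotient_of_mem σ v hx' hy', zeroExt_of_mem hx', zeroExt_of_mem hy',
      sub_sub_sub_cancel_right]
  refine ⟨?_, ((hix.sub hiy).mul_const _).congr e⟩
  rw [← integral_congr_ae e, integral_mul_const, integral_sub hix hiy,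
    mollify_eq_integral_mollMeasure, mollify_eq_integral_mollMeasure]

theorem gagliardoSq_le_of_integrand_le {n : ℕ} {σ : ℝ} {u : FullSpace n → ℝ} (k : ℕ)
    {Φ : FullSpace n × FullSpace n → FullSpace n → ℝ≥0∞}
    (hΦ : Measurable (Function.uncurry Φ))
    (h : ∀ x ∈ upperHalf n, ∀ y ∈ upperHalf n,
      ‖(u x - u y) * ‖x - y‖ ^ (-((((n + 1 : ℕ) : ℝ) + 2 * σ) / 2))‖ₑ ^ 2 ≤
        ∫⁻ t, Φ (x, y) t ∂(mollMeasure n k)) :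
    gagliardoSq σ u ≤ ∫⁻ t, (∫⁻ p, Φ p t) ∂(mollMeasure n k) := by
  have hmeas : Measurable fun p => ∫⁻ t, Φ p t ∂(mollMeasure n k) := hΦ.lintegral_prod_right
  calc gagliardoSq σ u ≤ ∫⁻ x, ∫⁻ y, (∫⁻ t, Φ (x, y) t ∂(mollMeasure n k))
        ∂(halfVol n) ∂(halfVol n) := by
        rw [gagliardoSq_eq]
        refine lintegral_mono_ae ?_
        filter_upwards [ae_halfVol_mem n] with x hx
        refine lintegral_mono_ae ?_
        filter_upwards [ae_halfVol_mem n] with y hy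
        rw [← enorm_sub_mul_rpow_sq]
        exact h x hx y hy
    _ ≤ ∫⁻ x, ∫⁻ y, (∫⁻ t, Φ (x, y) t ∂(mollMeasure n k)) :=
        lintegral_mono' (halfVol_le n) fun x => lintegral_mono' (halfVol_le n) le_rfl
    _ = ∫⁻ p, ∫⁻ t, Φ p t ∂(mollMeasure n k) := by
        rw [Measure.volume_eq_prod, lintegral_prod _ hmeas.aemeasurable]
    _ = _ := by
        rw [lintegral_lintegral_swap]
        exact hΦ.aemeasurable

instance (n : ℕ) :
    (volume : Measure (FullSpace n × FullSpace n)).IsAddRightInvariant := by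
  rw [Measure.volume_eq_prod]
  infer_instance

theorem lintegral_prod_translate {n : ℕ} (Φ : FullSpace n × FullSpace n → ℝ≥0∞)
    (t : FullSpace n) : ∫⁻ p : FullSpace n × FullSpace n, Φ (p.1 - t, p.2 - t) = ∫⁻ p, Φ p :=
  lintegral_sub_right_eq_self Φ (t, t)

theorem gagliardoSq_mollify_le {n : ℕ} (σ : ℝ) (k : ℕ) {v : FullSpace n → ℝ}
    (hv : Measurable v) (h : sqNorm v < ⊤) : gagliardoSq σ (mollify k v) ≤ gagliardoSq σ v := by
  have hm := measurable_gagliardoQuotient σ hv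
  refine (gagliardoSq_le_of_integrand_le (σ := σ) k
    (Φ := fun p t => ‖gagliardoQuotient σ v (p.1 - t, p.2 - t)‖ₑ ^ 2) ?_ ?_).trans ?_
  · unfold Function.uncurry
    fun_prop
  · intro x hx y hy
    obtain ⟨h1, h2⟩ := mollify_sub_mul_eq_integral σ k hv h hx hy
    rw [h1]
    exact enorm_integral_sq_le _ h2.aemeasurable
  · simp only [lintegral_prod_translate (fun p => ‖gagliardoQuotient σ v p‖ₑ ^ 2),
      lintegral_gagliardoQuotient σ hv]
    simp

theorem tendsto_gagliardoSq_mollify_sub {n : ℕ} (σ : ℝ) {v : FullSpace n → ℝ}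
    (hv : Measurable v) (h : sqNorm v < ⊤) (hg : gagliardoSq σ v < ⊤) :
    Tendsto (fun k => gagliardoSq σ (fun x => mollify k v x - v x)) atTop (𝓝 0) := by
  have hm := measurable_gagliardoQuotient σ hv
  have hL : MemLp (gagliardoQuotient σ v) 2 volume := by
    rw [memLp_two_iff hm.aestronglyMeasurable, lintegral_gagliardoQuotient σ hv]
    exact hg
  have htr := tendsto_lintegral_translate_sub_sq volume hL
  have hdiag : Tendsto (fun t : FullSpace n => (t, t)) (𝓝 0) (𝓝 0) := by
    have : Continuous fun t : FullSpace n => (t, t) := by fun_prop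
    exact this.tendsto 0
  have hlim := tendsto_lintegral_mollMeasure (htr.comp hdiag)
  refine tendsto_of_tendsto_of_tendsto_of_le_of_le tendsto_const_nhds hlim
    (fun k => zero_le) fun k => ?_
  refine gagliardoSq_le_of_integrand_le (σ := σ) k
    (Φ := fun p t => ‖gagliardoQuotient σ v (p - (t, t)) - gagliardoQuotient σ v p‖ₑ ^ 2) ?_ ?_
  · unfold Function.uncurry
    fun_prop
  · intro x hx y hy
    obtain ⟨h1, h2⟩ := mollify_sub_mul_eq_integral σ k hv h hx hy
    rw [sub_sub_sub_comm, sub_mul, h1, ← gagliardoQuotient_of_mem σ v hx hy, ← enorm_neg, neg_sub]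
    refine (enorm_sub_integral_sq_le _ h2 _).trans (lintegral_mono fun t => ?_)
    rw [← enorm_neg, neg_sub]
    rfl

theorem exists_measurable_ae_eq {n : ℕ} {v : FullSpace n → ℝ}
    (hv : AEStronglyMeasurable v (halfVol n)) :
    ∃ v' : FullSpace n → ℝ, Measurable v' ∧ v =ᵐ[halfVol n] v' :=
  ⟨hv.mk v, hv.stronglyMeasurable_mk.measurable, hv.ae_eq_mk⟩

/-- Mollification commutes with weak derivatives on Ω, so the induction on the order reduces to L²
and the Gagliardo seminorm. -/
theorem sobolevNormSqAux_mollify {n : ℕ} (m : ℕ) (σ : ℝ) : ∀ v : FullSpace n → ℝ, Measurable v →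
    sobolevNormSqAux m σ v < ⊤ → (∀ k, sobolevNormSqAux m σ (mollify k v) < ⊤) ∧
      Tendsto (fun k => sobolevNormSqAux m σ (fun x => mollify k v x - v x)) atTop (𝓝 0) := by
  induction m with
  | zero =>
    intro v hv h
    have h2 : sqNorm v < ⊤ := (sqNorm_le_sobolevNormSqAux 0 σ v).trans_lt h
    have hlim := tendsto_sqNorm_mollify_sub hv h2
    simp only [sobolevNormSqAux, eLpNorm_two_sq] at h ⊢
    by_cases hσ : 0 < σ
    · simp only [if_pos hσ] at h ⊢
      refine ⟨fun k => ENNReal.add_lt_top.2 ⟨(sqNorm_mollify_le k hv).trans_lt h2,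
        (gagliardoSq_mollify_le σ k hv h2).trans_lt (ENNReal.add_lt_top.1 h).2⟩, ?_⟩
      simpa [sqNorm] using hlim.add (tendsto_gagliardoSq_mollify_sub σ hv h2 (ENNReal.add_lt_top.1 h).2)
    · simp only [if_neg hσ, add_zero] at h ⊢
      exact ⟨fun k => (sqNorm_mollify_le k hv).trans_lt h2, hlim⟩
  | succ m ih =>
    intro v hv h
    have h2 : sqNorm v < ⊤ := (sqNorm_le_sobolevNormSqAux (m + 1) σ v).trans_lt h
    have hex := exists_hasWeakPartial_of_sobolevNormSqAux_lt_top h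
    have hg : ∀ i, ∃ g : FullSpace n → ℝ, Measurable g ∧ HasWeakPartial i v g ∧
        sobolevNormSqAux m σ g < ⊤ := by
      intro i
      obtain ⟨g, hg⟩ := hex i
      obtain ⟨g', hg'm, hg'⟩ := exists_measurable_ae_eq
        (aestronglyMeasurable_halfVol_of_locallyIntegrableOn hg.2.1)
      have hw := hg.congr EventuallyEq.rfl hg'
      refine ⟨g', hg'm, hw, ?_⟩
      rw [← sobolevNormSqAux_congr m σ hw.weakPartial_ae_eq]
      rw [sobolevNormSqAux_succ_eq hex] at h
      exact ENNReal.sum_lt_top.1 (ENNReal.add_lt_top.1 h).2 i (Finset.mem_univ i)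
    choose g hgm hgw hgf using hg
    constructor
    · intro k
      have hw := fun i => hasWeakPartial_mollify k hv h2 (hgw i)
      rw [sobolevNormSqAux_succ_eq fun i => ⟨_, hw i⟩]
      refine ENNReal.add_lt_top.2 ⟨(sqNorm_mollify_le k hv).trans_lt h2,
        ENNReal.sum_lt_top.2 fun i _ => ?_⟩
      rw [sobolevNormSqAux_congr m σ (hw i).weakPartial_ae_eq]
      exact (ih (g i) (hgm i) (hgf i)).1 k
    · have e : ∀ k, sobolevNormSqAux (m + 1) σ (fun x => mollify k v x - v x) =
          sqNorm (fun x => mollify k v x - v x) +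
            ∑ i, sobolevNormSqAux m σ (fun x => mollify k (g i) x - g i x) := by
        intro k
        have hw := fun i => (hasWeakPartial_mollify k hv h2 (hgw i)).sub (hgw i)
        rw [sobolevNormSqAux_succ_eq fun i => ⟨_, hw i⟩]
        congr 1
        exact Finset.sum_congr rfl fun i _ => sobolevNormSqAux_congr m σ (hw i).weakPartial_ae_eq
      simp only [e]
      have := (tendsto_sqNorm_mollify_sub hv h2).add
        (tendsto_finsetSum Finset.univ fun i _ => (ih (g i) (hgm i) (hgf i)).2)
      simpa using this

/-! ### Embedding of integer and higher order spaces into fractional ones. -/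

theorem fderiv_apply_sq_le {n : ℕ} (φ : FullSpace n → ℝ) (z w : FullSpace n) :
    ‖fderiv ℝ φ z w‖ₑ ^ 2 ≤ normPow 1 w ^ 2 *
      ∑ i, ‖fderiv ℝ φ z (EuclideanSpace.single i 1)‖ₑ ^ 2 := by
  have e : fderiv ℝ φ z w = ∑ i, w i * fderiv ℝ φ z (EuclideanSpace.single i 1) := by
    have h1 : w = ∑ i, w i • EuclideanSpace.single i (1 : ℝ) := by
      have := (EuclideanSpace.basisFun (Fin (n + 1)) ℝ).sum_repr w
      simpa using this.symm
    nth_rewrite 1 [h1]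
    simp [map_sum]
  simp only [Real.enorm_eq_ofReal_abs, ← ENNReal.ofReal_pow (abs_nonneg _), sq_abs, normPow,
    Real.rpow_one, ← ENNReal.ofReal_pow (norm_nonneg _)]
  rw [← ENNReal.ofReal_sum_of_nonneg (fun i _ => sq_nonneg _), ← ENNReal.ofReal_mul (sq_nonneg _)]
  apply ENNReal.ofReal_le_ofReal
  rw [e, EuclideanSpace.norm_sq_eq]
  simp only [Real.norm_eq_abs, sq_abs]
  exact Finset.sum_mul_sq_le_sq_mul_sq _ _ _

theorem convex_upperHalf (n : ℕ) : Convex ℝ (upperHalf n) := by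
  intro x hx y hy a b ha hb hab
  have hx0 : 0 < x (Fin.last n) := hx
  have hy0 : 0 < y (Fin.last n) := hy
  show 0 < (a • x + b • y) (Fin.last n)
  simp only [PiLp.add_apply, PiLp.smul_apply, smul_eq_mul]
  rcases ha.eq_or_lt with h | h
  · have : b = 1 := by linarith
    rw [← h, this]
    linarith
  · nlinarith [mul_pos h hx0, mul_nonneg hb hy0.le]

/-- The square of the norm of the gradient of `φ` on `Ω`, extended by zero. -/
noncomputable def gradSq {n : ℕ} (φ : FullSpace n → ℝ) : FullSpace n → ℝ≥0∞ :=
  (upperHalf n).indicator fun z => ∑ i, ‖fderiv ℝ φ z (EuclideanSpace.single i 1)‖ₑ ^ 2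

theorem measurable_gradSq {n : ℕ} {φ : FullSpace n → ℝ} (hφ : ContDiff ℝ ∞ φ) :
    Measurable (gradSq φ) := by
  refine Measurable.indicator ?_ (measurableSet_upperHalf n)
  have : ∀ i : Fin (n + 1), Measurable fun z => fderiv ℝ φ z (EuclideanSpace.single i 1) :=
    fun i => ((hφ.continuous_fderiv (by simp)).clm_apply continuous_const).measurable
  fun_prop

theorem lintegral_gradSq {n : ℕ} {φ : FullSpace n → ℝ} (hφ : ContDiff ℝ ∞ φ) :
    ∫⁻ z, gradSq φ z = ∑ i, sqNorm (fun z => fderiv ℝ φ z (EuclideanSpace.single i 1)) := by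
  have : ∀ i : Fin (n + 1), Measurable fun z => fderiv ℝ φ z (EuclideanSpace.single i 1) :=
    fun i => ((hφ.continuous_fderiv (by simp)).clm_apply continuous_const).measurable
  unfold gradSq
  rw [lintegral_indicator (measurableSet_upperHalf n), lintegral_finsetSum _ (by fun_prop)]
  rfl

/-- The fundamental theorem of calculus along the segment from y to x, which stays in Ω by
convexity, followed by Jensen's inequality. -/
theorem enorm_sub_sq_le_gradSq {n : ℕ} {φ : FullSpace n → ℝ} (hφ : ContDiff ℝ ∞ φ)
    {x y : FullSpace n} (hx : x ∈ upperHalf n) (hy : y ∈ upperHalf n) :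
    ‖φ x - φ y‖ₑ ^ 2 ≤ normPow 1 (x - y) ^ 2 *
      ∫⁻ θ in Set.Ioc (0 : ℝ) 1, gradSq φ (y + θ • (x - y)) := by
  have hd : ∀ θ : ℝ, HasDerivAt (fun θ : ℝ => φ (y + θ • (x - y)))
      (fderiv ℝ φ (y + θ • (x - y)) (x - y)) θ := by
    intro θ
    have h1 : HasDerivAt (fun θ : ℝ => y + θ • (x - y)) (x - y) θ := by
      simpa using ((hasDerivAt_id θ).smul_const (x - y)).const_add y
    exact ((hφ.differentiable (by simp)) _).hasFDerivAt.comp_hasDerivAt θ h1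
  have hc : Continuous fun θ : ℝ => fderiv ℝ φ (y + θ • (x - y)) (x - y) :=
    ((hφ.continuous_fderiv (by simp)).comp (by fun_prop)).clm_apply continuous_const
  have hftc := intervalIntegral.integral_eq_sub_of_hasDerivAt (a := 0) (b := 1)
    (fun θ _ => hd θ) (hc.intervalIntegrable 0 1)
  simp only [one_smul, zero_smul, add_zero, add_sub_cancel] at hftc
  rw [← hftc, intervalIntegral.integral_of_le zero_le_one]
  have : IsProbabilityMeasure (volume.restrict (Set.Ioc (0 : ℝ) 1)) := ⟨by simp⟩
  refine (enorm_integral_sq_le _ hc.measurable.aemeasurable).trans ?_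
  rw [← lintegral_const_mul' _ _ (by simp [normPow])]
  refine setLIntegral_mono' measurableSet_Ioc fun θ hθ => ?_
  have hmem : y + θ • (x - y) ∈ upperHalf n :=
    (convex_upperHalf n).add_smul_sub_mem hy hx ⟨hθ.1.le, hθ.2⟩
  rw [gradSq, Set.indicator_of_mem hmem]
  exact fderiv_apply_sq_le φ _ _

/-- Near the diagonal the gradient gains |x − y|², and |z|^(2−N−2σ) is integrable at the origin
since σ < 1. Away from it the L² norm suffices. -/
theorem exists_gagliardoSq_le_of_contDiff (n : ℕ) {σ : ℝ} (hσ : 0 < σ) (hσ1 : σ < 1) :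
    ∃ C : ℝ≥0∞, C < ⊤ ∧ ∀ φ : FullSpace n → ℝ, ContDiff ℝ ∞ φ → gagliardoSq σ φ ≤
      C * (sqNorm φ + ∑ i, sqNorm (fun z => fderiv ℝ φ z (EuclideanSpace.single i 1))) := by
  obtain ⟨p, hp⟩ : ∃ p : ℝ, p = ((n + 1 : ℕ) : ℝ) + 2 * σ := ⟨_, rfl⟩
  let K : FullSpace n → ℝ≥0∞ := (Metric.ball 0 1).indicator (normPow (2 - p))
  have hK : Measurable K := (measurable_normPow _).indicator measurableSet_ball
  have hKi : ∫⁻ z, K z < ⊤ := by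
    rw [lintegral_indicator measurableSet_ball]
    exact lintegral_normPow_near (by rw [hp]; linarith) 1
  have hF := measurable_normPowFar (n := n) (-p)
  have hFi : ∫⁻ z : FullSpace n, normPowFar (-p) z < ⊤ :=
    lintegral_normPowFar_lt_top (by rw [hp]; linarith)
  set A := ∫⁻ z, K z
  set B := ∫⁻ z : FullSpace n, normPowFar (-p) z
  refine ⟨A + 4 * B, ENNReal.add_lt_top.2 ⟨hKi, ENNReal.mul_lt_top (by simp) hFi⟩,
    fun φ hφ => ?_⟩
  have hH := measurable_gradSq hφ
  have hφm : Measurable φ := hφ.continuous.measurable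
  let ν : Measure ℝ := volume.restrict (Set.Ioc (0 : ℝ) 1)
  have hν : IsProbabilityMeasure ν := ⟨by simp [ν]⟩
  -- The mean of |∇φ|² over the segment from y to y + z. As the gradient is extended by zero to the
  -- whole space, the integral in y does not depend on z, by translation invariance.
  let J : FullSpace n → FullSpace n → ℝ≥0∞ := fun z y => ∫⁻ θ, gradSq φ (y + θ • z) ∂ν
  have hJ : Measurable fun q : FullSpace n × FullSpace n => J q.1 q.2 := by
    refine Measurable.lintegral_prod_right' (ν := ν)
      (f := fun r : (FullSpace n × FullSpace n) × ℝ => gradSq φ (r.1.2 + r.2 • r.1.1)) ?_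
    fun_prop
  have hJ' : Measurable (Function.uncurry J) := hJ
  have hnear : ∫⁻ x : FullSpace n, ∫⁻ y, K (x - y) * J (x - y) y = A * ∫⁻ z, gradSq φ z := by
    rw [lintegral_lintegral_swap]
    · calc ∫⁻ y, ∫⁻ x, K (x - y) * J (x - y) y = ∫⁻ y, ∫⁻ z, K z * J z y :=
            lintegral_congr fun y => lintegral_sub_right_eq_self (fun z => K z * J z y) y
        _ = ∫⁻ z, ∫⁻ y, K z * J z y := by
            rw [lintegral_lintegral_swap]
            fun_prop
        _ = ∫⁻ z, K z * ∫⁻ y, gradSq φ y := by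
            refine lintegral_congr fun z => ?_
            rw [lintegral_const_mul _ (by fun_prop)]
            congr 1
            simp only [J]
            rw [lintegral_lintegral_swap (by fun_prop)]
            simp [lintegral_add_right_eq_self (fun y => gradSq φ y)]
        _ = _ := lintegral_mul_const _ hK
    · fun_prop
  calc gagliardoSq σ φ ≤ ∫⁻ x, ∫⁻ y, (K (x - y) * J (x - y) y +
        ‖φ x - φ y‖ₑ ^ 2 * normPowFar (-p) (x - y)) ∂(halfVol n) ∂(halfVol n) := by
        rw [gagliardoSq_eq, ← hp]
        refine lintegral_mono_ae ?_
        filter_upwards [ae_halfVol_mem n] with x hx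
        refine lintegral_mono_ae ?_
        filter_upwards [ae_halfVol_mem n] with y hy
        by_cases hb : x - y ∈ Metric.ball (0 : FullSpace n) 1
        · refine le_add_right ?_
          rcases eq_or_ne x y with rfl | hxy
          · simp
          have hne := sub_ne_zero.2 hxy
          simp only [K, Set.indicator_of_mem hb]
          refine (mul_le_mul' (enorm_sub_sq_le_gradSq hφ hx hy) le_rfl).trans (le_of_eq ?_)
          rw [normPow_sq, mul_right_comm, normPow_mul hne]
          ring_nf
          rfl
        · refine le_add_left ?_
          rw [normPowFar, Set.indicator_of_mem (by exact hb)]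
    _ = (∫⁻ x, ∫⁻ y, K (x - y) * J (x - y) y ∂(halfVol n) ∂(halfVol n)) +
          ∫⁻ x, ∫⁻ y, ‖φ x - φ y‖ₑ ^ 2 * normPowFar (-p) (x - y) ∂(halfVol n) ∂(halfVol n) := by
        rw [← lintegral_add_left (by fun_prop)]
        refine lintegral_congr fun x => ?_
        rw [lintegral_add_left (by fun_prop)]
    _ ≤ A * (∫⁻ z, gradSq φ z) + 4 * B * sqNorm φ := by
        refine add_le_add ?_ (lintegral_sq_sub_mul_le hφm hF)
        rw [← hnear]
        exact lintegral_mono' (halfVol_le n) fun x => lintegral_mono' (halfVol_le n) le_rfl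
    _ ≤ _ := by
        rw [lintegral_gradSq hφ, add_mul, mul_add, mul_add]
        exact add_le_add le_add_self le_self_add

/-- The smooth bound holds uniformly for the mollifications; Fatou's lemma along an almost
everywhere convergent subsequence transfers it to v. -/
theorem exists_gagliardoSq_le_of_hasWeakPartial (n : ℕ) {σ : ℝ} (hσ : 0 < σ) (hσ1 : σ < 1) :
    ∃ C : ℝ≥0∞, C < ⊤ ∧ ∀ (v : FullSpace n → ℝ) (g : Fin (n + 1) → FullSpace n → ℝ),
      Measurable v → sqNorm v < ⊤ → (∀ i, Measurable (g i)) → (∀ i, HasWeakPartial i v (g i)) →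
      gagliardoSq σ v ≤ C * (sqNorm v + ∑ i, sqNorm (g i)) := by
  obtain ⟨C, hC, h⟩ := exists_gagliardoSq_le_of_contDiff n hσ hσ1
  refine ⟨C, hC, fun v g hv hv2 hg hw => ?_⟩
  have hM : ∀ k, gagliardoSq σ (mollify k v) ≤ C * (sqNorm v + ∑ i, sqNorm (g i)) := by
    intro k
    refine (h _ (contDiff_mollify k hv hv2)).trans (mul_le_mul' le_rfl
      (add_le_add (sqNorm_mollify_le k hv) (Finset.sum_le_sum fun i _ => ?_)))
    refine (le_of_eq (sqNorm_congr ?_)).trans (sqNorm_mollify_le k (hg i))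
    filter_upwards [ae_halfVol_mem n] with x hx
    exact fderiv_mollify k hv hv2 (hw i) hx
  have hmeas : ∀ k, Measurable (mollify k v) := fun k =>
    (contDiff_mollify k hv hv2).continuous.measurable
  have hconv : TendstoInMeasure (halfVol n) (fun k => mollify k v) atTop v := by
    refine tendstoInMeasure_of_tendsto_eLpNorm (p := 2) (by simp)
      (fun k => (hmeas k).aestronglyMeasurable) hv.aestronglyMeasurable ?_
    have h1 := tendsto_sqNorm_mollify_sub hv hv2
    have h2 := (ENNReal.continuous_rpow_const (y := (1 / 2 : ℝ))).tendsto 0 |>.comp h1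
    rw [ENNReal.zero_rpow_of_pos (by norm_num)] at h2
    refine h2.congr fun k => ?_
    rw [eLpNorm_two_eq]
    rfl
  obtain ⟨ns, -, hae⟩ := hconv.exists_seq_tendsto_ae
  have hnp := measurable_normPow (n := n) (-(((n + 1 : ℕ) : ℝ) + 2 * σ))
  have hmF : ∀ j, Measurable (Function.uncurry fun x y : FullSpace n =>
      ‖mollify (ns j) v x - mollify (ns j) v y‖ₑ ^ 2 *
        normPow (-(((n + 1 : ℕ) : ℝ) + 2 * σ)) (x - y)) := by
    intro j
    have := hmeas (ns j)
    unfold Function.uncurry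
    fun_prop
  calc gagliardoSq σ v ≤ ∫⁻ x, ∫⁻ y, liminf (fun j => ‖mollify (ns j) v x - mollify (ns j) v y‖ₑ ^ 2 *
        normPow (-(((n + 1 : ℕ) : ℝ) + 2 * σ)) (x - y)) atTop ∂(halfVol n) ∂(halfVol n) := by
        rw [gagliardoSq_eq]
        refine lintegral_mono_ae ?_
        filter_upwards [hae] with x hx
        refine lintegral_mono_ae ?_
        filter_upwards [hae] with y hy
        have h1 : Tendsto (fun j => ‖mollify (ns j) v x - mollify (ns j) v y‖ₑ ^ 2 *
            normPow (-(((n + 1 : ℕ) : ℝ) + 2 * σ)) (x - y)) atTop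
            (𝓝 (‖v x - v y‖ₑ ^ 2 * normPow (-(((n + 1 : ℕ) : ℝ) + 2 * σ)) (x - y))) :=
          ENNReal.Tendsto.mul_const (ENNReal.Tendsto.pow (hx.sub hy).enorm)
            (Or.inr ENNReal.ofReal_ne_top)
        exact h1.liminf_eq.ge
    _ ≤ ∫⁻ x, liminf (fun j => ∫⁻ y, ‖mollify (ns j) v x - mollify (ns j) v y‖ₑ ^ 2 *
        normPow (-(((n + 1 : ℕ) : ℝ) + 2 * σ)) (x - y) ∂(halfVol n)) atTop ∂(halfVol n) :=
        lintegral_mono fun x => lintegral_liminf_le fun j => (hmF j).of_uncurry_left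
    _ ≤ liminf (fun j => ∫⁻ x, ∫⁻ y, ‖mollify (ns j) v x - mollify (ns j) v y‖ₑ ^ 2 *
        normPow (-(((n + 1 : ℕ) : ℝ) + 2 * σ)) (x - y) ∂(halfVol n) ∂(halfVol n)) atTop :=
        lintegral_liminf_le fun j => (hmF j).lintegral_prod_right
    _ ≤ _ := by
        refine liminf_le_of_frequently_le' (Eventually.frequently (Eventually.of_forall fun j => ?_))
        rw [← gagliardoSq_eq]
        exact hM _

/-- Since σ < 1, only the first derivatives matter as soon as m ≥ 1; for m = 0 it is monotonicity in
the exponent. -/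
theorem exists_sqNorm_add_gagliardoSq_le (n m : ℕ) {σ σ₀ : ℝ} (hσ : 0 < σ) (hσ1 : σ < 1)
    (h : σ ≤ m + σ₀) : ∃ C : ℝ≥0∞, C < ⊤ ∧ ∀ v : FullSpace n → ℝ, Measurable v →
      sobolevNormSqAux m σ₀ v < ⊤ →
      sqNorm v + gagliardoSq σ v ≤ C * sobolevNormSqAux m σ₀ v := by
  cases m with
  | zero =>
    have hσ₀ : σ ≤ σ₀ := by simpa using h
    obtain ⟨C, hC, hmono⟩ := gagliardoSq_mono_exponent (n := n) hσ hσ₀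
    refine ⟨1 + C, ENNReal.add_lt_top.2 ⟨by simp, hC⟩, fun v hv _ => ?_⟩
    simp only [sobolevNormSqAux, if_pos (hσ.trans_le hσ₀), eLpNorm_two_sq]
    change sqNorm v + gagliardoSq σ v ≤ (1 + C) * (sqNorm v + gagliardoSq σ₀ v)
    calc _ ≤ sqNorm v + (gagliardoSq σ₀ v + C * sqNorm v) := add_le_add le_rfl (hmono v hv)
      _ = (sqNorm v + gagliardoSq σ₀ v) + C * sqNorm v := by ring
      _ ≤ (sqNorm v + gagliardoSq σ₀ v) + C * (sqNorm v + gagliardoSq σ₀ v) :=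
          add_le_add le_rfl (mul_le_mul' le_rfl le_self_add)
      _ = _ := by ring
  | succ m =>
    obtain ⟨C, hC, hH⟩ := exists_gagliardoSq_le_of_hasWeakPartial n hσ hσ1
    refine ⟨1 + C, ENNReal.add_lt_top.2 ⟨by simp, hC⟩, fun v hv hfin => ?_⟩
    have hex := exists_hasWeakPartial_of_sobolevNormSqAux_lt_top hfin
    have hv2 : sqNorm v < ⊤ := (sqNorm_le_sobolevNormSqAux _ _ v).trans_lt hfin
    have hg : ∀ i, ∃ g : FullSpace n → ℝ, Measurable g ∧ weakPartial i v =ᵐ[halfVol n] g := by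
      intro i
      obtain ⟨g, hg⟩ := hex i
      exact exists_measurable_ae_eq
        (aestronglyMeasurable_halfVol_of_locallyIntegrableOn hg.weakPartial_spec.2.1)
    choose g hgm hga using hg
    have hgw : ∀ i, HasWeakPartial i v (g i) := fun i =>
      (hex i).choose_spec.weakPartial_spec.congr EventuallyEq.rfl (hga i)
    have hsum : sqNorm v + ∑ i, sqNorm (g i) ≤ sobolevNormSqAux (m + 1) σ₀ v := by
      rw [sobolevNormSqAux_succ_eq hex]
      refine add_le_add le_rfl (Finset.sum_le_sum fun i _ => ?_)
      rw [← sqNorm_congr (hga i)]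
      exact sqNorm_le_sobolevNormSqAux _ _ _
    rw [add_mul, one_mul]
    exact add_le_add (sqNorm_le_sobolevNormSqAux _ _ v)
      ((hH v g hv hv2 hgm hgw).trans (mul_le_mul' le_rfl hsum))

/-! ### Sobolev spaces of real order and the trace. -/

theorem memH_iff {n : ℕ} {r : ℝ} {u : FullSpace n → ℝ} : MemH r u ↔
    AEStronglyMeasurable u (halfVol n) ∧ sobolevNormSqAux ⌊r⌋₊ (Int.fract r) u < ⊤ := by
  rw [MemH, sobolevNorm, ENNReal.rpow_lt_top_iff_of_pos (by norm_num)]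

theorem natFloor_add_fract {r : ℝ} (hr : 0 ≤ r) : (⌊r⌋₊ : ℝ) + Int.fract r = r := by
  rw [natCast_floor_eq_intCast_floor hr, Int.floor_add_fract]

theorem sobolevNorm_congr {n : ℕ} (r : ℝ) {u v : FullSpace n → ℝ} (h : u =ᵐ[halfVol n] v) :
    sobolevNorm r u = sobolevNorm r v := by
  rw [sobolevNorm, sobolevNorm, sobolevNormSqAux_congr _ _ h]

theorem MemH.congr {n : ℕ} {r : ℝ} {u v : FullSpace n → ℝ} (hu : MemH r u)
    (h : u =ᵐ[halfVol n] v) : MemH r v :=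
  ⟨hu.1.congr h, sobolevNorm_congr r h ▸ hu.2⟩

theorem sobolevNorm_sq {n : ℕ} (r : ℝ) (u : FullSpace n → ℝ) :
    sobolevNorm r u ^ 2 = sobolevNormSqAux ⌊r⌋₊ (Int.fract r) u := by
  rw [sobolevNorm, ← ENNReal.rpow_natCast, ← ENNReal.rpow_mul]
  norm_num

theorem exists_sqNorm_add_gagliardoSq_le_sobolevNorm (n : ℕ) {σ r : ℝ} (hσ : 0 < σ)
    (hσ1 : σ < 1) (h : σ ≤ r) : ∃ C : ℝ≥0∞, C < ⊤ ∧ ∀ v : FullSpace n → ℝ, Measurable v →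
      MemH r v → sqNorm v + gagliardoSq σ v ≤ C * sobolevNorm r v ^ 2 := by
  obtain ⟨C, hC, hE⟩ := exists_sqNorm_add_gagliardoSq_le n ⌊r⌋₊ (σ₀ := Int.fract r) hσ hσ1
    (by rwa [natFloor_add_fract (hσ.le.trans h)])
  refine ⟨C, hC, fun v hv hm => ?_⟩
  rw [sobolevNorm_sq]
  exact hE v hv (memH_iff.1 hm).2

theorem rpow_half_mul_sq (C a : ℝ≥0∞) : (C * a ^ 2) ^ (1 / 2 : ℝ) = C ^ (1 / 2 : ℝ) * a := by
  rw [ENNReal.mul_rpow_of_nonneg _ _ (by norm_num), ← ENNReal.rpow_natCast a,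
    ← ENNReal.rpow_mul]
  norm_num

theorem MemH.sqNorm_lt_top {n : ℕ} {r : ℝ} {u : FullSpace n → ℝ} (hu : MemH r u) :
    sqNorm u < ⊤ := (sqNorm_le_sobolevNormSqAux _ _ u).trans_lt (memH_iff.1 hu).2

theorem memH_mollify {n : ℕ} {r : ℝ} (k : ℕ) {v : FullSpace n → ℝ} (hv : Measurable v)
    (h : MemH r v) : MemH r (mollify k v) :=
  memH_iff.2 ⟨(contDiff_mollify k hv h.sqNorm_lt_top).continuous.aestronglyMeasurable,
    (sobolevNormSqAux_mollify _ _ v hv (memH_iff.1 h).2).1 k⟩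

theorem tendsto_sobolevNorm_mollify_sub {n : ℕ} {r : ℝ} {v : FullSpace n → ℝ}
    (hv : Measurable v) (h : MemH r v) :
    Tendsto (fun k => sobolevNorm r (fun x => mollify k v x - v x)) atTop (𝓝 0) := by
  have h1 := (sobolevNormSqAux_mollify _ _ v hv (memH_iff.1 h).2).2
  have h2 := ((ENNReal.continuous_rpow_const (y := (1 / 2 : ℝ))).tendsto 0).comp h1
  rw [ENNReal.zero_rpow_of_pos (by norm_num)] at h2
  exact h2

/-- The trace of `v` is the limit of its dyadic averages. -/
theorem exists_trace (n : ℕ) {τ r : ℝ} (hτ : 1 / 2 < τ) (hτ1 : τ < 1) (hr : τ ≤ r) :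
    ∃ C : ℝ≥0∞, C < ⊤ ∧ ∀ v : FullSpace n → ℝ, Measurable v → MemH r v →
      ∃ g : Lp ℝ 2 (volume : Measure (EuclideanSpace ℝ (Fin n))),
        (∀ k : ℕ, eLpNorm (fun x' => dyadicAvg k v x' - g x') 2 volume ≤
          C * ENNReal.ofReal (dyadicRatio τ ^ k) * gagliardoSq τ v ^ (1 / 2 : ℝ)) ∧
        ∀ g', HasTrace r v g' ↔ g' = g := by
  obtain ⟨C₁, hC₁, h₁⟩ := exists_lim_dyadicAvg n hτ
  obtain ⟨C₂, hC₂, h₂⟩ := exists_eLpNorm_restrict_sub_lim_le n hτ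
  obtain ⟨C₃, hC₃, h₃⟩ := exists_sqNorm_add_gagliardoSq_le_sobolevNorm n (by linarith) hτ1 hr
  refine ⟨C₁, hC₁, fun v hv hm => ?_⟩
  have hv2 := hm.sqNorm_lt_top
  have hfin : ∀ u : FullSpace n → ℝ, Measurable u → MemH r u → gagliardoSq τ u < ⊤ := by
    intro u hu hum
    exact le_add_self.trans_lt ((h₃ u hu hum).trans_lt
      (ENNReal.mul_lt_top hC₃ (ENNReal.pow_lt_top hum.2)))
  have hg := hfin v hv hm
  obtain ⟨g, hgk⟩ := h₁ v hv hv2 hg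
  refine ⟨g, hgk, ?_⟩
  have hlim : Tendsto (fun k => eLpNorm (fun x' => dyadicAvg k v x' - g x') 2 volume) atTop
      (𝓝 0) :=
    tendsto_of_tendsto_of_tendsto_of_le_of_le tendsto_const_nhds
      (tendsto_const_mul_ofReal_dyadicRatio_pow hτ hC₁ (gag_rpow_lt_top hg))
      (fun k => zero_le) hgk
  -- Every admissible approximating sequence has boundary values tending to g. This gives uniqueness
  -- of the trace and, applied to mollifications, its existence.
  have key : ∀ φ : ℕ → FullSpace n → ℝ, (∀ k, ContDiff ℝ ∞ (φ k) ∧ MemH r (φ k)) →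
      Tendsto (fun k => sobolevNorm r (fun x => φ k x - v x)) atTop (𝓝 0) →
      Tendsto (fun k => eLpNorm (fun x' => φ k (bdryPoint x') - g x') 2 volume) atTop (𝓝 0) := by
    intro φ hφ hφv
    have hb := ENNReal.Tendsto.const_mul (a := C₂ * C₃ ^ (1 / 2 : ℝ)) hφv
      (Or.inr (ENNReal.mul_lt_top hC₂ (ENNReal.rpow_lt_top_of_nonneg (by norm_num) hC₃.ne)).ne)
    rw [mul_zero] at hb
    refine tendsto_of_tendsto_of_tendsto_of_le_of_le' tendsto_const_nhds hb
      (Eventually.of_forall fun k => zero_le) ?_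
    -- The embedding estimate needs φ k − v in H^r; its norm tends to zero, so it is finite for
    -- large k.
    filter_upwards [hφv.eventually (gt_mem_nhds ENNReal.zero_lt_top)] with k hk
    have hc := (hφ k).1.continuous
    have hd : Measurable fun x => φ k x - v x := hc.measurable.sub hv
    refine (h₂ (φ k) v hc hv (hφ k).2.sqNorm_lt_top hv2 (hfin _ hc.measurable (hφ k).2) g
      hlim).trans ?_
    rw [mul_assoc, ← rpow_half_mul_sq]
    exact mul_le_mul' le_rfl (ENNReal.rpow_le_rpow
      (h₃ _ hd ⟨hd.aestronglyMeasurable, hk⟩) (by norm_num))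
  intro g'
  constructor
  · rintro ⟨φ, hφ, hφv, hφg⟩
    have h1 := hφg.add (key φ hφ hφv)
    rw [add_zero] at h1
    have h2 : eLpNorm (fun x' => g' x' - g x') 2 volume ≤ 0 := by
      refine ge_of_tendsto h1 (Eventually.of_forall fun k => ?_)
      have hφb : AEStronglyMeasurable (fun x' : EuclideanSpace ℝ (Fin n) => φ k (bdryPoint x'))
        volume := ((hφ k).1.continuous.comp (continuous_bdryPoint n)).aestronglyMeasurable
      have e : (fun x' => g' x' - g x') = (fun x' => φ k (bdryPoint x') - g x') -
          fun x' => φ k (bdryPoint x') - g' x' := by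
        ext x'
        simp
      rw [e, add_comm]
      exact eLpNorm_sub_le (hφb.sub (Lp.aestronglyMeasurable g))
        (hφb.sub (Lp.aestronglyMeasurable g')) one_le_two
    have h3 : edist g' g = 0 := by
      rw [Lp.edist_def]
      exact le_antisymm h2 zero_le
    exact edist_eq_zero.1 h3
  · rintro rfl
    refine ⟨fun k => mollify k v, fun k => ⟨contDiff_mollify k hv hv2, memH_mollify k hv hm⟩,
      tendsto_sobolevNorm_mollify_sub hv hm, ?_⟩
    exact key _ (fun k => ⟨contDiff_mollify k hv hv2, memH_mollify k hv hm⟩)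
      (tendsto_sobolevNorm_mollify_sub hv hm)

theorem hasTrace_congr {n : ℕ} {r : ℝ} {u v : FullSpace n → ℝ} (h : u =ᵐ[halfVol n] v)
    (g : Lp ℝ 2 (volume : Measure (EuclideanSpace ℝ (Fin n)))) :
    HasTrace r u g ↔ HasTrace r v g := by
  have e : ∀ φ : FullSpace n → ℝ, sobolevNorm r (fun x => φ x - u x) =
      sobolevNorm r (fun x => φ x - v x) := fun φ =>
    sobolevNorm_congr r (h.mono fun x hx => by simp only [hx])
  simp only [HasTrace, e]

theorem MemH.weakPartial {n : ℕ} {r : ℝ} (hr : 1 ≤ r) {ψ : FullSpace n → ℝ} (h : MemH r ψ)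
    (i : Fin (n + 1)) : MemH (r - 1) (weakPartial i ψ) ∧
      sobolevNorm (r - 1) (_root_.weakPartial i ψ) ^ 2 ≤ sobolevNorm r ψ ^ 2 := by
  obtain ⟨m, hm⟩ : ∃ m, ⌊r⌋₊ = m + 1 :=
    Nat.exists_eq_succ_of_ne_zero (Nat.floor_pos.2 hr).ne'
  have hm' : ⌊r - 1⌋₊ = m := by rw [Nat.floor_sub_one, hm]; rfl
  have hf : Int.fract (r - 1) = Int.fract r := Int.fract_sub_one r
  have h2 := (memH_iff.1 h).2
  rw [hm] at h2
  have hex := exists_hasWeakPartial_of_sobolevNormSqAux_lt_top h2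
  have hle : sobolevNormSqAux m (Int.fract r) (_root_.weakPartial i ψ) ≤
      sobolevNormSqAux (m + 1) (Int.fract r) ψ := by
    rw [sobolevNormSqAux_succ_eq hex]
    exact le_add_left (Finset.single_le_sum
      (f := fun i => sobolevNormSqAux m (Int.fract r) (_root_.weakPartial i ψ))
      (fun _ _ => zero_le) (Finset.mem_univ i))
  constructor
  · refine memH_iff.2 ⟨aestronglyMeasurable_halfVol_of_locallyIntegrableOn
      (hex i).choose_spec.weakPartial_spec.2.1, ?_⟩
    rw [hm', hf]
    exact hle.trans_lt h2
  · rw [sobolevNorm_sq, sobolevNorm_sq, hm', hf, hm]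
    exact hle

theorem exists_measurable_gradient (n : ℕ) {τ r : ℝ} (hτ : 0 < τ) (hτ1 : τ < 1) (hr : τ ≤ r - 1) :
    ∃ C : ℝ≥0∞, C < ⊤ ∧ ∀ ψ : FullSpace n → ℝ, MemH r ψ →
      ∃ f : Fin (n + 1) → FullSpace n → ℝ, (∀ i, Measurable (f i)) ∧
        (∀ i, weakPartial i ψ =ᵐ[halfVol n] f i) ∧ (∀ i, MemH (r - 1) (f i)) ∧
        (∀ i, sqNorm (f i) + gagliardoSq τ (f i) ≤ C * sobolevNorm r ψ ^ 2) := by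
  obtain ⟨C, hC, hE⟩ := exists_sqNorm_add_gagliardoSq_le_sobolevNorm n hτ hτ1 hr
  refine ⟨C, hC, fun ψ hψ => ?_⟩
  have hw := fun i => hψ.weakPartial (by linarith) i
  choose f hfm hfe using fun i => exists_measurable_ae_eq (hw i).1.1
  have hfH := fun i => (hw i).1.congr (hfe i)
  refine ⟨f, hfm, hfe, hfH, fun i => (hE _ (hfm i) (hfH i)).trans (mul_le_mul' le_rfl ?_)⟩
  rw [← sobolevNorm_congr _ (hfe i)]
  exact (hw i).2

/-! ### The weighted normal derivative and the two regimes of s. -/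

theorem enorm_rpow_mul_sq {s a t : ℝ} (ht : 0 < t) : ‖t ^ (1 - 2 * s) * a‖ₑ ^ 2 =
    ENNReal.ofReal (t ^ (-(2 * (2 * s - 1)))) * ‖a‖ₑ ^ 2 := by
  rw [enorm_mul, mul_pow, Real.enorm_eq_ofReal (by positivity),
    ← ENNReal.ofReal_pow (by positivity), ← Real.rpow_natCast, ← Real.rpow_mul ht.le]
  push_cast
  ring_nf

theorem lintegral_weighted_sq {n : ℕ} (s : ℝ) (v : FullSpace n → ℝ) :
    ∫⁻ x, ‖x (Fin.last n) ^ (1 - 2 * s) * v x‖ₑ ^ 2 ∂(halfVol n) =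
      ∫⁻ x, ENNReal.ofReal (x (Fin.last n) ^ (-(2 * (2 * s - 1)))) * ‖v x‖ₑ ^ 2 ∂(halfVol n) := by
  refine lintegral_congr_ae ?_
  filter_upwards [ae_halfVol_mem n] with x hx
  exact enorm_rpow_mul_sq hx

theorem measurable_weighted {n : ℕ} (s : ℝ) {v : FullSpace n → ℝ} (hv : Measurable v) :
    Measurable fun x : FullSpace n => x (Fin.last n) ^ (1 - 2 * s) * v x := by
  have := measurable_last n
  fun_prop

theorem opConst_pos {γ ν₀ s : ℝ} (hs : 1 / 2 < s) (hγ : 0 < γ) (hν₀ : 0 < ν₀) :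
    0 < γ * ν₀ ^ (1 - 2 * s) * Real.Gamma (2 * s) := by
  have := Real.Gamma_pos_of_pos (by linarith : 0 < 2 * s)
  positivity

/-- The operator is the sum of an operator bounded on `H^(2s+β)` and a multiple of the weighted
normal derivative. -/
theorem exists_opL_estimate (n : ℕ) {s τ r γ ν₀ : ℝ} (hs : 1 / 2 < s) (hτ : 2 * s - 1 < τ)
    (hτ1 : τ < 1) (hr : τ ≤ r - 1) (hγ : 0 < γ) (hν₀ : 0 < ν₀) :
    ∃ C : ℝ≥0∞, C < ⊤ ∧ ∀ ψ : FullSpace n → ℝ, MemH r ψ →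
      ∃ v : FullSpace n → ℝ, Measurable v ∧ weakPartial (Fin.last n) ψ =ᵐ[halfVol n] v ∧
        MemH (r - 1) v ∧ sqNorm v + gagliardoSq τ v ≤ C * sobolevNorm r ψ ^ 2 ∧
        (∀ᵐ x ∂(halfVol n), PVExists s ψ x) ∧
        (MemLp (opL γ ν₀ s ψ) 2 (halfVol n) ↔ ∫⁻ x, ENNReal.ofReal (x (Fin.last n) ^
          (-(2 * (2 * s - 1)))) * ‖v x‖ₑ ^ 2 ∂(halfVol n) < ⊤) ∧
        eLpNorm (opL γ ν₀ s ψ) 2 (halfVol n) ≤ C * (sobolevNorm r ψ +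
          (∫⁻ x, ENNReal.ofReal (x (Fin.last n) ^ (-(2 * (2 * s - 1)))) * ‖v x‖ₑ ^ 2
            ∂(halfVol n)) ^ (1 / 2 : ℝ)) := by
  obtain ⟨C₁, hC₁, h₁⟩ := exists_measurable_gradient n (by linarith : 0 < τ) hτ1 hr
  obtain ⟨C₂, hC₂, h₂⟩ := lintegral_sq_regularPart_le (n := n) hs hτ
  obtain ⟨c, hc⟩ : ∃ c, c = γ * ν₀ ^ (1 - 2 * s) * Real.Gamma (2 * s) := ⟨_, rfl⟩
  have hc0 : 0 < c := hc ▸ opConst_pos hs hγ hν₀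
  obtain ⟨κ, hκ⟩ : ∃ κ, κ = bdryConst n s := ⟨_, rfl⟩
  have hκ0 : 0 < κ := hκ ▸ bdryConst_pos hs
  set D : ℝ≥0∞ := ‖c‖ₑ * ((C₂ * ((n + 1 : ℕ) * C₁)) ^ (1 / 2 : ℝ) + ‖κ‖ₑ)
  have hD : D < ⊤ := ENNReal.mul_lt_top (by simp) (ENNReal.add_lt_top.2
    ⟨ENNReal.rpow_lt_top_of_nonneg (by norm_num) (ENNReal.mul_lt_top hC₂
      (ENNReal.mul_lt_top (by simp) hC₁)).ne, by simp⟩)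
  refine ⟨C₁ + D, ENNReal.add_lt_top.2 ⟨hC₁, hD⟩, fun ψ hψ => ?_⟩
  obtain ⟨f, hfm, hfe, hfH, hfE⟩ := h₁ ψ hψ
  have hfin : ∀ i, sqNorm (f i) + gagliardoSq τ (f i) < ⊤ := fun i => (hfE i).trans_lt
    (ENNReal.mul_lt_top hC₁ (ENNReal.pow_lt_top hψ.2))
  obtain ⟨hPV, hop⟩ := ae_PVExists_and_opL_eq hs hτ γ ν₀ hfe hfm
    (fun i => (ENNReal.add_lt_top.1 (hfin i)).1) (fun i => (ENNReal.add_lt_top.1 (hfin i)).2)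
  rw [← hc, ← hκ] at hop
  have hR : ∫⁻ x, ‖regularPart s f x‖ₑ ^ 2 ∂(halfVol n) ≤
      C₂ * ((n + 1 : ℕ) * C₁) * sobolevNorm r ψ ^ 2 := by
    refine (h₂ f hfm).trans ?_
    rw [mul_assoc]
    refine mul_le_mul' le_rfl ((Finset.sum_le_sum fun i _ => hfE i).trans (le_of_eq ?_))
    simp [mul_assoc]
  have hRm := (stronglyMeasurable_regularPart s hfm).aestronglyMeasurable (μ := halfVol n)
  have hRL : MemLp (regularPart s f) 2 (halfVol n) := (memLp_two_iff hRm).2 (hR.trans_lt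
    (ENNReal.mul_lt_top (ENNReal.mul_lt_top hC₂ (ENNReal.mul_lt_top (by simp) hC₁))
      (ENNReal.pow_lt_top hψ.2)))
  set v := f (Fin.last n)
  set w : FullSpace n → ℝ := fun x => x (Fin.last n) ^ (1 - 2 * s) * v x
  have hw : Measurable w := measurable_weighted s (hfm _)
  have hop' : opL γ ν₀ s ψ =ᵐ[halfVol n] c • (regularPart s f + κ • w) := by
    filter_upwards [hop] with x hx
    rw [hx]
    simp only [Pi.smul_apply, Pi.add_apply, smul_eq_mul, w]
    ring
  refine ⟨v, hfm _, hfe _, hfH _, (hfE _).trans (mul_le_mul' le_self_add le_rfl), hPV, ?_, ?_⟩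
  · rw [memLp_congr_ae hop', ← lintegral_weighted_sq, ← memLp_two_iff hw.aestronglyMeasurable]
    constructor
    · intro h
      -- As c and κ are nonzero, the weighted normal derivative is recovered by subtracting the
      -- square integrable regular part.
      have h1 := ((h.const_smul c⁻¹).sub hRL).const_smul κ⁻¹
      refine (memLp_congr_ae (Eventually.of_forall fun x => ?_)).1 h1
      simp only [Pi.smul_apply, Pi.sub_apply, Pi.add_apply, smul_eq_mul]
      rw [inv_mul_cancel_left₀ hc0.ne', add_sub_cancel_left, inv_mul_cancel_left₀ hκ0.ne']
    · intro h
      exact (hRL.add (h.const_smul κ)).const_smul c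
  · rw [eLpNorm_congr_ae hop', ← lintegral_weighted_sq, eLpNorm_const_smul]
    have h1 : eLpNorm (regularPart s f) 2 (halfVol n) ≤
        (C₂ * ((n + 1 : ℕ) * C₁)) ^ (1 / 2 : ℝ) * sobolevNorm r ψ := by
      rw [eLpNorm_two_eq, ← rpow_half_mul_sq]
      exact ENNReal.rpow_le_rpow hR (by norm_num)
    calc ‖c‖ₑ * eLpNorm (regularPart s f + κ • w) 2 (halfVol n)
        ≤ ‖c‖ₑ * ((C₂ * ((n + 1 : ℕ) * C₁)) ^ (1 / 2 : ℝ) * sobolevNorm r ψ +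
          ‖κ‖ₑ * eLpNorm w 2 (halfVol n)) := by
          refine mul_le_mul' le_rfl ((eLpNorm_add_le hRm
            (hw.aestronglyMeasurable.const_smul κ) one_le_two).trans ?_)
          rw [eLpNorm_const_smul]
          exact add_le_add h1 le_rfl
      _ ≤ D * (sobolevNorm r ψ + eLpNorm w 2 (halfVol n)) := by
          simp only [D]
          rw [mul_assoc]
          refine mul_le_mul' le_rfl ?_
          rw [mul_add]
          exact add_le_add (mul_le_mul' le_self_add le_rfl) (mul_le_mul' le_add_self le_rfl)
      _ ≤ _ := by
          rw [← eLpNorm_two_eq]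
          exact mul_le_mul' le_add_self le_rfl

theorem opL_bound_of_hardy {n : ℕ} {s r γ ν₀ : ℝ} {ψ v : FullSpace n → ℝ} {C K : ℝ≥0∞}
    (h : eLpNorm (opL γ ν₀ s ψ) 2 (halfVol n) ≤ C * (sobolevNorm r ψ +
      (∫⁻ x, ENNReal.ofReal (x (Fin.last n) ^ (-(2 * (2 * s - 1)))) * ‖v x‖ₑ ^ 2
        ∂(halfVol n)) ^ (1 / 2 : ℝ)))
    (hK : ∫⁻ x, ENNReal.ofReal (x (Fin.last n) ^ (-(2 * (2 * s - 1)))) * ‖v x‖ₑ ^ 2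
        ∂(halfVol n) ≤ K * sobolevNorm r ψ ^ 2) :
    eLpNorm (opL γ ν₀ s ψ) 2 (halfVol n) ≤ C * (1 + K ^ (1 / 2 : ℝ)) * sobolevNorm r ψ := by
  refine h.trans ?_
  rw [mul_assoc]
  refine mul_le_mul' le_rfl ?_
  rw [add_mul, one_mul, ← rpow_half_mul_sq]
  exact add_le_add le_rfl (ENNReal.rpow_le_rpow hK (by norm_num))

theorem exists_real_const {K : ℝ≥0∞} (hK : K < ⊤) : ∃ C : ℝ, 0 < C ∧ K ≤ ENNReal.ofReal C := by
  refine ⟨K.toReal + 1, by positivity, ?_⟩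
  rw [ENNReal.ofReal_add ENNReal.toReal_nonneg zero_le_one, ENNReal.ofReal_toReal hK.ne]
  exact le_self_add

theorem exists_opL_bound_of_lt (n : ℕ) {s β γ ν₀ : ℝ} (hs : 1 / 2 < s) (hs' : s < 3 / 4)
    (hβ : 0 < β) (hγ : 0 < γ) (hν₀ : 0 < ν₀) :
    ∃ C : ℝ, 0 < C ∧ ∀ ψ : FullSpace n → ℝ, MemH (2 * s + β) ψ →
      (∀ᵐ x ∂(halfVol n), PVExists s ψ x) ∧ MemLp (opL γ ν₀ s ψ) 2 (halfVol n) ∧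
      eLpNorm (opL γ ν₀ s ψ) 2 (halfVol n) ≤
        ENNReal.ofReal C * sobolevNorm (2 * s + β) ψ := by
  -- The exponent τ must exceed 2s − 1 for the regular part and the Hardy sum, stay below 2s − 1 + β
  -- so that the gradient lies in H^τ, and stay below 1/2 so that no trace intervenes; the last is
  -- possible because s < 3/4.
  obtain ⟨τ, hτ, hτ2⟩ := exists_between (show 2 * s - 1 < min (1 / 2) (2 * s - 1 + β) from
    lt_min (by linarith) (by linarith))
  have hτh : τ < 1 / 2 := hτ2.trans_le (min_le_left _ _)
  have hτβ : τ < 2 * s - 1 + β := hτ2.trans_le (min_le_right _ _)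
  obtain ⟨C₁, hC₁, h₁⟩ := exists_opL_estimate n (r := 2 * s + β) hs hτ (by linarith)
    (by linarith) hγ hν₀
  obtain ⟨C₂, hC₂, h₂⟩ := exists_hardy_of_dyadicAvg_le n (σ := 2 * s - 1) (by linarith) hτ
  obtain ⟨C₃, hC₃, h₃⟩ := exists_lintegral_dyadicAvg_sq_le_of_lt_half n
    (by linarith : 0 < τ) hτh
  have hK : C₂ * ((C₃ + 1) * C₁) < ⊤ := ENNReal.mul_lt_top hC₂ (ENNReal.mul_lt_top
    (ENNReal.add_lt_top.2 ⟨hC₃, by simp⟩) hC₁)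
  obtain ⟨C, hC, hCle⟩ := exists_real_const (K := C₁ * (1 + (C₂ * ((C₃ + 1) * C₁)) ^ (1 / 2 : ℝ)))
    (ENNReal.mul_lt_top hC₁ (ENNReal.add_lt_top.2 ⟨by simp,
      ENNReal.rpow_lt_top_of_nonneg (by norm_num) hK.ne⟩))
  refine ⟨C, hC, fun ψ hψ => ?_⟩
  obtain ⟨v, hvm, -, hvH, hvE, hPV, hiff, hbd⟩ := h₁ ψ hψ
  have hv2 := hvH.sqNorm_lt_top
  have hhardy := h₂ v hvm hv2 _ (h₃ v hvm hv2)
  have hS : ∫⁻ x, ENNReal.ofReal (x (Fin.last n) ^ (-(2 * (2 * s - 1)))) * ‖v x‖ₑ ^ 2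
      ∂(halfVol n) ≤ C₂ * ((C₃ + 1) * C₁) * sobolevNorm (2 * s + β) ψ ^ 2 := by
    refine hhardy.trans ?_
    rw [mul_assoc C₂]
    refine mul_le_mul' le_rfl ?_
    calc C₃ * (sqNorm v + gagliardoSq τ v) + sqNorm v + gagliardoSq τ v
        = (C₃ + 1) * (sqNorm v + gagliardoSq τ v) := by ring
      _ ≤ (C₃ + 1) * (C₁ * sobolevNorm (2 * s + β) ψ ^ 2) := mul_le_mul' le_rfl hvE
      _ = _ := by ring
  refine ⟨hPV, hiff.2 (hS.trans_lt (ENNReal.mul_lt_top hK (ENNReal.pow_lt_top hψ.2))), ?_⟩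
  exact (opL_bound_of_hardy hbd hS).trans (mul_le_mul' hCle le_rfl)

theorem eq_zero_of_tendsto_dyadicAvg {n : ℕ} {v : FullSpace n → ℝ} (hv : Measurable v)
    {g : Lp ℝ 2 (volume : Measure (EuclideanSpace ℝ (Fin n)))}
    (h1 : Tendsto (fun k => eLpNorm (fun x' => dyadicAvg k v x' - g x') 2 volume) atTop (𝓝 0))
    (h2 : Tendsto (fun k => ∫⁻ x' : EuclideanSpace ℝ (Fin n), ‖dyadicAvg k v x'‖ₑ ^ 2) atTop
      (𝓝 0)) : g = 0 := by
  have h3 := ((ENNReal.continuous_rpow_const (y := (1 / 2 : ℝ))).tendsto 0).comp h2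
  rw [ENNReal.zero_rpow_of_pos (by norm_num)] at h3
  have h4 := h3.add h1
  rw [add_zero] at h4
  have h5 : eLpNorm g 2 volume ≤ 0 := by
    refine ge_of_tendsto h4 (Eventually.of_forall fun k => ?_)
    have hk := aestronglyMeasurable_dyadicAvg k hv
    have e : (g : EuclideanSpace ℝ (Fin n) → ℝ) =
        dyadicAvg k v - fun x' => dyadicAvg k v x' - g x' := by
      ext x'
      simp
    calc eLpNorm g 2 volume = eLpNorm (dyadicAvg k v - fun x' => dyadicAvg k v x' - g x') 2
          volume := by rw [← e]
      _ ≤ _ := (eLpNorm_sub_le hk (hk.sub (Lp.aestronglyMeasurable g)) one_le_two).trans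
          (le_of_eq (by rw [eLpNorm_two_eq]; rfl))
  exact (Lp.eq_zero_iff_ae_eq_zero).2
    ((eLpNorm_eq_zero_iff (Lp.aestronglyMeasurable g) (by simp)).1 (le_antisymm h5 zero_le))

theorem exists_opL_bound_of_ge (n : ℕ) {s β γ ν₀ : ℝ} (hs : 3 / 4 ≤ s) (hs₁ : s < 1)
    (hβ : 0 < β) (hγ : 0 < γ) (hν₀ : 0 < ν₀) :
    ∃ C : ℝ, 0 < C ∧ ∀ ψ : FullSpace n → ℝ, MemH (2 * s + β) ψ →
      (∀ᵐ x ∂(halfVol n), PVExists s ψ x) ∧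
      (MemLp (opL γ ν₀ s ψ) 2 (halfVol n) ↔
        MemLp (fun x => x (Fin.last n) ^ (1 - 2 * s) * weakPartial (Fin.last n) ψ x) 2
          (halfVol n)) ∧
      (∃! g, HasTrace (2 * s + β - 1) (weakPartial (Fin.last n) ψ) g) ∧
      (MemLp (opL γ ν₀ s ψ) 2 (halfVol n) ↔
        HasTrace (2 * s + β - 1) (weakPartial (Fin.last n) ψ) 0) ∧
      (MemLp (opL γ ν₀ s ψ) 2 (halfVol n) →
        eLpNorm (opL γ ν₀ s ψ) 2 (halfVol n) ≤
          ENNReal.ofReal C * sobolevNorm (2 * s + β) ψ) := by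
  -- Now 2s − 1 ≥ 1/2, so τ > 1/2 automatically and the averages converge; τ < 1 is required by the
  -- Gagliardo embedding.
  obtain ⟨τ, hτ, hτ2⟩ := exists_between (show 2 * s - 1 < min 1 (2 * s - 1 + β) from
    lt_min (by linarith) (by linarith))
  have hτ1 : τ < 1 := hτ2.trans_le (min_le_left _ _)
  have hτβ : τ < 2 * s - 1 + β := hτ2.trans_le (min_le_right _ _)
  have hτh : 1 / 2 < τ := by linarith
  obtain ⟨C₁, hC₁, h₁⟩ := exists_opL_estimate n (r := 2 * s + β) (by linarith) hτ hτ1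
    (by linarith) hγ hν₀
  obtain ⟨C₂, hC₂, h₂⟩ := exists_hardy_of_dyadicAvg_le n (σ := 2 * s - 1) (by linarith) hτ
  obtain ⟨C₃, hC₃, h₃⟩ := exists_trace n (r := 2 * s + β - 1) hτh hτ1 (by linarith)
  have hK : C₂ * ((C₃ ^ 2 + 1) * C₁) < ⊤ := ENNReal.mul_lt_top hC₂ (ENNReal.mul_lt_top
    (ENNReal.add_lt_top.2 ⟨ENNReal.pow_lt_top hC₃, by simp⟩) hC₁)
  obtain ⟨C, hC, hCle⟩ := exists_real_const
    (K := C₁ * (1 + (C₂ * ((C₃ ^ 2 + 1) * C₁)) ^ (1 / 2 : ℝ)))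
    (ENNReal.mul_lt_top hC₁ (ENNReal.add_lt_top.2 ⟨by simp,
      ENNReal.rpow_lt_top_of_nonneg (by norm_num) hK.ne⟩))
  refine ⟨C, hC, fun ψ hψ => ?_⟩
  obtain ⟨v, hvm, hve, hvH, hvE, hPV, hiff, hbd⟩ := h₁ ψ hψ
  have hv2 := hvH.sqNorm_lt_top
  obtain ⟨g, hgk, htr⟩ := h₃ v hvm hvH
  have hvg : gagliardoSq τ v < ⊤ := le_add_self.trans_lt (hvE.trans_lt
    (ENNReal.mul_lt_top hC₁ (ENNReal.pow_lt_top hψ.2)))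
  have hlim : Tendsto (fun k => eLpNorm (fun x' => dyadicAvg k v x' - g x') 2 volume) atTop
      (𝓝 0) :=
    tendsto_of_tendsto_of_tendsto_of_le_of_le tendsto_const_nhds
      (tendsto_const_mul_ofReal_dyadicRatio_pow hτh hC₃ (gag_rpow_lt_top hvg))
      (fun k => zero_le) hgk
  -- The converse Hardy argument needs 2s − 1 ≥ 1/2, which is exactly s ≥ 3/4.
  have hzero : ∫⁻ x, ENNReal.ofReal (x (Fin.last n) ^ (-(2 * (2 * s - 1)))) * ‖v x‖ₑ ^ 2
      ∂(halfVol n) < ⊤ → g = 0 := fun h =>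
    eq_zero_of_tendsto_dyadicAvg hvm hlim
      (tendsto_lintegral_dyadicAvg_sq n (by linarith) hvm h)
  have hS : g = 0 → ∫⁻ x, ENNReal.ofReal (x (Fin.last n) ^ (-(2 * (2 * s - 1)))) * ‖v x‖ₑ ^ 2
      ∂(halfVol n) ≤ C₂ * ((C₃ ^ 2 + 1) * C₁) * sobolevNorm (2 * s + β) ψ ^ 2 := by
    rintro rfl
    -- With g = 0, the rate of convergence of the averages to the trace is a decay rate for the
    -- averages themselves, as the Hardy inequality requires.
    have hA : ∀ k : ℕ, ∫⁻ x', ‖dyadicAvg k v x'‖ₑ ^ 2 ≤ C₃ ^ 2 * gagliardoSq τ v *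
        ENNReal.ofReal (((1 / 2 : ℝ) ^ k) ^ (2 * τ - 1)) := by
      intro k
      refine lintegral_sq_le_of_eLpNorm_le ((le_of_eq (eLpNorm_congr_ae ?_)).trans (hgk k))
      filter_upwards [Lp.coeFn_zero ℝ 2
        (volume : Measure (EuclideanSpace ℝ (Fin n)))] with x' hx'
      rw [hx']
      simp
    refine (h₂ v hvm hv2 _ hA).trans ?_
    rw [mul_assoc C₂]
    refine mul_le_mul' le_rfl ?_
    calc C₃ ^ 2 * gagliardoSq τ v + sqNorm v + gagliardoSq τ v
        ≤ C₃ ^ 2 * (sqNorm v + gagliardoSq τ v) + sqNorm v + gagliardoSq τ v :=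
          add_le_add (add_le_add (mul_le_mul' le_rfl le_add_self) le_rfl) le_rfl
      _ = (C₃ ^ 2 + 1) * (sqNorm v + gagliardoSq τ v) := by ring
      _ ≤ (C₃ ^ 2 + 1) * (C₁ * sobolevNorm (2 * s + β) ψ ^ 2) := mul_le_mul' le_rfl hvE
      _ = _ := by ring
  have htr' : ∀ g', HasTrace (2 * s + β - 1) (weakPartial (Fin.last n) ψ) g' ↔ g' = g :=
    fun g' => (hasTrace_congr hve g').trans (htr g')
  refine ⟨hPV, ?_, ⟨g, (htr' g).2 rfl, fun g' => (htr' g').1⟩, ?_, fun h => ?_⟩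
  · have he : (fun x => x (Fin.last n) ^ (1 - 2 * s) * weakPartial (Fin.last n) ψ x)
        =ᵐ[halfVol n] fun x => x (Fin.last n) ^ (1 - 2 * s) * v x :=
      hve.mono fun x hx => by simp only [hx]
    rw [hiff, memLp_congr_ae he, memLp_two_iff (measurable_weighted s hvm).aestronglyMeasurable,
      lintegral_weighted_sq]
  · rw [hiff, htr']
    exact ⟨fun h => (hzero h).symm, fun h => (hS h.symm).trans_lt
      (ENNReal.mul_lt_top hK (ENNReal.pow_lt_top hψ.2))⟩
  · exact (opL_bound_of_hardy hbd (hS (hzero (hiff.1 h)))).trans (mul_le_mul' hCle le_rfl)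

theorem mainTheorem5 (n : ℕ) (s β γ ν₀ : ℝ) (hs₀ : 1 / 2 < s) (hs₁ : s < 1) (hβ : 0 < β)
    (hγ : 0 < γ) (hν₀ : 0 < ν₀) :
    ∃ C : ℝ, 0 < C ∧ ∀ ψ : FullSpace n → ℝ, MemH (2 * s + β) ψ →
      (∀ᵐ x ∂(halfVol n), PVExists s ψ x) ∧
      (s < 3 / 4 →
        MemLp (opL γ ν₀ s ψ) 2 (halfVol n) ∧
        eLpNorm (opL γ ν₀ s ψ) 2 (halfVol n) ≤
          ENNReal.ofReal C * sobolevNorm (2 * s + β) ψ) ∧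
      (3 / 4 ≤ s →
        (MemLp (opL γ ν₀ s ψ) 2 (halfVol n) ↔
          MemLp (fun x => x (Fin.last n) ^ (1 - 2 * s) * weakPartial (Fin.last n) ψ x) 2
            (halfVol n)) ∧
        (∃! g, HasTrace (2 * s + β - 1) (weakPartial (Fin.last n) ψ) g) ∧
        (MemLp (opL γ ν₀ s ψ) 2 (halfVol n) ↔
          HasTrace (2 * s + β - 1) (weakPartial (Fin.last n) ψ) 0) ∧
        (MemLp (opL γ ν₀ s ψ) 2 (halfVol n) →
          eLpNorm (opL γ ν₀ s ψ) 2 (halfVol n) ≤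
            ENNReal.ofReal C * sobolevNorm (2 * s + β) ψ)) := by
  rcases lt_or_ge s (3 / 4) with h | h
  · obtain ⟨C, hC, hψ⟩ := exists_opL_bound_of_lt n hs₀ h hβ hγ hν₀
    exact ⟨C, hC, fun ψ hm => ⟨(hψ ψ hm).1, fun _ => (hψ ψ hm).2, fun h' => absurd h h'.not_gt⟩⟩
  · obtain ⟨C, hC, hψ⟩ := exists_opL_bound_of_ge n h hs₁ hβ hγ hν₀
    exact ⟨C, hC, fun ψ hm => ⟨(hψ ψ hm).1, fun h' => absurd h' h.not_gt, fun _ => (hψ ψ hm).2⟩⟩
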